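/- **Multi-level contextual LF.** Variables $x^n$ carry a level $n\in\mathbb N$; expressions are taken modulo renaming of bound variables. The syntax is - sorts $s ::= \mathsf{type}\mid\mathsf{kind}$; atomic types/kinds $P,Q ::= s\mid \mathbf a\mid P\,(\hat\Gamma^n.N)$; normal types/kinds $A,B,K ::= P\mid \Pi x^n{:}A[\Gamma^n].B$; - neutral terms $R ::= x^n[\sigma]\mid \mathbf c\mid R\,(\hat\Gamma^n.N)$; normal terms $M,N ::= R\mid \lambda x^n.M$; - substitutions $\sigma,\rho ::= \cdot\mid \sigma,\hat\Gamma^n.M\mid\sigma,x^n$; contexts $\Psi,\Phi,\Gamma ::= \cdot\mid\Psi,x^n{:}A[\Gamma^n]$; signatures $\Sigma$, lists of declarations $\mathbf a{:}K$ and $\mathbf c{:}A$. A superscript on a context, $\Gamma^n$, means that its variables have levels $<n$; $\hat\Gamma$ is the list of its variables. A closure $\hat\Gamma^n.M$ binds all variables of level $<n$ in $M$; in $A[\Gamma^n]$ the context $\Gamma^n$ binds all variables of level $<n$ in $A$. Contexts are sorted by non-increasing level from left to right. $\Psi{\restriction}n$ drops the variables of level $<n$; $\Psi\bowtie\Phi$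 is the stable sorted merge, so $\Psi\bowtie x^n{:}A[\Phi^n]$ places $x^n$ to the right of all variables of level $\ge n$ (it is $\Psi,x^n{:}A[\Phi^n]$ if $\Psi$ has no variable of level $<n$). With the domains $\phi$ of substitutions at hand, $\sigma{\restriction}n$ and $\sigma\bowtie\rho$ are defined in the same way; $\mathrm{id}(\hat\Gamma)$ lists the variables of $\hat\Gamma$. **Approximations.** $\alpha,\beta ::= a\mid\alpha[\gamma]\Rightarrow\beta$ and $\gamma,\phi ::= \cdot\mid\gamma,x^n{:}\alpha[\phi]\mid\gamma,x^n{:}\_$. Erasure is $\mathbf a^-=a$, $(P\,(\hat\Gamma.N))^-=P^-$, $(\Pi x^n{:}A[\Gamma].B)^-=A^-[\Gamma^-]\Rightarrow B^-$, and componentwise on contexts. Write $\alpha\le\beta$ if $\alpha$ occurs in $\beta$, and $\alpha<\phi$ if $\alpha\le\beta$ for some $y{:}\beta[\gamma]$ in $\phi$. **Hereditary substitution.** Let $\theta$ be a single substitution $[\hat\Phi^n.N/x^n]_{\alpha[\phi]}$ or a simultaneous one $[\sigma]_{\phi}$ with domain $\phi$ of level $n$. It is a partial operation, defined by the following clauses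 and undefined otherwise. It avoids capture. It acts inside a closure $\hat\Gamma^k.M$ (and inside the type of $A[\Gamma^k]$) if $k\le n$ in the single case, unchanged, and if $k<n$ in the simultaneous case, as $\sigma{\restriction}k\bowtie\mathrm{id}(\hat\Gamma^k)$; otherwise it leaves this part unchanged. On a context $\Gamma^k$ it acts only through variables of level $\ge k$. Under a binder $y^k$, a simultaneous substitution is extended by $y^k/y^k$ (with approximation $\_$) if $k<n$. Constants are unchanged. A variable in the domain is replaced by its image: $\theta(x^k[\rho])=y^k[\theta\rho]$ if the image is a variable $y^k$, and $\theta(x^k[\rho])=[\theta\rho]_\gamma M:\beta$ if it is $\hat\Gamma^k.M$ and $x^k$ has approximate type $\beta[\gamma]$; entries $x^k$ of substitutions are replaced by the image. Other variables $y^k[\rho]$ become $y^k[\theta\rho]$. If $\theta R=R'$ is neutral, then $\theta(R\,(\hat\Gamma^k.M))=R'\,(\hat\Gamma^k.M')$, where $M'$ is the result for $M$; if $\theta R=\lambda y^k.N':\gamma[\psi]\Rightarrow\beta$, with $\gamma[\psi]\Rightarrow\beta$ occurring in $\alpha[\phi]$ (respectively $<\phi$), then $\theta(R\,(\hat\Gamma^k.M))=[\hat\Gamma^k.M'/y^k]_{\gamma[\psi]}N':\beta$.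 Thus substitution into a neutral term yields a neutral term $R'$ or a normal term with an approximation, $M':\alpha'$; in normal terms the approximation is dropped. All other cases are componentwise. When a subscript is a type or context, its erasure is meant. **Equality.** Types (and contexts) are compared by the least congruence $\equiv$ that identifies, inside substitutions, an entry $x^k$ with its $\eta$-expanded form $\hat\Gamma^k.N$, where $N$ is an $\eta$-expansion of $x^k[\mathrm{id}(\hat\Gamma)]$. **Typing** (over $\Sigma$; each rule is read "conclusion if premises"). - $\Psi\vdash\mathbf a\Rightarrow\Sigma(\mathbf a)$ and $\Psi\vdash\mathbf c\Rightarrow\Sigma(\mathbf c)$. - $\Psi\vdash P\,(\hat\Phi^n.N)\Rightarrow[\hat\Phi^n.N/x^n]_{A[\Phi]}K$ if $\Psi\vdash P\Rightarrow\Pi x^n{:}A[\Phi^n].K$ and $\Psi{\restriction}n\bowtie\Phi^n\vdash N\Leftarrow A$; similarly for $R\,(\hat\Phi^n.N)$. - $\Psi\vdash\mathsf{type}\Leftarrow\mathsf{kind}$; $\Psi\vdash P\Leftarrow\mathsf{type}$ if $\Psi\vdash P\Rightarrow\mathsf{type}$; $\Psi\vdash\Pi x^n{:}A[\Phi^n].B\Leftarrow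 s$ if $\Psi{\restriction}n\bowtie\Phi^n\vdash A\Leftarrow\mathsf{type}$, $\Psi\vdash\Phi^n\ \mathsf{ctx}$ and $\Psi\bowtie x^n{:}A[\Phi^n]\vdash B\Leftarrow s$. - $\Psi\vdash x^n[\sigma]\Rightarrow[\sigma]_\Phi A$ if $\Psi(x^n)=A[\Phi^n]$ and $\Psi\vdash\sigma\Leftarrow\Phi^n$. - $\Psi\vdash R\Leftarrow Q$ if $\Psi\vdash R\Rightarrow P$ and $P\equiv Q$; $\Psi\vdash\lambda x^n.M\Leftarrow\Pi x^n{:}A[\Phi^n].B$ if $\Psi\bowtie x^n{:}A[\Phi^n]\vdash M\Leftarrow B$. - $\Psi\vdash\cdot\Leftarrow\cdot$. If $\Psi\vdash\sigma\Leftarrow\Phi^n$, put $\Gamma'=[\sigma]_\Phi(\Gamma^k)$ and $A'=[\sigma{\restriction}k\bowtie\mathrm{id}(\hat\Gamma^k)]_{\Phi\restriction k\,\bowtie\,\Gamma}A$; then $\Psi\vdash\sigma,\hat\Gamma^k.M\Leftarrow\Phi^n,x^k{:}A[\Gamma^k]$ if $\Psi{\restriction}k\bowtie\Gamma'\vdash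 M\Leftarrow A'$, and $\Psi\vdash\sigma,y^k\Leftarrow\Phi^n,x^k{:}A[\Gamma^k]$ if $\Psi(y^k)\equiv A'[\Gamma']$. - $\Psi\vdash\cdot\ \mathsf{ctx}$; $\Psi\vdash\Phi^n,x^k{:}A[\Gamma^k]\ \mathsf{ctx}$ (at level $n$) if $\Psi\vdash\Phi^n\ \mathsf{ctx}$, $k<n$, all levels in $\Phi$ are $\ge k$, $\Psi{\restriction}n\bowtie\Phi{\restriction}k\bowtie\Gamma^k\vdash A\Leftarrow\mathsf{type}$ and $\Psi{\restriction}n\bowtie\Phi{\restriction}k\vdash\Gamma^k\ \mathsf{ctx}$. $\Sigma$ is well-typed if its names are distinct and each declared $K$ (each $A$) satisfies $\cdot\vdash K\Leftarrow\mathsf{kind}$ ($\cdot\vdash A\Leftarrow\mathsf{type}$) over the preceding declarations. $J$ ranges over $P\Rightarrow K$, $A\Leftarrow s$, $R\Rightarrow C$, $M\Leftarrow C$, $\rho\Leftarrow\Gamma^m$ and $\Gamma^m\ \mathsf{ctx}$. A judgment $M\Leftarrow C$ presupposes that $C$ is a well-formed type, and $\rho\Leftarrow\Gamma^m$ that $\Gamma^m$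 is a well-formed context, in the context of the judgment. **Lemma (Substitution property).** Let $\Sigma$ be well-typed. 1. Let $\Delta$ be a well-formed context and let $\Psi^n,\Phi^n$ be well-formed contexts in $\Delta{\restriction}n$. If $\Delta{\restriction}n\bowtie\Psi^n\vdash\sigma\Leftarrow\Phi^n$ and $\Delta{\restriction}n\bowtie\Phi^n\vdash J$ (with its presupposition), then $\Delta{\restriction}n\bowtie\Psi^n\vdash[\sigma]_\phi J$, where $\phi=\Phi^-$. 2. Let $\Psi$ be a well-formed context, $\Phi^n$ a well-formed context in $\Psi$ and $\Psi{\restriction}n\bowtie\Phi^n\vdash A\Leftarrow\mathsf{type}$. If $\Psi{\restriction}n\bowtie\Phi^n\vdash N\Leftarrow A$ and $\Psi\bowtie x^n{:}A[\Phi^n]\vdash J$ (with its presupposition), then $\Psi\vdash[\hat\Phi^n.N/x^n]_{\alpha[\phi]}J$, where $\alpha=A^-$ and $\phi=\Phi^-$. Here $\Gamma\vdash\theta J$ means that the substitutions of $\theta$ into all constituents of $J$ are defined, with uniquely determined results, and that the judgment about the results is derivable, where synthesized types and kinds are taken up to $\equiv$. For $J=(R\Rightarrow C)$ it means: (a) if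 $\theta R=R'$ is neutral, then $\Gamma\vdash R'\Rightarrow C''$ for some $C''\equiv\theta C$; (b) if $\theta R=M:\alpha'$, then $\Gamma\vdash M\Leftarrow\theta C$ and $\alpha'=(\theta C)^-$. -/

import Mathlib

namespace MLCTT

/-! ### Raw expressions

Expressions are taken modulo renaming of bound variables, by means of de Bruijn indices which are
counted separately for every level: the variable `(k, i)` is the `i`-th most recent variable of
level `k` that is in scope.  A closure `Γ̂ᵏ. M` binds all variables of level `< k` in `M` and none of
level `≥ k`; `λ xᵏ. M` and `Π xᵏ:A[Γᵏ]. B` bind one more variable of level `k`.  In `A[Γᵏ]`, the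
context `Γᵏ` binds all variables of level `< k` in `A`.  The list `Γ̂` of bound variables of a
closure is, modulo renaming, the list of their levels.  In all lists and contexts the most recent
(rightmost) item is the head. -/

inductive Srt where
  | type
  | kind

mutual
/-- Atomic types and kinds `P ::= s | a | P (Γ̂ᵏ. N)`. -/
inductive ATy where
  | sort (s : Srt)
  | con (a : ℕ)
  | app (P : ATy) (k : ℕ) (h : List ℕ) (N : Tm)
/-- Normal types and kinds `A ::= P | Π xᵏ:A[Γᵏ]. B`. -/
inductive Ty where
  | atom (P : ATy)
  | pi (k : ℕ) (A : Ty) (Γ : Ctx) (B : Ty)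
/-- Atomic (neutral) terms `R ::= xᵏ[σ] | c | R (Γ̂ᵏ. N)`. -/
inductive Ne where
  | var (k i : ℕ) (σ : Sbn)
  | con (c : ℕ)
  | app (R : Ne) (k : ℕ) (h : List ℕ) (N : Tm)
/-- Normal terms `M ::= R | λ xᵏ. M`. -/
inductive Tm where
  | ne (R : Ne)
  | lam (k : ℕ) (M : Tm)
/-- Entries `F ::= xᵏ | Γ̂ᵏ. M` of substitutions. -/
inductive Ent where
  | ren (k i : ℕ)
  | clo (k : ℕ) (h : List ℕ) (M : Tm)
/-- Simultaneous substitutions `σ ::= · | σ, F`. -/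
inductive Sbn where
  | nil
  | snoc (σ : Sbn) (F : Ent)
/-- Contexts `Ψ ::= · | Ψ, xᵏ:A[Γᵏ]`. -/
inductive Ctx where
  | nil
  | snoc (Ψ : Ctx) (k : ℕ) (A : Ty) (Γ : Ctx)
end

/-! ### Weakening

`wk l c` makes room for one new variable of level `l` at index `c`. -/

mutual
def ATy.wk (l c : ℕ) : ATy → ATy
  | .sort s => .sort s
  | .con a => .con a
  | .app P k h N => .app (P.wk l c) k h (if k ≤ l then N.wk l c else N)
def Ty.wk (l c : ℕ) : Ty → Ty
  | .atom P => .atom (P.wk l c)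
  | .pi k A Γ B =>
      .pi k (if k ≤ l then A.wk l c else A) (if k ≤ l then Γ.wk l c else Γ)
        (B.wk l (if k = l then c + 1 else c))
def Ne.wk (l c : ℕ) : Ne → Ne
  | .var k i σ => .var k (if k = l ∧ c ≤ i then i + 1 else i) (σ.wk l c)
  | .con a => .con a
  | .app R k h N => .app (R.wk l c) k h (if k ≤ l then N.wk l c else N)
def Tm.wk (l c : ℕ) : Tm → Tm
  | .ne R => .ne (R.wk l c)
  | .lam k M => .lam k (M.wk l (if k = l then c + 1 else c))
def Ent.wk (l c : ℕ) : Ent → Ent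
  | .ren k i => .ren k (if k = l ∧ c ≤ i then i + 1 else i)
  | .clo k h M => .clo k h (if k ≤ l then M.wk l c else M)
def Sbn.wk (l c : ℕ) : Sbn → Sbn
  | .nil => .nil
  | .snoc σ F => .snoc (σ.wk l c) (F.wk l c)
/-- Used only on contexts all of whose variables have level `< l`. -/
def Ctx.wk (l c : ℕ) : Ctx → Ctx
  | .nil => .nil
  | .snoc Ψ k A Γ => .snoc (Ψ.wk l c) k (A.wk l c) (Γ.wk l c)
end

/-! ### Context operations -/

/-- The list `Ψ̂` of the variables declared in `Ψ`. -/
def Ctx.hat : Ctx → List ℕ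
  | .nil => []
  | .snoc Ψ k _ _ => k :: Ψ.hat

/-- Chopping `Ψ↾n`: drop all variables of level `< n` from a sorted context. -/
def Ctx.chop (n : ℕ) : Ctx → Ctx
  | .nil => .nil
  | .snoc Ψ k A Γ => if k < n then Ψ.chop n else .snoc Ψ k A Γ

/-- Insertion `Ψ ⋈ xⁿ:A[Γⁿ]`: the new declaration is placed to the right of all those of level
`≥ n`.  It is `Ψ, xⁿ:A[Γⁿ]` if all variables of `Ψ` have level `≥ n`. -/
def Ctx.ins : Ctx → ℕ → Ty → Ctx → Ctx
  | .nil, n, A, Γ => .snoc .nil n A Γ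
  | .snoc Ψ k B Γ₁, n, A, Γ =>
      if k < n then .snoc (Ψ.ins n A Γ) k (B.wk n 0) (Γ₁.wk n 0)
      else .snoc (.snoc Ψ k B Γ₁) n A Γ

/-- Merging `Ψ ⋈ Φ` of sorted contexts: the declarations of `Φ` are inserted from left to right. -/
def Ctx.merge (Ψ : Ctx) : Ctx → Ctx
  | .nil => Ψ
  | .snoc Φ k A Γ => (Ψ.merge Φ).ins k A Γ

/-- Lookup `Ψ(xᵏ) = A[Γᵏ]` in a sorted context, where `xᵏ` is the variable `(k, i)`.  The type that
was declared is weakened by the variables of level `k` declared since. -/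
def Ctx.lookup (k : ℕ) : ℕ → Ctx → Option (Ty × Ctx)
  | _, .nil => none
  | i, .snoc Ψ k₁ A Γ =>
      if k₁ = k then
        match i with
        | 0 => some (A.wk k 0, Γ.wk k 0)
        | j + 1 => (Ψ.lookup k j).map fun D => (D.1.wk k 0, D.2.wk k 0)
      else Ψ.lookup k i

/-! ### Type and context approximations -/

mutual
/-- Type approximations `α ::= a | α[γ] ⇒ β`.  The approximation `sort s` only serves to make
erasure a total function. -/
inductive Apx where
  | sort (s : Srt)
  | base (a : ℕ)
  | arrow (α : Apx) (γ : CApx) (β : Apx)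
/-- The declared approximation `α[φ]` of a variable, or `_` if it is not available. -/
inductive Slot where
  | known (α : Apx) (φ : CApx)
  | unknown
/-- Context approximations `γ ::= · | γ, xᵏ:α[φ] | γ, xᵏ:_`. -/
inductive CApx where
  | nil
  | snoc (γ : CApx) (k : ℕ) (s : Slot)
end

mutual
def ATy.erase : ATy → Apx
  | .sort s => .sort s
  | .con a => .base a
  | .app P _ _ _ => P.erase
def Ty.erase : Ty → Apx
  | .atom P => P.erase
  | .pi _ A Γ B => .arrow A.erase Γ.erase B.erase
def Ctx.erase : Ctx → CApx
  | .nil => .nil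
  | .snoc Ψ k A Γ => .snoc Ψ.erase k (.known A.erase Γ.erase)
end

mutual
/-- `α ≤ β`: `α` occurs in `β`. -/
inductive Apx.Occ : Apx → Apx → Prop
  | refl (α : Apx) : Apx.Occ α α
  | dom {α β δ : Apx} {ψ : CApx} : Apx.Occ α β → Apx.Occ α (.arrow β ψ δ)
  | ctx {α β δ : Apx} {ψ : CApx} : CApx.Occ α ψ → Apx.Occ α (.arrow β ψ δ)
  | cod {α β δ : Apx} {ψ : CApx} : Apx.Occ α δ → Apx.Occ α (.arrow β ψ δ)
/-- `α < ψ`: `α ≤ β` for some `yᵏ:β[γ]` in `ψ`. -/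
inductive CApx.Occ : Apx → CApx → Prop
  | here {α β : Apx} {ψ γ : CApx} {k : ℕ} :
      Apx.Occ α β → CApx.Occ α (.snoc ψ k (.known β γ))
  | there {α : Apx} {ψ : CApx} {k : ℕ} {s : Slot} : CApx.Occ α ψ → CApx.Occ α (.snoc ψ k s)
end

/-! ### Operations on simultaneous substitutions with their domain `σ/φ` -/

/-- The identity substitution `id(Φ̂)`. -/
def idSbn : List ℕ → Sbn
  | [] => .nil
  | l :: h => .snoc ((idSbn h).wk l 0) (.ren l 0)

/-- The context approximation `x₁:_, …, xᵣ:_` with variables `Φ̂`. -/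
def CApx.ofHat : List ℕ → CApx
  | [] => .nil
  | l :: h => .snoc (CApx.ofHat h) l .unknown

/-- Chopping `(σ/φ)↾n`. -/
def Sbn.chop (n : ℕ) : Sbn → CApx → Sbn
  | .snoc σ F, .snoc φ k _ => if k < n then σ.chop n φ else .snoc σ F
  | _, _ => .nil

def CApx.chop (n : ℕ) : CApx → CApx
  | .nil => .nil
  | .snoc φ k s => if k < n then φ.chop n else .snoc φ k s

/-- Insertion `σ/φ ⋈ F/xⁿ`. -/
def Sbn.ins (n : ℕ) (F : Ent) : Sbn → CApx → Sbn
  | .snoc σ F₁, .snoc φ k _ =>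
      if k < n then .snoc (σ.ins n F φ) F₁ else .snoc (.snoc σ F₁) F
  | σ, _ => .snoc σ F

def CApx.ins (n : ℕ) (s : Slot) : CApx → CApx
  | .nil => .snoc .nil n s
  | .snoc φ k s₁ => if k < n then .snoc (φ.ins n s) k s₁ else .snoc (.snoc φ k s₁) n s

def CApx.merge (ψ : CApx) : CApx → CApx
  | .nil => ψ
  | .snoc φ k s => (ψ.merge φ).ins k s

/-- Merging `σ/ψ ⋈ τ/φ`: the entries of `τ` are inserted from left to right. -/
def Sbn.merge (σ : Sbn) (ψ : CApx) : Sbn → CApx → Sbn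
  | .snoc τ F, .snoc φ k _ => (σ.merge ψ τ φ).ins k F (ψ.merge φ)
  | _, _ => σ

/-- The entry of `σ/φ` for the variable `(k, i)`, with the approximate type of this variable. -/
def Sbn.lookup (k : ℕ) : ℕ → Sbn → CApx → Option (Ent × Slot)
  | i, .snoc σ F, .snoc φ k₁ s =>
      if k₁ = k then
        match i with
        | 0 => some (F, s)
        | j + 1 => σ.lookup k j φ
      else σ.lookup k i φ
  | _, _, _ => none

/-! ### Hereditary substitution

The single and the simultaneous hereditary substitution are defined together, by their graphs. -/

/-- What is substituted:
* `single n c h N α φ` is `[Φ̂ⁿ. N / xⁿ]_{α[φ]}`, where `Φ̂ = h` and `xⁿ` is the variable `(n, c)`;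
* `simul n σ φ` is `[σ]_{φⁿ}`, for a domain `φ` with variables of level `< n`. -/
inductive Sb where
  | single (n c : ℕ) (h : List ℕ) (N : Tm) (α : Apx) (φ : CApx)
  | simul (n : ℕ) (σ : Sbn) (φ : CApx)

/-- The substitution for use under one more bound variable of level `k`.  A simultaneous one is
extended by `yᵏ/yᵏ` at its place if `k < n`. -/
def Sb.under (k : ℕ) : Sb → Sb
  | .single n c h N α φ =>
      .single n (if k = n then c + 1 else c) h (if n ≤ k then N.wk k 0 else N) α φ
  | .simul n σ φ =>
      if k < n then .simul n ((σ.wk k 0).ins k (.ren k 0) φ) (φ.ins k .unknown)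
      else .simul n (σ.wk k 0) φ

/-- Whether the substitution has an effect inside of a closure `Γ̂ᵏ. M`. -/
def Sb.Enters (k : ℕ) : Sb → Prop
  | .single n _ _ _ _ _ => k ≤ n
  | .simul n _ _ => k < n

/-- The substitution for use inside of a closure `Γ̂ᵏ. M`.  A simultaneous one becomes
`σ↾k ⋈ id(Γ̂ᵏ)`. -/
def Sb.enter (k : ℕ) (h : List ℕ) : Sb → Sb
  | .single n c h₁ N α φ => .single n c h₁ N α φ
  | .simul n σ φ =>
      .simul n ((σ.chop k φ).merge (φ.chop k) (idSbn h) (CApx.ofHat h))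
        ((φ.chop k).merge (CApx.ofHat h))

/-- The image of the variable `(k, i)`, with its approximate type. -/
def Sb.img (k i : ℕ) : Sb → Option (Ent × Slot)
  | .single n c h N α φ =>
      if k = n then
        if i = c then some (.clo n h N, .known α φ)
        else if c < i then some (.ren k (i - 1), .unknown)
        else some (.ren k i, .unknown)
      else some (.ren k i, .unknown)
  | .simul n σ φ => if k < n then σ.lookup k i φ else some (.ren k i, .unknown)

/-- The bound on the approximate types of the redices which may be reduced. -/
def Sb.Bounds (α : Apx) : Sb → Prop
  | .single _ _ _ _ β φ => Apx.Occ α β ∨ CApx.Occ α φ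
  | .simul _ _ φ => CApx.Occ α φ

/-- The result of a substitution into a neutral term: `R₁` or `M₁ : α₁`. -/
inductive NeRes where
  | ne (R : Ne)
  | nm (M : Tm) (α : Apx)

mutual
/-- `[θ] P = P₁`. -/
inductive HATy : Sb → ATy → ATy → Prop
  | sort {θ : Sb} (s : Srt) : HATy θ (.sort s) (.sort s)
  | con {θ : Sb} (a : ℕ) : HATy θ (.con a) (.con a)
  | app {θ : Sb} {P P₁ : ATy} {k : ℕ} {h : List ℕ} {N N₁ : Tm} :
      HATy θ P P₁ → HClo θ k h N N₁ → HATy θ (.app P k h N) (.app P₁ k h N₁)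
/-- `[θ] A = A₁`. -/
inductive HTy : Sb → Ty → Ty → Prop
  | atom {θ : Sb} {P P₁ : ATy} : HATy θ P P₁ → HTy θ (.atom P) (.atom P₁)
  | pi {θ : Sb} {k : ℕ} {A A₁ : Ty} {Γ Γ₁ : Ctx} {B B₁ : Ty} :
      HCloTy θ k Γ.hat A A₁ → HCtx θ k Γ Γ₁ → HTy (θ.under k) B B₁ →
      HTy θ (.pi k A Γ B) (.pi k A₁ Γ₁ B₁)
/-- Substitution into the type `A` of `A[Γᵏ]`, where `Γ̂ = h`. -/
inductive HCloTy : Sb → ℕ → List ℕ → Ty → Ty → Prop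
  | act {θ : Sb} {k : ℕ} {h : List ℕ} {A A₁ : Ty} :
      θ.Enters k → HTy (θ.enter k h) A A₁ → HCloTy θ k h A A₁
  | skip {θ : Sb} {k : ℕ} {h : List ℕ} {A : Ty} : ¬ θ.Enters k → HCloTy θ k h A A
/-- `[θ] R = R₁` or `[θ] R = M₁ : α₁`. -/
inductive HNe : Sb → Ne → NeRes → Prop
  | con {θ : Sb} (c : ℕ) : HNe θ (.con c) (.ne (.con c))
  | ren {θ : Sb} {k i k₁ i₁ : ℕ} {σ σ₁ : Sbn} {s : Slot} :
      θ.img k i = some (.ren k₁ i₁, s) → HSbn θ σ σ₁ →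
      HNe θ (.var k i σ) (.ne (.var k₁ i₁ σ₁))
  | clo {θ : Sb} {k i k₁ : ℕ} {σ σ₁ : Sbn} {h : List ℕ} {N N₁ : Tm} {α : Apx} {φ : CApx} :
      θ.img k i = some (.clo k₁ h N, .known α φ) → HSbn θ σ σ₁ → HTm (.simul k σ₁ φ) N N₁ →
      HNe θ (.var k i σ) (.nm N₁ α)
  | app {θ : Sb} {R R₁ : Ne} {k : ℕ} {h : List ℕ} {M M₁ : Tm} :
      HNe θ R (.ne R₁) → HClo θ k h M M₁ → HNe θ (.app R k h M) (.ne (.app R₁ k h M₁))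
  | beta {θ : Sb} {R : Ne} {k : ℕ} {h : List ℕ} {M M₁ N N₁ : Tm} {α β : Apx} {φ : CApx} :
      HNe θ R (.nm (.lam k N) (.arrow α φ β)) → θ.Bounds (.arrow α φ β) → HClo θ k h M M₁ →
      HTm (.single k 0 h M₁ α φ) N N₁ → HNe θ (.app R k h M) (.nm N₁ β)
/-- `[θ] M = M₁`. -/
inductive HTm : Sb → Tm → Tm → Prop
  | ne {θ : Sb} {R R₁ : Ne} : HNe θ R (.ne R₁) → HTm θ (.ne R) (.ne R₁)
  | nm {θ : Sb} {R : Ne} {M : Tm} {α : Apx} : HNe θ R (.nm M α) → HTm θ (.ne R) M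
  | lam {θ : Sb} {k : ℕ} {M M₁ : Tm} : HTm (θ.under k) M M₁ → HTm θ (.lam k M) (.lam k M₁)
/-- Substitution into the term `M` of a closure `Γ̂ᵏ. M`, where `Γ̂ = h`. -/
inductive HClo : Sb → ℕ → List ℕ → Tm → Tm → Prop
  | act {θ : Sb} {k : ℕ} {h : List ℕ} {M M₁ : Tm} :
      θ.Enters k → HTm (θ.enter k h) M M₁ → HClo θ k h M M₁
  | skip {θ : Sb} {k : ℕ} {h : List ℕ} {M : Tm} : ¬ θ.Enters k → HClo θ k h M M
/-- Substitution into an entry of a substitution. -/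
inductive HEnt : Sb → Ent → Ent → Prop
  | ren {θ : Sb} {k i : ℕ} {F : Ent} {s : Slot} :
      θ.img k i = some (F, s) → HEnt θ (.ren k i) F
  | clo {θ : Sb} {k : ℕ} {h : List ℕ} {M M₁ : Tm} :
      HClo θ k h M M₁ → HEnt θ (.clo k h M) (.clo k h M₁)
/-- `[θ] σ = σ₁`. -/
inductive HSbn : Sb → Sbn → Sbn → Prop
  | nil {θ : Sb} : HSbn θ .nil .nil
  | snoc {θ : Sb} {σ σ₁ : Sbn} {F F₁ : Ent} :
      HSbn θ σ σ₁ → HEnt θ F F₁ → HSbn θ (.snoc σ F) (.snoc σ₁ F₁)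
/-- `[θ] (Γᵐ) = Γ₁`: the types in a context `Γᵐ` refer to the surrounding context only through
variables of level `≥ m`. -/
inductive HCtx : Sb → ℕ → Ctx → Ctx → Prop
  | skip {θ : Sb} {m : ℕ} {Γ : Ctx} : ¬ θ.Enters m → HCtx θ m Γ Γ
  | nil {θ : Sb} {m : ℕ} : θ.Enters m → HCtx θ m .nil .nil
  | snoc {θ : Sb} {m k : ℕ} {Γ Γ₁ : Ctx} {A A₁ : Ty} {Φ Φ₁ : Ctx} :
      θ.Enters m → HCtx θ m Γ Γ₁ →
      HCloTy (θ.enter m Γ.hat) k Φ.hat A A₁ → HCtx (θ.enter m Γ.hat) k Φ Φ₁ →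
      HCtx θ m (.snoc Γ k A Φ) (.snoc Γ₁ k A₁ Φ₁)
end

/-! ### Equality of types

Types are compared up to renaming and up to identifying, in substitutions, an entry `xᵏ` with its
`η`-expanded form. -/

/-- `Eta R N`: the normal term `N` is an `η`-expansion of the neutral term `R`. -/
inductive Eta : Ne → Tm → Prop
  | ne (R : Ne) : Eta R (.ne R)
  | lam {R : Ne} {k : ℕ} {h : List ℕ} {N M : Tm} :
      Eta (.var k 0 (idSbn h)) N → Eta (.app (R.wk k 0) k h N) M → Eta R (.lam k M)

mutual
/-- One contraction of an entry `Γ̂ᵏ. N` to `xᵏ`, anywhere in an atomic type. -/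
inductive EATy : ATy → ATy → Prop
  | fn {P P₁ : ATy} {k : ℕ} {h : List ℕ} {N : Tm} :
      EATy P P₁ → EATy (.app P k h N) (.app P₁ k h N)
  | arg {P : ATy} {k : ℕ} {h : List ℕ} {N N₁ : Tm} :
      ETm N N₁ → EATy (.app P k h N) (.app P k h N₁)
inductive ETy : Ty → Ty → Prop
  | atom {P P₁ : ATy} : EATy P P₁ → ETy (.atom P) (.atom P₁)
  | dom {k : ℕ} {A A₁ : Ty} {Γ : Ctx} {B : Ty} : ETy A A₁ → ETy (.pi k A Γ B) (.pi k A₁ Γ B)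
  | ctx {k : ℕ} {A : Ty} {Γ Γ₁ : Ctx} {B : Ty} : ECtx Γ Γ₁ → ETy (.pi k A Γ B) (.pi k A Γ₁ B)
  | cod {k : ℕ} {A : Ty} {Γ : Ctx} {B B₁ : Ty} : ETy B B₁ → ETy (.pi k A Γ B) (.pi k A Γ B₁)
inductive ENe : Ne → Ne → Prop
  | var {k i : ℕ} {σ σ₁ : Sbn} : ESbn σ σ₁ → ENe (.var k i σ) (.var k i σ₁)
  | fn {R R₁ : Ne} {k : ℕ} {h : List ℕ} {N : Tm} :
      ENe R R₁ → ENe (.app R k h N) (.app R₁ k h N)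
  | arg {R : Ne} {k : ℕ} {h : List ℕ} {N N₁ : Tm} :
      ETm N N₁ → ENe (.app R k h N) (.app R k h N₁)
inductive ETm : Tm → Tm → Prop
  | ne {R R₁ : Ne} : ENe R R₁ → ETm (.ne R) (.ne R₁)
  | lam {k : ℕ} {M M₁ : Tm} : ETm M M₁ → ETm (.lam k M) (.lam k M₁)
inductive EEnt : Ent → Ent → Prop
  | contract {k i : ℕ} {h : List ℕ} {N : Tm} :
      Eta (.var k i (idSbn h)) N → EEnt (.clo k h N) (.ren k i)
  | clo {k : ℕ} {h : List ℕ} {M M₁ : Tm} : ETm M M₁ → EEnt (.clo k h M) (.clo k h M₁)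
inductive ESbn : Sbn → Sbn → Prop
  | init {σ σ₁ : Sbn} {F : Ent} : ESbn σ σ₁ → ESbn (.snoc σ F) (.snoc σ₁ F)
  | last {σ : Sbn} {F F₁ : Ent} : EEnt F F₁ → ESbn (.snoc σ F) (.snoc σ F₁)
inductive ECtx : Ctx → Ctx → Prop
  | init {Ψ Ψ₁ : Ctx} {k : ℕ} {A : Ty} {Γ : Ctx} :
      ECtx Ψ Ψ₁ → ECtx (.snoc Ψ k A Γ) (.snoc Ψ₁ k A Γ)
  | type {Ψ : Ctx} {k : ℕ} {A A₁ : Ty} {Γ : Ctx} :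
      ETy A A₁ → ECtx (.snoc Ψ k A Γ) (.snoc Ψ k A₁ Γ)
  | ctx {Ψ : Ctx} {k : ℕ} {A : Ty} {Γ Γ₁ : Ctx} :
      ECtx Γ Γ₁ → ECtx (.snoc Ψ k A Γ) (.snoc Ψ k A Γ₁)
end

/-- Equality of types (and kinds). -/
def Ty.Eqv : Ty → Ty → Prop := Relation.EqvGen ETy

/-- Equality of contexts. -/
def Ctx.Eqv : Ctx → Ctx → Prop := Relation.EqvGen ECtx

/-! ### Typing -/

/-- Declarations of a signature. -/
inductive Decl where
  | ty (a : ℕ) (K : Ty)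
  | tm (c : ℕ) (A : Ty)

/-- Signatures; the most recent declaration is the head. -/
abbrev Sig := List Decl

def Sig.lookupTy (a : ℕ) : Sig → Option Ty
  | [] => none
  | .ty a₁ K :: S => if a₁ = a then some K else Sig.lookupTy a S
  | .tm _ _ :: S => Sig.lookupTy a S

def Sig.lookupTm (c : ℕ) : Sig → Option Ty
  | [] => none
  | .ty _ _ :: S => Sig.lookupTm c S
  | .tm c₁ A :: S => if c₁ = c then some A else Sig.lookupTm c S

/-- The type (as a kind). -/
abbrev Ty.star : Ty := .atom (.sort .type)

mutual
/-- `Ψ ⊢ P ⇒ K`. -/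
inductive ATySyn (S : Sig) : Ctx → ATy → Ty → Prop
  | con {Ψ : Ctx} {a : ℕ} {K : Ty} : S.lookupTy a = some K → ATySyn S Ψ (.con a) K
  | app {Ψ : Ctx} {P : ATy} {n : ℕ} {A : Ty} {Φ : Ctx} {K K₁ : Ty} {N : Tm} :
      ATySyn S Ψ P (.pi n A Φ K) → TmChk S ((Ψ.chop n).merge Φ) N A →
      HTy (.single n 0 Φ.hat N A.erase Φ.erase) K K₁ →
      ATySyn S Ψ (.app P n Φ.hat N) K₁
/-- `Ψ ⊢ A ⇐ s`. -/
inductive TyChk (S : Sig) : Ctx → Ty → Srt → Prop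
  | star {Ψ : Ctx} : TyChk S Ψ Ty.star .kind
  | atom {Ψ : Ctx} {P : ATy} : ATySyn S Ψ P Ty.star → TyChk S Ψ (.atom P) .type
  | pi {Ψ : Ctx} {n : ℕ} {A : Ty} {Φ : Ctx} {B : Ty} {s : Srt} :
      TyChk S ((Ψ.chop n).merge Φ) A .type → CtxWf S Ψ n Φ → TyChk S (Ψ.ins n A Φ) B s →
      TyChk S Ψ (.pi n A Φ B) s
/-- `Ψ ⊢ R ⇒ A`. -/
inductive NeSyn (S : Sig) : Ctx → Ne → Ty → Prop
  | var {Ψ : Ctx} {n i : ℕ} {σ : Sbn} {A A₁ : Ty} {Φ : Ctx} :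
      Ψ.lookup n i = some (A, Φ) → SbnChk S Ψ σ n Φ → HTy (.simul n σ Φ.erase) A A₁ →
      NeSyn S Ψ (.var n i σ) A₁
  | con {Ψ : Ctx} {c : ℕ} {A : Ty} : S.lookupTm c = some A → NeSyn S Ψ (.con c) A
  | app {Ψ : Ctx} {R : Ne} {n : ℕ} {A : Ty} {Φ : Ctx} {B B₁ : Ty} {N : Tm} :
      NeSyn S Ψ R (.pi n A Φ B) → TmChk S ((Ψ.chop n).merge Φ) N A →
      HTy (.single n 0 Φ.hat N A.erase Φ.erase) B B₁ →
      NeSyn S Ψ (.app R n Φ.hat N) B₁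
/-- `Ψ ⊢ M ⇐ A`. -/
inductive TmChk (S : Sig) : Ctx → Tm → Ty → Prop
  | ne {Ψ : Ctx} {R : Ne} {P Q : ATy} :
      NeSyn S Ψ R (.atom P) → Ty.Eqv (.atom P) (.atom Q) → TmChk S Ψ (.ne R) (.atom Q)
  | lam {Ψ : Ctx} {n : ℕ} {M : Tm} {A : Ty} {Φ : Ctx} {B : Ty} :
      TmChk S (Ψ.ins n A Φ) M B → TmChk S Ψ (.lam n M) (.pi n A Φ B)
/-- `Ψ ⊢ σ ⇐ Φⁿ`. -/
inductive SbnChk (S : Sig) : Ctx → Sbn → ℕ → Ctx → Prop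
  | nil {Ψ : Ctx} {n : ℕ} : SbnChk S Ψ .nil n .nil
  | clo {Ψ : Ctx} {σ : Sbn} {n k : ℕ} {Φ Γ Γ₁ : Ctx} {A A₁ : Ty} {M : Tm} :
      SbnChk S Ψ σ n Φ →
      HCtx (.simul n σ Φ.erase) k Γ Γ₁ →
      HTy (.simul n
        ((σ.chop k Φ.erase).merge (Φ.erase.chop k) (idSbn Γ.hat) Γ.erase)
        ((Φ.erase.chop k).merge Γ.erase)) A A₁ →
      TmChk S ((Ψ.chop k).merge Γ₁) M A₁ →
      SbnChk S Ψ (.snoc σ (.clo k Γ.hat M)) n (.snoc Φ k A Γ)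
  | ren {Ψ : Ctx} {σ : Sbn} {n k i : ℕ} {Φ Γ Γ₁ Γ₀ : Ctx} {A A₁ A₀ : Ty} :
      SbnChk S Ψ σ n Φ →
      HCtx (.simul n σ Φ.erase) k Γ Γ₁ →
      HTy (.simul n
        ((σ.chop k Φ.erase).merge (Φ.erase.chop k) (idSbn Γ.hat) Γ.erase)
        ((Φ.erase.chop k).merge Γ.erase)) A A₁ →
      Ψ.lookup k i = some (A₀, Γ₀) → Ty.Eqv A₀ A₁ → Ctx.Eqv Γ₀ Γ₁ →
      SbnChk S Ψ (.snoc σ (.ren k i)) n (.snoc Φ k A Γ)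
/-- `Ψ ⊢ Φⁿ ctx`.  Contexts are sorted: a declaration of level `k` is only appended to declarations
of level `≥ k`. -/
inductive CtxWf (S : Sig) : Ctx → ℕ → Ctx → Prop
  | nil {Ψ : Ctx} {n : ℕ} : CtxWf S Ψ n .nil
  | snoc {Ψ : Ctx} {n k : ℕ} {Φ Γ : Ctx} {A : Ty} :
      CtxWf S Ψ n Φ → k < n → (∀ l ∈ Φ.hat, k ≤ l) →
      TyChk S (((Ψ.chop n).merge (Φ.chop k)).merge Γ) A .type →
      CtxWf S ((Ψ.chop n).merge (Φ.chop k)) k Γ →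
      CtxWf S Ψ n (.snoc Φ k A Γ)
end

/-- Well-typed signatures. -/
inductive Sig.Wf : Sig → Prop
  | nil : Sig.Wf []
  | ty {S : Sig} {a : ℕ} {K : Ty} :
      Sig.Wf S → S.lookupTy a = none → TyChk S .nil K .kind → Sig.Wf (.ty a K :: S)
  | tm {S : Sig} {c : ℕ} {A : Ty} :
      Sig.Wf S → S.lookupTm c = none → TyChk S .nil A .type → Sig.Wf (.tm c A :: S)

/-! ### Judgments -/

/-- The judgments `J` which may stand to the right of `Ψ ⊢`. -/
inductive Judgment where
  | atySyn (P : ATy) (K : Ty)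
  | tyChk (A : Ty) (s : Srt)
  | neSyn (R : Ne) (A : Ty)
  | tmChk (M : Tm) (A : Ty)
  | sbnChk (σ : Sbn) (m : ℕ) (Γ : Ctx)
  | ctxWf (m : ℕ) (Γ : Ctx)

/-- `Ψ ⊢ J`. -/
def Holds (S : Sig) (Ψ : Ctx) : Judgment → Prop
  | .atySyn P K => ATySyn S Ψ P K
  | .tyChk A s => TyChk S Ψ A s
  | .neSyn R A => NeSyn S Ψ R A
  | .tmChk M A => TmChk S Ψ M A
  | .sbnChk σ m Γ => SbnChk S Ψ σ m Γ
  | .ctxWf m Γ => CtxWf S Ψ m Γ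

/-- The presupposition of a checking judgment: the type, or context, which is checked against is
well-formed. -/
def Presupposed (S : Sig) (Ψ : Ctx) : Judgment → Prop
  | .tmChk _ A => TyChk S Ψ A .type
  | .sbnChk _ m Γ => CtxWf S Ψ m Γ
  | _ => True

/-- The partial operation with graph `p` is defined and single-valued, and `x` is its value. -/
def IsValue {X : Type} (p : X → Prop) (x : X) : Prop := ∀ y, p y ↔ y = x

/-- `Ψ ⊢ [θ] J`.  All substitutions into the parts of `J` have to be defined.  Synthesized types are
taken up to equality of types.  If the subject of a synthesis judgment for terms becomes a normal
term, then this term checks against the type. -/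
def HoldsSubst (S : Sig) (Ψ : Ctx) (θ : Sb) : Judgment → Prop
  | .atySyn P K => ∃ P₁ K₁ K₂, IsValue (HATy θ P) P₁ ∧ IsValue (HTy θ K) K₁ ∧
      ATySyn S Ψ P₁ K₂ ∧ Ty.Eqv K₂ K₁
  | .tyChk A s => ∃ A₁, IsValue (HTy θ A) A₁ ∧ TyChk S Ψ A₁ s
  | .neSyn R C => ∃ r C₁, IsValue (HNe θ R) r ∧ IsValue (HTy θ C) C₁ ∧
      match r with
      | .ne R₁ => ∃ C₂, NeSyn S Ψ R₁ C₂ ∧ Ty.Eqv C₂ C₁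
      | .nm M α => TmChk S Ψ M C₁ ∧ α = C₁.erase
  | .tmChk M C => ∃ M₁ C₁, IsValue (HTm θ M) M₁ ∧ IsValue (HTy θ C) C₁ ∧ TmChk S Ψ M₁ C₁
  | .sbnChk σ m Γ => ∃ σ₁ Γ₁, IsValue (HSbn θ σ) σ₁ ∧ IsValue (HCtx θ m Γ) Γ₁ ∧
      SbnChk S Ψ σ₁ m Γ₁
  | .ctxWf m Γ => ∃ Γ₁, IsValue (HCtx θ m Γ) Γ₁ ∧ CtxWf S Ψ m Γ₁

end MLCTT

/-!
Both kinds of substitution are morphisms of contexts: they take the variables of one context to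
entries that are well-typed over another one.  The theorem says that morphisms preserve all
judgments.

*Trees and environments.*  All categories of expressions are embedded into one type `X` of trees, and
substitutions are replaced by environments, functions from variables (level and index) to entries.
Passing a binder or entering a closure are then pointwise operations on functions (`under`, `enterE`),
and `Sub` is the graph of hereditary substitution by an environment.

*Simple typing.*  If the dependencies in types are erased, typing becomes `Has`.  Let `b` bound the
sizes of the declarations of all variables which an environment replaces by closures.  The
instantiation of the body of such a closure, and the reduction of a redex which arises, are
substitutions with bounds less than `b`.  Therefore induction on `b`, and then on derivations, shows
that hereditary substitution is defined and preserves simple types (`Sub.total`), that it commutes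
with itself (`Sub.comp`), and that it respects contraction of entries (`Sub.resp`).  By `Sub.graph`,
its values are those of the substitution on expressions; there, the bound on the types of redices is
always met.

*Equality.*  `X.nf` contracts every entry which is an expansion of a variable.  Two types are equal if
and only if their trees have the same normal form (`Ty.eqv_iff`), so that equality is respected by
substitution and preserves erasure.

*Dependent typing.*  Well-typed expressions are simply typed (`TmChk.has` and its companions), so that
the above applies to them.  A morphism `Mor` of bound `b` preserves all judgments, by induction on `b`
and then on derivations (`TmChk.sub` and its companions): if a variable is replaced by a closure, or if
a redex arises, the result is obtained from a well-typed term by a morphism of smaller bound.  The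
types in the results agree only up to equality; therefore the statement for terms allows any type
equal to the result of the substitution.  Its case of bound `0`, where variables are only renamed, thus
contains both weakening, which is needed to take morphisms with closures under binders
(`TmPres.weakens`), and conversion.  Finally, `Mor.inst` and `Mor.single` show that well-typed
substitutions are morphisms, and `Mor.holdsSubst` returns to the judgments of the theorem.
-/

namespace MLCTT

/-! ### Functions of levels and indices -/

/-- Extension of a function of variables `(l, i)` by a value for a new most recent variable of
level `k`. -/
def cons {α : Type*} (k : ℕ) (a : α) (f : ℕ → ℕ → α) : ℕ → ℕ → α := fun l i =>
  if l = k then (match i with | 0 => a | j + 1 => f l j) else f l i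

/-- The index of a variable after one more variable of level `k` has been introduced. -/
def shift (k l i : ℕ) : ℕ := if l = k then i + 1 else i

/-- `f` on the levels `< k` and `g` on the others. -/
def belowOr {α : Type*} (k : ℕ) (f g : ℕ → ℕ → α) : ℕ → ℕ → α := fun l i =>
  if l < k then f l i else g l i

@[simp] theorem cons_zero {α : Type*} (k : ℕ) (a : α) (f : ℕ → ℕ → α) : cons k a f k 0 = a := by
  simp [cons]

@[simp] theorem cons_shift {α : Type*} (k : ℕ) (a : α) (f : ℕ → ℕ → α) (l i : ℕ) :
    cons k a f l (shift k l i) = f l i := by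
  by_cases h : l = k <;> simp [cons, shift, h]

theorem cons_ne {α : Type*} {k l : ℕ} (h : l ≠ k) (a : α) (f : ℕ → ℕ → α) (i : ℕ) :
    cons k a f l i = f l i := by
  simp [cons, h]

theorem shift_ne {k l : ℕ} (h : l ≠ k) (i : ℕ) : shift k l i = i := by
  simp [shift, h]

theorem index_cases (k l i : ℕ) : (l = k ∧ i = 0) ∨ ∃ j, i = shift k l j := by
  by_cases h : l = k
  · cases i with
    | zero => exact .inl ⟨h, rfl⟩
    | succ j => exact .inr ⟨j, by simp [shift, h]⟩
  · exact .inr ⟨i, by simp [shift, h]⟩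

theorem index_ext {α : Type*} (k : ℕ) {f g : ℕ → ℕ → α} (h0 : f k 0 = g k 0)
    (h1 : ∀ l i, f l (shift k l i) = g l (shift k l i)) : f = g := by
  funext l i
  rcases index_cases k l i with ⟨rfl, rfl⟩ | ⟨j, rfl⟩
  · exact h0
  · exact h1 l j

theorem belowOr_lt {α : Type*} {k l : ℕ} (h : l < k) (f g : ℕ → ℕ → α) (i : ℕ) :
    belowOr k f g l i = f l i := by simp [belowOr, h]

theorem belowOr_ge {α : Type*} {k l : ℕ} (h : k ≤ l) (f g : ℕ → ℕ → α) (i : ℕ) :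
    belowOr k f g l i = g l i := by simp [belowOr, Nat.not_lt.2 h]

/-! ### Trees -/

/-- Labels of the leaves of trees. -/
inductive Lbl where
  | nil
  | tm (c : ℕ)
  | ty (a : ℕ)
  | srt (s : Srt)

/-- Trees, into which all syntactic categories are embedded.  Variables, entries, closures and
abstractions have constructors of their own; the remaining structure is given by pairs and labels.
The flag of a closure is `true` for the entries of substitutions, which may be
`η`-contracted, and `false` for all other closures. -/
inductive X where
  | leaf (l : Lbl)
  | var (k i : ℕ) (σ : X)
  | ren (k i : ℕ)
  | clo (e : Bool) (k : ℕ) (h : List ℕ) (M : X)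
  | lam (k : ℕ) (M : X)
  | app (R F : X)
  | pair (A B : X)

/-- A renaming under one more bound variable of level `k`. -/
def lift (k : ℕ) (ρ : ℕ → ℕ → ℕ) : ℕ → ℕ → ℕ := cons k 0 fun l i => shift k l (ρ l i)

/-- A renaming inside of a closure which binds the levels `< k`. -/
def enterR (k : ℕ) (ρ : ℕ → ℕ → ℕ) : ℕ → ℕ → ℕ := belowOr k (fun _ i => i) ρ

/-- The action of a renaming on a tree.  Renamings change the indices of variables and keep their
levels. -/
def X.rename (ρ : ℕ → ℕ → ℕ) : X → X
  | .leaf l => .leaf l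
  | .var k i σ => .var k (ρ k i) (σ.rename ρ)
  | .ren k i => .ren k (ρ k i)
  | .clo e k h M => .clo e k h (M.rename (enterR k ρ))
  | .lam k M => .lam k (M.rename (lift k ρ))
  | .app R F => .app (R.rename ρ) (F.rename ρ)
  | .pair A B => .pair (A.rename ρ) (B.rename ρ)

@[simp] theorem lift_zero (k : ℕ) (ρ : ℕ → ℕ → ℕ) : lift k ρ k 0 = 0 := by simp [lift]

@[simp] theorem lift_shift (k : ℕ) (ρ : ℕ → ℕ → ℕ) (l i : ℕ) :
    lift k ρ l (shift k l i) = shift k l (ρ l i) := by simp [lift]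

theorem lift_comp (k : ℕ) (ρ ρ' : ℕ → ℕ → ℕ) :
    (fun l i => lift k ρ' l (lift k ρ l i)) = lift k (fun l i => ρ' l (ρ l i)) :=
  index_ext k (by simp) (by simp)

theorem lift_id (k : ℕ) : lift k (fun _ i => i) = fun _ i => i :=
  index_ext k (by simp) (by simp)

theorem enterR_comp (k : ℕ) (ρ ρ' : ℕ → ℕ → ℕ) :
    (fun l i => enterR k ρ' l (enterR k ρ l i)) = enterR k (fun l i => ρ' l (ρ l i)) := by
  funext l i; by_cases h : l < k <;> simp [enterR, belowOr, h]

theorem enterR_id (k : ℕ) : enterR k (fun _ i => i) = fun _ i => i := by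
  funext l i; simp [enterR, belowOr]

theorem X.rename_rename (M : X) : ∀ ρ ρ' : ℕ → ℕ → ℕ,
    (M.rename ρ).rename ρ' = M.rename (fun l i => ρ' l (ρ l i)) := by
  induction M <;> intro ρ ρ' <;> simp_all [X.rename, lift_comp, enterR_comp]

theorem X.rename_id (M : X) : M.rename (fun _ i => i) = M := by
  induction M <;> simp_all [X.rename, lift_id, enterR_id]

/-- Weakening by one most recent variable of level `k`. -/
abbrev X.weak (k : ℕ) (M : X) : X := M.rename (shift k)

theorem X.weak_rename (k : ℕ) (ρ : ℕ → ℕ → ℕ) (M : X) :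
    (M.weak k).rename (lift k ρ) = (M.rename ρ).weak k := by
  simp [X.weak, X.rename_rename]

/-- `F` is an entry for a variable of level `k`. -/
inductive Lv (k : ℕ) : X → Prop
  | ren (i : ℕ) : Lv k (.ren k i)
  | clo (h : List ℕ) (M : X) : Lv k (.clo true k h M)

theorem enterR_congr {k : ℕ} {ρ ρ' : ℕ → ℕ → ℕ} (h : ∀ l i, k ≤ l → ρ l i = ρ' l i) :
    enterR k ρ = enterR k ρ' := by
  funext l i
  rcases Nat.lt_or_ge l k with hl | hl
  · simp [enterR, belowOr, hl]
  · simp [enterR, belowOr_ge hl, h l i hl]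

theorem Lv.rename {k : ℕ} {F : X} (h : Lv k F) (ρ : ℕ → ℕ → ℕ) : Lv k (F.rename ρ) := by
  cases h <;> simp only [X.rename] <;> constructor

theorem Lv.of_rename {k : ℕ} {F : X} {ρ : ℕ → ℕ → ℕ} (h : Lv k (F.rename ρ)) : Lv k F := by
  cases F with
  | ren l i => simp only [X.rename] at h; cases h; constructor
  | clo e l h' M => simp only [X.rename] at h; cases h; constructor
  | _ => simp only [X.rename] at h; cases h

theorem Lv.rename_congr {k : ℕ} {F : X} (h : Lv k F) {ρ ρ' : ℕ → ℕ → ℕ}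
    (hρ : ∀ l i, k ≤ l → ρ l i = ρ' l i) : F.rename ρ = F.rename ρ' := by
  cases h with
  | ren i => simp [X.rename, hρ k i le_rfl]
  | clo h M => simp [X.rename, enterR_congr hρ]

/-! ### Environments and hereditary substitution on trees -/

/-- Environments assign entries to variables. -/
abbrev Env := ℕ → ℕ → X

/-- The identity environment. -/
def idE : Env := fun k i => .ren k i

/-- An environment under one more bound variable of level `k`. -/
def under (k : ℕ) (θ : Env) : Env := cons k (.ren k 0) fun l i => (θ l i).weak k

/-- An environment inside of a closure which binds the levels `< k`. -/
def enterE (k : ℕ) (θ : Env) : Env := belowOr k idE θ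

/-- The components of a pair; every other tree has the components of an empty substitution. -/
def X.fst : X → X
  | .pair A _ => A
  | _ => .leaf .nil

/-- The second component, with the convention of `X.fst`. -/
def X.snd : X → X
  | .pair _ B => B
  | _ => .leaf .nil

/-- The environment of a simultaneous substitution `σ` for the variables `h` of levels `< n`.
The leaf at variables outside of the domain is a value on which no rule of `Sub` acts. -/
def inst (n : ℕ) : List ℕ → X → Env
  | [], _ => belowOr n (fun _ _ => .leaf .nil) idE
  | l :: h, σ => cons l σ.snd (inst n h σ.fst)

/-- The environment of the single substitution of `ĥᵏ. N` for the most recent variable of level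
`k`. -/
def single (k : ℕ) (h : List ℕ) (N : X) : Env := cons k (.clo true k h N) idE

/-- Whether the tree is an abstraction. -/
def X.isLam : X → Bool
  | .lam _ _ => true
  | _ => false

/-- The graph of hereditary substitution on trees.  Redices are reduced without any bound on their
approximate types. -/
inductive Sub : Env → X → X → Prop
  | leaf {θ : Env} (l : Lbl) : Sub θ (.leaf l) (.leaf l)
  | vren {θ : Env} {k i i' : ℕ} {σ σ' : X} :
      θ k i = .ren k i' → Sub θ σ σ' → Sub θ (.var k i σ) (.var k i' σ')
  | vclo {θ : Env} {k i : ℕ} {h : List ℕ} {σ σ' N N' : X} :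
      θ k i = .clo true k h N → (∀ l ∈ h, l < k) → Sub θ σ σ' → Sub (inst k h σ') N N' →
      Sub θ (.var k i σ) N'
  | ren {θ : Env} {k i : ℕ} {F : X} : θ k i = F → Lv k F → Sub θ (.ren k i) F
  | clo {θ : Env} {e : Bool} {k : ℕ} {h : List ℕ} {M M' : X} :
      Sub (enterE k θ) M M' → Sub θ (.clo e k h M) (.clo e k h M')
  | lam {θ : Env} {k : ℕ} {M M' : X} : Sub (under k θ) M M' → Sub θ (.lam k M) (.lam k M')
  | app {θ : Env} {R R' F F' : X} :
      Sub θ R R' → R'.isLam = false → Sub θ F F' → Sub θ (.app R F) (.app R' F')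
  | beta {θ : Env} {R F B B' N : X} {k : ℕ} {h : List ℕ} :
      Sub θ R (.lam k B) → Sub θ F (.clo false k h N) → Sub (single k h N) B B' →
      Sub θ (.app R F) B'
  | pair {θ : Env} {A A' B B' : X} : Sub θ A A' → Sub θ B B' → Sub θ (.pair A B) (.pair A' B')

/-- Hereditary substitution is single-valued. -/
theorem Sub.det {θ : Env} {M Y : X} (h : Sub θ M Y) : ∀ {Z : X}, Sub θ M Z → Y = Z := by
  induction h with
  | leaf l => intro Z h; cases h; rfl
  | vren h1 _ ih =>
    intro Z h; cases h with
    | vren h2 h3 => rw [h1] at h2; cases h2; rw [ih h3]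
    | vclo h2 => rw [h1] at h2; cases h2
  | vclo h1 _ _ _ ih1 ih2 =>
    intro Z h; cases h with
    | vren h2 => rw [h1] at h2; cases h2
    | vclo h2 _ h3 h4 => rw [h1] at h2; cases h2; cases ih1 h3; exact ih2 h4
  | ren h1 => intro Z h; cases h with | ren h2 => exact h1.symm.trans h2
  | clo _ ih => intro Z h; cases h with | clo h => rw [ih h]
  | lam _ ih => intro Z h; cases h with | lam h => rw [ih h]
  | app _ h2 _ ih1 ih2 =>
    intro Z h; cases h with
    | app h3 _ h5 => rw [ih1 h3, ih2 h5]
    | beta h3 => rw [ih1 h3] at h2; cases h2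
  | beta _ _ _ ih1 ih2 ih3 =>
    intro Z h; cases h with
    | app h3 h4 => rw [← ih1 h3] at h4; cases h4
    | beta h3 h4 h5 => cases ih1 h3; cases ih2 h4; exact ih3 h5
  | pair _ _ ih1 ih2 => intro Z h; cases h with | pair h3 h4 => rw [ih1 h3, ih2 h4]

@[simp] theorem under_zero (k : ℕ) (θ : Env) : under k θ k 0 = .ren k 0 := by simp [under]

@[simp] theorem under_shift (k : ℕ) (θ : Env) (l i : ℕ) :
    under k θ l (shift k l i) = (θ l i).weak k := by simp [under]

@[simp] theorem single_zero (k : ℕ) (h : List ℕ) (N : X) :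
    single k h N k 0 = .clo true k h N := by simp [single]

@[simp] theorem single_shift (k : ℕ) (h : List ℕ) (N : X) (l i : ℕ) :
    single k h N l (shift k l i) = .ren l i := by simp [single, idE]

/-- Renamings `ρ` and `ρ'` of the source and the target transform `θ` into `θ'`. -/
def Equi (ρ ρ' : ℕ → ℕ → ℕ) (θ θ' : Env) : Prop :=
  ∀ k i, Lv k (θ k i) → θ' k (ρ k i) = (θ k i).rename ρ'

theorem Equi.enter {ρ ρ' : ℕ → ℕ → ℕ} {θ θ' : Env} (h : Equi ρ ρ' θ θ') (k : ℕ) :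
    Equi (enterR k ρ) (enterR k ρ') (enterE k θ) (enterE k θ') := by
  intro l i hl
  rcases Nat.lt_or_ge l k with hlk | hlk
  · simp [enterE, enterR, belowOr_lt hlk, idE, X.rename]
  · simp only [enterE, enterR, belowOr_ge hlk] at hl ⊢
    rw [h l i hl]
    exact hl.rename_congr fun m j hm => (belowOr_ge (hlk.trans hm) _ _ _).symm

theorem Equi.under {ρ ρ' : ℕ → ℕ → ℕ} {θ θ' : Env} (h : Equi ρ ρ' θ θ') (k : ℕ) :
    Equi (lift k ρ) (lift k ρ') (under k θ) (under k θ') := by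
  intro l i hl
  rcases index_cases k l i with ⟨rfl, rfl⟩ | ⟨j, rfl⟩
  · simp [X.rename]
  · simp only [under_shift, lift_shift] at hl ⊢
    rw [h l j hl.of_rename, X.weak_rename]

theorem X.fst_rename (σ : X) (ρ : ℕ → ℕ → ℕ) : (σ.rename ρ).fst = σ.fst.rename ρ := by
  cases σ <;> rfl

theorem X.snd_rename (σ : X) (ρ : ℕ → ℕ → ℕ) : (σ.rename ρ).snd = σ.snd.rename ρ := by
  cases σ <;> rfl

/-- A renaming of the entries of `σ` concerns the source of the environment of `σ` only through the
variables of levels `≥ n`. -/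
theorem Equi.inst {n : ℕ} (ρ : ℕ → ℕ → ℕ) : ∀ (h : List ℕ) (σ : X), (∀ l ∈ h, l < n) →
    Equi (enterR n ρ) ρ (inst n h σ) (inst n h (σ.rename ρ))
  | [], σ, _ => by
    intro l i hl
    rcases Nat.lt_or_ge l n with hln | hln
    · simp only [MLCTT.inst, belowOr_lt hln] at hl; cases hl
    · simp [MLCTT.inst, enterR, belowOr_ge hln, idE, X.rename]
  | m :: h, σ, hh => by
    have ih := Equi.inst ρ h σ.fst (fun l hl => hh l (List.mem_cons_of_mem _ hl))
    have hm := hh m List.mem_cons_self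
    intro l i hl
    simp only [MLCTT.inst, X.fst_rename, X.snd_rename] at hl ⊢
    rcases index_cases m l i with ⟨rfl, rfl⟩ | ⟨j, rfl⟩
    · simp [enterR, belowOr_lt hm]
    · rw [cons_shift] at hl ⊢
      have e : enterR n ρ l (shift m l j) = shift m l (enterR n ρ l j) := by
        rcases Nat.lt_or_ge l n with hln | hln
        · simp [enterR, belowOr_lt hln]
        · rw [shift_ne (by omega), shift_ne (by omega)]
      rw [e, cons_shift, ih l j hl]

theorem Equi.single (ρ : ℕ → ℕ → ℕ) (k : ℕ) (h : List ℕ) (N : X) :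
    Equi (lift k ρ) ρ (single k h N) (single k h (N.rename (enterR k ρ))) := by
  intro l i hl
  rcases index_cases k l i with ⟨rfl, rfl⟩ | ⟨j, rfl⟩
  · simp [X.rename]
  · simp [X.rename]

theorem isLam_rename (M : X) (ρ : ℕ → ℕ → ℕ) : (M.rename ρ).isLam = M.isLam := by
  cases M <;> rfl

/-- Hereditary substitution commutes with renamings of its source and of its target. -/
theorem Sub.rename {θ : Env} {M Y : X} (h : Sub θ M Y) :
    ∀ {ρ ρ' : ℕ → ℕ → ℕ} {θ' : Env}, Equi ρ ρ' θ θ' → Sub θ' (M.rename ρ) (Y.rename ρ') := by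
  induction h with
  | leaf l => intro ρ ρ' θ' _; exact .leaf l
  | @vren θ k i i' σ σ' h1 _ ih =>
    intro ρ ρ' θ' he
    refine .vren ?_ (ih he)
    rw [he k i (by rw [h1]; constructor), h1]; rfl
  | @vclo θ k i hh σ σ' N N' h1 h2 _ _ ih1 ih2 =>
    intro ρ ρ' θ' he
    refine .vclo (h := hh) (N := N.rename (enterR k ρ')) ?_ h2 (ih1 he) (ih2 (Equi.inst ρ' _ _ h2))
    rw [he k i (by rw [h1]; constructor), h1]; rfl
  | @ren θ k i F h1 h2 =>
    intro ρ ρ' θ' he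
    refine .ren ?_ (h2.rename ρ')
    rw [he k i (by rw [h1]; exact h2), h1]
  | clo _ ih => intro ρ ρ' θ' he; exact .clo (ih (he.enter _))
  | lam _ ih => intro ρ ρ' θ' he; exact .lam (ih (he.under _))
  | app _ h2 _ ih1 ih2 =>
    intro ρ ρ' θ' he
    exact .app (ih1 he) (by rw [isLam_rename]; exact h2) (ih2 he)
  | beta _ _ _ ih1 ih2 ih3 =>
    intro ρ ρ' θ' he
    exact .beta (ih1 he) (ih2 he) (ih3 (Equi.single ρ' _ _ _))
  | pair _ _ ih1 ih2 => intro ρ ρ' θ' he; exact .pair (ih1 he) (ih2 he)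

theorem Sub.weak {θ : Env} {M Y : X} (h : Sub θ M Y) (k : ℕ) :
    Sub (under k θ) (M.weak k) (Y.weak k) :=
  h.rename fun l i _ => by simp

theorem Sub.congr {θ θ' : Env} {M Y : X} (h : Sub θ M Y) (he : ∀ k i, θ k i = θ' k i) :
    Sub θ' M Y := by
  have : θ = θ' := by funext k i; exact he k i
  exact this ▸ h

/-- An entry depends only on the variables of its own and of higher levels. -/
theorem Sub.enter_of_lv {θ θ' : Env} {F F' : X} {l : ℕ} (h : Sub θ F F') (hl : Lv l F)
    (he : ∀ m i, l ≤ m → θ' m i = θ m i) : Sub θ' F F' := by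
  cases hl with
  | ren i => cases h with | ren h1 h2 => exact .ren ((he _ _ le_rfl).trans h1) h2
  | clo hh M =>
    cases h with
    | clo h =>
      refine .clo (h.congr fun m i => ?_)
      rcases Nat.lt_or_ge m l with hm | hm
      · simp [enterE, belowOr_lt hm]
      · simp [enterE, belowOr_ge hm, he m i hm]

/-! ### Simple types -/

/-- Simple types and simple contexts.  They refine approximations: a function type records the
level of its argument. -/
inductive T where
  | base (l : Lbl)
  | arrow (k : ℕ) (α φ β : T)
  | nil
  | snoc (φ : T) (k : ℕ) (α ψ : T)

/-- The levels of the variables of a simple context. -/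
def T.hat : T → List ℕ
  | .snoc φ k _ _ => k :: φ.hat
  | _ => []

/-- Assignments of simple types `α[φ]` to variables. -/
abbrev SCtx := ℕ → ℕ → Option (T × T)

/-- A simple context as an assignment of declarations to its variables. -/
def T.get : T → SCtx
  | .snoc φ k α ψ => cons k (some (α, ψ)) φ.get
  | _ => fun _ _ => none

/-- `α.Ok none` means that `α` is a simple type, and `φ.Ok (some n)` that `φ` is a simple context
with variables of levels `< n`; in both cases, every context `φᵏ` inside has variables of levels
`< k`. -/
def T.Ok : T → Option ℕ → Prop
  | .base _, none => True
  | .arrow k α φ β, none => α.Ok none ∧ φ.Ok (some k) ∧ β.Ok none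
  | .nil, some _ => True
  | .snoc φ k α ψ, some n => φ.Ok (some n) ∧ k < n ∧ α.Ok none ∧ ψ.Ok (some k)
  | _, _ => False

/-- The size of a simple type.  The size of a declaration `α[φ]` is `α.size + φ.size + 1`; it is
smaller than the size of every function type with argument `α[φ]` and of every simple context which
contains the declaration. -/
def T.size : T → ℕ
  | .base _ => 0
  | .arrow _ α φ β => α.size + φ.size + β.size + 2
  | .nil => 0
  | .snoc φ _ α ψ => φ.size + α.size + ψ.size + 2

theorem T.Ok.lt {φ : T} {n : ℕ} (h : φ.Ok (some n)) : ∀ l ∈ φ.hat, l < n := by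
  induction φ with
  | snoc φ k α ψ ih _ _ =>
    intro l hl
    simp only [T.hat, List.mem_cons] at hl
    rcases hl with rfl | hl
    · exact h.2.1
    · exact ih h.1 l hl
  | _ => intro l hl; simp [T.hat] at hl

theorem T.get_mem {φ α ψ : T} {l i : ℕ} (h : φ.get l i = some (α, ψ)) : l ∈ φ.hat := by
  induction φ generalizing i with
  | snoc φ k α ψ ih _ _ =>
    simp only [T.get] at h
    rcases index_cases k l i with ⟨rfl, rfl⟩ | ⟨j, rfl⟩
    · simp [T.hat]
    · rw [cons_shift] at h; exact List.mem_cons_of_mem _ (ih h)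
  | _ => simp [T.get] at h

theorem T.get_size {φ α ψ : T} {l i : ℕ} (h : φ.get l i = some (α, ψ)) :
    α.size + ψ.size + 1 ≤ φ.size := by
  induction φ generalizing i with
  | snoc φ k α ψ ih _ _ =>
    simp only [T.get] at h
    rcases index_cases k l i with ⟨rfl, rfl⟩ | ⟨j, rfl⟩
    · rw [cons_zero] at h; cases h; simp only [T.size]; omega
    · rw [cons_shift] at h; have := ih h; simp only [T.size]; omega
  | _ => simp [T.get] at h

/-! ### Simple typing of trees -/

/-- The forms of simple typing judgments. -/
inductive J where
  /-- `R ⇒ α` -/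
  | syn (α : T)
  /-- `M ⇐ α` -/
  | chk (α : T)
  /-- a closure or an entry for a variable `xᵏ:α[φ]` -/
  | ent (e : Bool) (k : ℕ) (α φ : T)
  /-- `σ ⇐ φ` -/
  | sbn (φ : T)
  /-- an atomic type with head `l` and a kind of erasure `κ` -/
  | asyn (κ : T) (l : Lbl)
  /-- a type or kind of erasure `α` -/
  | ty (α : T)
  /-- a context of level `m` and of erasure `φ` -/
  | ctx (m : ℕ) (φ : T)
  /-- a declaration `A[Γᵏ]` of erasure `α[φ]` -/
  | decl (k : ℕ) (α φ : T)

/-- The simple kinds and types of the constants. -/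
structure SSig where
  ty : ℕ → Option T
  tm : ℕ → Option T

/-- Simple typing.  Dependencies are erased, and types and contexts only have to consist of simply
typed arguments. -/
inductive Has (s : SSig) : SCtx → X → J → Prop
  | con {G : SCtx} {c : ℕ} {α : T} : s.tm c = some α → α.Ok none → Has s G (.leaf (.tm c)) (.syn α)
  | var {G : SCtx} {k i : ℕ} {σ : X} {α φ : T} :
      G k i = some (α, φ) → α.Ok none → φ.Ok (some k) → Has s G σ (.sbn φ) → Has s G (.var k i σ) (.syn α)
  | app {G : SCtx} {R F : X} {k : ℕ} {α φ β : T} :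
      Has s G R (.syn (.arrow k α φ β)) → Has s G F (.ent false k α φ) →
      Has s G (.app R F) (.syn β)
  | ne {G : SCtx} {R : X} {l : Lbl} : Has s G R (.syn (.base l)) → Has s G R (.chk (.base l))
  | lam {G : SCtx} {k : ℕ} {M : X} {α φ β : T} :
      α.Ok none → φ.Ok (some k) → Has s (cons k (some (α, φ)) G) M (.chk β) →
      Has s G (.lam k M) (.chk (.arrow k α φ β))
  | ren {G : SCtx} {k i : ℕ} {α φ : T} :
      G k i = some (α, φ) → α.Ok none → φ.Ok (some k) → Has s G (.ren k i) (.ent true k α φ)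
  | clo {G : SCtx} {e : Bool} {k : ℕ} {M : X} {α φ : T} :
      φ.Ok (some k) → Has s (belowOr k φ.get G) M (.chk α) → Has s G (.clo e k φ.hat M) (.ent e k α φ)
  | nil {G : SCtx} : Has s G (.leaf .nil) (.sbn .nil)
  | snoc {G : SCtx} {σ F : X} {k : ℕ} {α φ ψ : T} :
      Has s G σ (.sbn φ) → Has s G F (.ent true k α ψ) →
      Has s G (.pair σ F) (.sbn (.snoc φ k α ψ))
  | acon {G : SCtx} {a : ℕ} {κ : T} :
      s.ty a = some κ → κ.Ok none → Has s G (.leaf (.ty a)) (.asyn κ (.ty a))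
  | aapp {G : SCtx} {P F : X} {k : ℕ} {α φ β : T} {l : Lbl} :
      Has s G P (.asyn (.arrow k α φ β) l) → Has s G F (.ent false k α φ) →
      Has s G (.pair P F) (.asyn β l)
  | sort {G : SCtx} (t : Srt) : Has s G (.leaf (.srt t)) (.ty (.base (.srt t)))
  | atom {G : SCtx} {P : X} {l : Lbl} :
      Has s G P (.asyn (.base (.srt .type)) l) → Has s G P (.ty (.base l))
  | pi {G : SCtx} {D B : X} {k : ℕ} {α φ β : T} :
      Has s G D (.decl k α φ) → Has s (cons k (some (α, φ)) G) B (.ty β) →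
      Has s G (.pair D (.lam k B)) (.ty (.arrow k α φ β))
  | decl {G : SCtx} {A Γ : X} {k : ℕ} {α φ : T} :
      Has s (belowOr k φ.get G) A (.ty α) → Has s G Γ (.ctx k φ) →
      Has s G (.pair (.clo false k φ.hat A) Γ) (.decl k α φ)
  | cnil {G : SCtx} {m : ℕ} : Has s G (.leaf .nil) (.ctx m .nil)
  | csnoc {G : SCtx} {Γ D : X} {m k : ℕ} {α φ ψ : T} :
      Has s G Γ (.ctx m φ) → k < m → Has s (belowOr m φ.get G) D (.decl k α ψ) →
      Has s G (.pair Γ (.clo false m φ.hat D)) (.ctx m (.snoc φ k α ψ))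

variable {s : SSig}

/-- The simple types and simple contexts of a judgment are well-formed. -/
def J.Ok : J → Prop
  | .syn α => α.Ok none
  | .chk α => α.Ok none
  | .ent _ k α φ => α.Ok none ∧ φ.Ok (some k)
  | .sbn _ => True
  | .asyn κ _ => κ.Ok none
  | .ty α => α.Ok none
  | .ctx m φ => φ.Ok (some m)
  | .decl k α φ => α.Ok none ∧ φ.Ok (some k)

theorem Has.ok {G : SCtx} {M : X} {j : J} (h : Has s G M j) : j.Ok := by
  induction h <;> simp_all [J.Ok, T.Ok]

theorem cons_comp_lift {α : Type*} (k : ℕ) (a : α) (G : ℕ → ℕ → α) (ρ : ℕ → ℕ → ℕ) :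
    (fun l i => cons k a G l (lift k ρ l i)) = cons k a fun l i => G l (ρ l i) :=
  index_ext k (by simp) (by simp)

theorem belowOr_comp_enterR {α : Type*} (k : ℕ) (f G : ℕ → ℕ → α) (ρ : ℕ → ℕ → ℕ) :
    (fun l i => belowOr k f G l (enterR k ρ l i)) = belowOr k f fun l i => G l (ρ l i) := by
  funext l i; by_cases h : l < k <;> simp [enterR, belowOr, h]

theorem Has.rename {G : SCtx} {M : X} {j : J} (h : Has s G M j) :
    ∀ {G' : SCtx} {ρ : ℕ → ℕ → ℕ}, (fun l i => G' l (ρ l i)) = G → Has s G' (M.rename ρ) j := by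
  induction h with
  | con h1 h2 => intro _ _ _; exact .con h1 h2
  | var h1 h2 h3 _ ih => intro _ _ e; subst e; exact .var h1 h2 h3 (ih rfl)
  | app _ _ ih1 ih2 => intro _ _ e; exact .app (ih1 e) (ih2 e)
  | ne _ ih => intro _ _ e; exact .ne (ih e)
  | lam h1 h2 _ ih =>
    intro _ _ e; exact .lam h1 h2 (ih (by rw [cons_comp_lift, e]))
  | ren h1 h2 h3 => intro _ _ e; subst e; exact .ren h1 h2 h3
  | clo h1 _ ih => intro _ _ e; exact .clo h1 (ih (by rw [belowOr_comp_enterR, e]))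
  | nil => intro _ _ _; exact .nil
  | snoc _ _ ih1 ih2 => intro _ _ e; exact .snoc (ih1 e) (ih2 e)
  | acon h1 h2 => intro _ _ _; exact .acon h1 h2
  | aapp _ _ ih1 ih2 => intro _ _ e; exact .aapp (ih1 e) (ih2 e)
  | sort t => intro _ _ _; exact .sort t
  | atom _ ih => intro _ _ e; exact .atom (ih e)
  | pi _ _ ih1 ih2 =>
    intro _ _ e; exact .pi (ih1 e) (ih2 (by rw [cons_comp_lift, e]))
  | decl _ _ ih1 ih2 => intro _ _ e; exact .decl (ih1 (by rw [belowOr_comp_enterR, e])) (ih2 e)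
  | cnil => intro _ _ _; exact .cnil
  | csnoc _ h _ ih1 ih2 =>
    intro _ _ e; exact .csnoc (ih1 e) h (ih2 (by rw [belowOr_comp_enterR, e]))

/-- Simple typing is reflected by renamings. -/
theorem Has.of_rename {G' : SCtx} {N : X} {j : J} (h : Has s G' N j) :
    ∀ {M : X} {ρ : ℕ → ℕ → ℕ}, N = M.rename ρ → Has s (fun l i => G' l (ρ l i)) M j := by
  induction h with
  | con h1 h2 => intro M ρ e; cases M <;> cases e; exact .con h1 h2
  | var h1 h2 h3 _ ih => intro M ρ e; cases M <;> cases e; exact .var h1 h2 h3 (ih rfl)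
  | app _ _ ih1 ih2 => intro M ρ e; cases M <;> cases e; exact .app (ih1 rfl) (ih2 rfl)
  | ne _ ih => intro M ρ e; exact .ne (ih e)
  | lam h1 h2 _ ih =>
    intro M ρ e; cases M <;> cases e
    exact .lam h1 h2 (by rw [← cons_comp_lift]; exact ih rfl)
  | ren h1 h2 h3 => intro M ρ e; cases M <;> cases e; exact .ren h1 h2 h3
  | clo h1 _ ih =>
    intro M ρ e; cases M <;> cases e
    exact .clo h1 (by rw [← belowOr_comp_enterR]; exact ih rfl)
  | nil => intro M ρ e; cases M <;> cases e; exact .nil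
  | snoc _ _ ih1 ih2 => intro M ρ e; cases M <;> cases e; exact .snoc (ih1 rfl) (ih2 rfl)
  | acon h1 h2 => intro M ρ e; cases M <;> cases e; exact .acon h1 h2
  | aapp _ _ ih1 ih2 => intro M ρ e; cases M <;> cases e; exact .aapp (ih1 rfl) (ih2 rfl)
  | sort t => intro M ρ e; cases M <;> cases e; exact .sort t
  | atom _ ih => intro M ρ e; exact .atom (ih e)
  | pi _ _ ih1 ih2 =>
    intro M ρ e; cases M with
    | pair A B =>
      cases B <;> cases e
      exact .pi (ih1 rfl) (by rw [← cons_comp_lift]; exact ih2 rfl)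
    | _ => cases e
  | decl _ _ ih1 ih2 =>
    intro M ρ e; cases M with
    | pair A B =>
      cases A <;> cases e
      exact .decl (by rw [← belowOr_comp_enterR]; exact ih1 rfl) (ih2 rfl)
    | _ => cases e
  | cnil => intro M ρ e; cases M <;> cases e; exact .cnil
  | csnoc _ h _ ih1 ih2 =>
    intro M ρ e; cases M with
    | pair A B =>
      cases B <;> cases e
      exact .csnoc (ih1 rfl) h (by rw [← belowOr_comp_enterR]; exact ih2 rfl)
    | _ => cases e

theorem cons_comp_shift {α : Type*} (k : ℕ) (a : α) (G : ℕ → ℕ → α) :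
    (fun l i => cons k a G l (shift k l i)) = G := by
  funext l i; simp

theorem Has.weak {G : SCtx} {M : X} {j : J} (h : Has s G M j) (k : ℕ) (d : Option (T × T)) :
    Has s (cons k d G) (M.weak k) j :=
  h.rename (cons_comp_shift k d G)

theorem Has.of_weak {G : SCtx} {M : X} {j : J} {k : ℕ} {d : Option (T × T)}
    (h : Has s (cons k d G) (M.weak k) j) : Has s G M j := by
  have := h.of_rename rfl
  rwa [cons_comp_shift] at this

theorem belowOr_congr {α : Type*} {k : ℕ} {f G G' : ℕ → ℕ → α} (h : ∀ l i, k ≤ l → G l i = G' l i) :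
    belowOr k f G = belowOr k f G' := by
  funext l i
  rcases Nat.lt_or_ge l k with hl | hl
  · simp [belowOr, hl]
  · simp [belowOr_ge hl, h l i hl]

/-- An entry `xᵏ`, or closure, depends only on the variables of levels `≥ k`. -/
theorem Has.ent_congr {G G' : SCtx} {F : X} {e : Bool} {k : ℕ} {α φ : T}
    (h : Has s G F (.ent e k α φ)) (hG : ∀ l i, k ≤ l → G l i = G' l i) :
    Has s G' F (.ent e k α φ) := by
  cases h with
  | ren h1 h2 h3 => exact .ren ((hG _ _ le_rfl).symm.trans h1) h2 h3
  | clo h1 h2 => exact .clo h1 (by rwa [← belowOr_congr hG])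

theorem Has.lv {G : SCtx} {F : X} {k : ℕ} {α φ : T}
    (h : Has s G F (.ent true k α φ)) : Lv k F := by
  cases h <;> constructor

theorem Has.syn_isLam {G : SCtx} {R : X} {α : T} (h : Has s G R (.syn α)) : R.isLam = false := by
  cases h <;> rfl

/-- Simply typed environments. -/
def HasEnv (s : SSig) (G' : SCtx) (θ : Env) (G : SCtx) : Prop :=
  ∀ k i α φ, G k i = some (α, φ) → α.Ok none → φ.Ok (some k) → Has s G' (θ k i) (.ent true k α φ)

/-- The declarations of all variables which are not renamed have size at most `b`. -/
def Bd (b : ℕ) (G : SCtx) (θ : Env) : Prop :=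
  ∀ k i α φ, G k i = some (α, φ) → (∃ i', θ k i = .ren k i') ∨ α.size + φ.size + 1 ≤ b

theorem HasEnv.under {G G' : SCtx} {θ : Env} (h : HasEnv s G' θ G) (k : ℕ)
    (d : Option (T × T)) : HasEnv s (cons k d G') (under k θ) (cons k d G) := by
  intro l i α φ hl h1 h2
  rcases index_cases k l i with ⟨rfl, rfl⟩ | ⟨j, rfl⟩
  · rw [under_zero]; rw [cons_zero] at hl; exact .ren (by rwa [cons_zero]) h1 h2
  · rw [under_shift]; rw [cons_shift] at hl; exact (h l j α φ hl h1 h2).weak k d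

theorem HasEnv.enter {G G' : SCtx} {θ : Env} (h : HasEnv s G' θ G) (k : ℕ) (f : SCtx) :
    HasEnv s (belowOr k f G') (enterE k θ) (belowOr k f G) := by
  intro l i α φ hl h1 h2
  rcases Nat.lt_or_ge l k with hlk | hlk
  · simp only [belowOr_lt hlk, enterE, idE] at hl ⊢
    exact .ren (by rwa [belowOr_lt hlk]) h1 h2
  · simp only [belowOr_ge hlk, enterE] at hl ⊢
    exact (h l i α φ hl h1 h2).ent_congr fun m j hm => (belowOr_ge (hlk.trans hm) _ _ _).symm

theorem Bd.under {b : ℕ} {G : SCtx} {θ : Env} (h : Bd b G θ) (k : ℕ) (d : Option (T × T)) :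
    Bd b (cons k d G) (under k θ) := by
  intro l i α φ hl
  rcases index_cases k l i with ⟨rfl, rfl⟩ | ⟨j, rfl⟩
  · exact .inl ⟨0, under_zero _ _⟩
  · rw [cons_shift] at hl; rw [under_shift]
    rcases h l j α φ hl with ⟨i', e⟩ | h
    · exact .inl ⟨shift k l i', by rw [e]; rfl⟩
    · exact .inr h

theorem Bd.enter {b : ℕ} {G : SCtx} {θ : Env} (h : Bd b G θ) (k : ℕ) (f : SCtx) :
    Bd b (belowOr k f G) (enterE k θ) := by
  intro l i α φ hl
  rcases Nat.lt_or_ge l k with hlk | hlk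
  · exact .inl ⟨i, by simp [enterE, belowOr_lt hlk, idE]⟩
  · simp only [belowOr_ge hlk, enterE] at hl ⊢; exact h l i α φ hl

theorem Bd.mono {b b' : ℕ} {G : SCtx} {θ : Env} (h : Bd b G θ) (hb : b ≤ b') : Bd b' G θ :=
  fun k i α φ hl => (h k i α φ hl).imp_right fun h => h.trans hb

theorem HasEnv.single {G : SCtx} {k : ℕ} {h : List ℕ} {N : X} {α φ : T}
    (hN : Has s G (.clo false k h N) (.ent false k α φ)) :
    HasEnv s G (single k h N) (cons k (some (α, φ)) G) := by
  intro l i β ψ hl h1 h2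
  rcases index_cases k l i with ⟨rfl, rfl⟩ | ⟨j, rfl⟩
  · rw [cons_zero] at hl; cases hl
    rw [single_zero]; cases hN with | clo h3 h4 => exact .clo h3 h4
  · rw [cons_shift] at hl; rw [single_shift]; exact .ren hl h1 h2

theorem Bd.single {G : SCtx} {k : ℕ} {h : List ℕ} {N : X} {α φ : T} :
    Bd (α.size + φ.size + 1) (cons k (some (α, φ)) G) (single k h N) := by
  intro l i β ψ hl
  rcases index_cases k l i with ⟨rfl, rfl⟩ | ⟨j, rfl⟩
  · rw [cons_zero] at hl; cases hl; exact .inr le_rfl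
  · rw [single_shift]; exact .inl ⟨j, rfl⟩

theorem inst_ge {n : ℕ} : ∀ {h : List ℕ} {σ : X} {l i : ℕ}, (∀ l ∈ h, l < n) → n ≤ l →
    inst n h σ l i = .ren l i
  | [], _, l, i, _, hl => by simp [inst, belowOr_ge hl, idE]
  | m :: h, σ, l, i, hh, hl => by
    have hm := hh m List.mem_cons_self
    rw [inst, cons_ne (by omega)]
    exact inst_ge (fun l hl => hh l (List.mem_cons_of_mem _ hl)) hl

theorem Has.inst_get {G : SCtx} {n : ℕ} {σ : X} {φ : T} (hσ : Has s G σ (.sbn φ)) :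
    ∀ {l i : ℕ} {α ψ : T}, φ.get l i = some (α, ψ) → Has s G (inst n φ.hat σ l i) (.ent true l α ψ) := by
  induction φ generalizing σ with
  | snoc φ k α ψ ih _ _ =>
    intro l i β χ h
    cases hσ with
    | snoc h1 h2 =>
      simp only [T.get, T.hat, inst, X.fst, X.snd] at h ⊢
      rcases index_cases k l i with ⟨rfl, rfl⟩ | ⟨j, rfl⟩
      · rw [cons_zero] at h ⊢; cases h; exact h2
      · rw [cons_shift] at h ⊢; exact ih h1 h
  | _ => intro l i β χ h; simp [T.get] at h

theorem HasEnv.inst {G : SCtx} {n : ℕ} {σ : X} {φ : T} (hφ : φ.Ok (some n)) (hσ : Has s G σ (.sbn φ)) :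
    HasEnv s G (inst n φ.hat σ) (belowOr n φ.get G) := by
  intro l i α ψ hl h1 h2
  rcases Nat.lt_or_ge l n with hln | hln
  · rw [belowOr_lt hln] at hl; exact hσ.inst_get hl
  · rw [belowOr_ge hln] at hl; rw [inst_ge hφ.lt hln]; exact .ren hl h1 h2

theorem Bd.inst {G : SCtx} {n : ℕ} {σ : X} {φ : T} (hφ : φ.Ok (some n)) :
    Bd φ.size (belowOr n φ.get G) (inst n φ.hat σ) := by
  intro l i α ψ hl
  rcases Nat.lt_or_ge l n with hln | hln
  · rw [belowOr_lt hln] at hl; exact .inr (T.get_size hl)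
  · rw [inst_ge hφ.lt hln]; exact .inl ⟨i, rfl⟩

/-- Simple typing of the result of a substitution.  A neutral term may become a normal term, but
only if its type is bounded by the size of a declaration of the domain. -/
def Res (s : SSig) (b : ℕ) (G : SCtx) (Y : X) : J → Prop
  | .syn α => Has s G Y (.syn α) ∨ Has s G Y (.chk α) ∧ α.size + 1 ≤ b
  | j => Has s G Y j

/-- Hereditary substitution into simply typed trees is defined and preserves simple types. -/
theorem Sub.total (b : ℕ) : ∀ {G : SCtx} {M : X} {j : J}, Has s G M j → ∀ {G' : SCtx} {θ : Env},
    HasEnv s G' θ G → Bd b G θ → ∃ Y, Sub θ M Y ∧ Res s b G' Y j := by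
  induction b using Nat.strong_induction_on with
  | _ b IH =>
  intro G M j h
  induction h with
  | con h1 h2 => intro G' θ _ _; exact ⟨_, .leaf _, .inl (.con h1 h2)⟩
  | @var G k i σ α φ h1 h2 h3 hσ ih =>
    intro G' θ hE hB
    obtain ⟨σ', hs, ht⟩ := ih hE hB
    have hF := hE k i α φ h1 h2 h3
    generalize hF' : θ k i = F at hF
    cases hF with
    | ren h4 _ _ => exact ⟨_, .vren hF' hs, .inl (.var h4 h2 h3 ht)⟩
    | clo h4 h5 =>
      rcases hB k i α φ h1 with ⟨i', e⟩ | hb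
      · rw [e] at hF'; cases hF'
      -- The variable is not renamed, so that its declaration `α[φ]` has size at most `b`, and the
      -- domain `φ` of the new substitution is smaller.
      · obtain ⟨Y, h6, h7⟩ := IH φ.size (by omega) h5 (HasEnv.inst h3 ht) (Bd.inst h3)
        exact ⟨Y, .vclo hF' h3.lt hs h6, .inr ⟨h7, by omega⟩⟩
  | @app G R F k α φ β h1 h2 ih1 ih2 =>
    intro G' θ hE hB
    obtain ⟨R', hR, hR'⟩ := ih1 hE hB
    obtain ⟨F', hF, hF'⟩ := ih2 hE hB
    rcases hR' with hR' | ⟨hR', hb⟩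
    · exact ⟨_, .app hR hR'.syn_isLam hF, .inl (.app hR' hF')⟩
    · simp only [T.size] at hb
      replace hF' : Has s G' F' (.ent false k α φ) := hF'
      cases hR' with
      | lam h3 h4 h5 =>
        cases hF' with
        | clo h6 h7 =>
          -- The function has become normal only because its type comes from the domain; so the
          -- declaration `α[φ]` of its argument is smaller than `b`.
          obtain ⟨Y, h8, h9⟩ := IH (α.size + φ.size + 1) (by omega) h5
            (HasEnv.single (.clo h6 h7)) Bd.single
          exact ⟨Y, .beta hR hF h8, .inr ⟨h9, by omega⟩⟩
  | @ne G R l _ ih =>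
    intro G' θ hE hB
    obtain ⟨Y, h1, h2⟩ := ih hE hB
    refine ⟨Y, h1, ?_⟩
    rcases h2 with h2 | h2
    · exact .ne h2
    · exact h2.1
  | lam h1 h2 _ ih =>
    intro G' θ hE hB
    obtain ⟨Y, h3, h4⟩ := ih (hE.under _ _) (hB.under _ _)
    exact ⟨_, .lam h3, .lam h1 h2 h4⟩
  | ren h1 h2 h3 =>
    intro G' θ hE hB
    have hF := hE _ _ _ _ h1 h2 h3
    exact ⟨_, .ren rfl hF.lv, hF⟩
  | clo h1 _ ih =>
    intro G' θ hE hB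
    obtain ⟨Y, h3, h4⟩ := ih (hE.enter _ _) (hB.enter _ _)
    exact ⟨_, .clo h3, .clo h1 h4⟩
  | nil => intro G' θ _ _; exact ⟨_, .leaf _, .nil⟩
  | snoc _ _ ih1 ih2 =>
    intro G' θ hE hB
    obtain ⟨Y1, h3, h4⟩ := ih1 hE hB
    obtain ⟨Y2, h5, h6⟩ := ih2 hE hB
    exact ⟨_, .pair h3 h5, .snoc h4 h6⟩
  | acon h1 h2 => intro G' θ _ _; exact ⟨_, .leaf _, .acon h1 h2⟩
  | aapp _ _ ih1 ih2 =>
    intro G' θ hE hB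
    obtain ⟨Y1, h3, h4⟩ := ih1 hE hB
    obtain ⟨Y2, h5, h6⟩ := ih2 hE hB
    exact ⟨_, .pair h3 h5, .aapp h4 h6⟩
  | sort t => intro G' θ _ _; exact ⟨_, .leaf _, .sort t⟩
  | atom _ ih =>
    intro G' θ hE hB
    obtain ⟨Y1, h3, h4⟩ := ih hE hB
    exact ⟨_, h3, .atom h4⟩
  | pi _ _ ih1 ih2 =>
    intro G' θ hE hB
    obtain ⟨Y1, h3, h4⟩ := ih1 hE hB
    obtain ⟨Y2, h5, h6⟩ := ih2 (hE.under _ _) (hB.under _ _)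
    exact ⟨_, .pair h3 (.lam h5), .pi h4 h6⟩
  | decl _ _ ih1 ih2 =>
    intro G' θ hE hB
    obtain ⟨Y1, h3, h4⟩ := ih1 (hE.enter _ _) (hB.enter _ _)
    obtain ⟨Y2, h5, h6⟩ := ih2 hE hB
    exact ⟨_, .pair (.clo h3) h5, .decl h4 h6⟩
  | cnil => intro G' θ _ _; exact ⟨_, .leaf _, .cnil⟩
  | csnoc _ h _ ih1 ih2 =>
    intro G' θ hE hB
    obtain ⟨Y1, h3, h4⟩ := ih1 hE hB
    obtain ⟨Y2, h5, h6⟩ := ih2 (hE.enter _ _) (hB.enter _ _)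
    exact ⟨_, .pair h3 (.clo h5), .csnoc h4 h h6⟩

/-! ### Composition of hereditary substitutions -/

theorem Sub.lv {θ : Env} {F F' : X} {k : ℕ} (h : Sub θ F F') (hl : Lv k F) : Lv k F' := by
  cases hl with
  | ren i => cases h with | ren _ h => exact h
  | clo hh M => cases h; constructor

/-- An environment which renames the variables of a simply typed tree acts on it as a renaming. -/
theorem Has.sub_rename {G : SCtx} {M : X} {j : J} (h : Has s G M j) :
    ∀ {θ : Env} {ρ : ℕ → ℕ → ℕ}, (∀ l i d, G l i = some d → θ l i = .ren l (ρ l i)) →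
      Sub θ M (M.rename ρ) := by
  have hu : ∀ {G : SCtx} {θ : Env} {ρ : ℕ → ℕ → ℕ} (k : ℕ) (d : Option (T × T)),
      (∀ l i d, G l i = some d → θ l i = .ren l (ρ l i)) →
      ∀ l i d', cons k d G l i = some d' → under k θ l i = .ren l (lift k ρ l i) := by
    intro G θ ρ k d hθ l i d' hl
    rcases index_cases k l i with ⟨rfl, rfl⟩ | ⟨j, rfl⟩
    · simp
    · rw [cons_shift] at hl; rw [under_shift, hθ l j d' hl, lift_shift]; rfl
  have hn : ∀ {G : SCtx} {θ : Env} {ρ : ℕ → ℕ → ℕ} (k : ℕ) (f : SCtx),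
      (∀ l i d, G l i = some d → θ l i = .ren l (ρ l i)) →
      ∀ l i d', belowOr k f G l i = some d' → enterE k θ l i = .ren l (enterR k ρ l i) := by
    intro G θ ρ k f hθ l i d' hl
    rcases Nat.lt_or_ge l k with hlk | hlk
    · simp [enterE, enterR, belowOr_lt hlk, idE]
    · simp only [enterE, enterR, belowOr_ge hlk] at hl ⊢; exact hθ l i d' hl
  induction h with
  | con => intro _ _ _; exact .leaf _
  | var h1 _ _ _ ih => intro _ _ e; exact .vren (e _ _ _ h1) (ih e)
  | app h1 _ ih1 ih2 =>
    intro _ _ e; exact .app (ih1 e) (by rw [isLam_rename]; exact h1.syn_isLam) (ih2 e)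
  | ne _ ih => intro _ _ e; exact ih e
  | lam _ _ _ ih => intro _ _ e; exact .lam (ih (hu _ _ e))
  | ren h1 => intro _ _ e; exact .ren (e _ _ _ h1) (.ren _)
  | clo _ _ ih => intro _ _ e; exact .clo (ih (hn _ _ e))
  | nil => intro _ _ _; exact .leaf _
  | snoc _ _ ih1 ih2 => intro _ _ e; exact .pair (ih1 e) (ih2 e)
  | acon => intro _ _ _; exact .leaf _
  | aapp _ _ ih1 ih2 => intro _ _ e; exact .pair (ih1 e) (ih2 e)
  | sort t => intro _ _ _; exact .leaf _
  | atom _ ih => intro _ _ e; exact ih e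
  | pi _ _ ih1 ih2 => intro _ _ e; exact .pair (ih1 e) (.lam (ih2 (hu _ _ e)))
  | decl _ _ ih1 ih2 => intro _ _ e; exact .pair (.clo (ih1 (hn _ _ e))) (ih2 e)
  | cnil => intro _ _ _; exact .leaf _
  | csnoc _ _ _ ih1 ih2 => intro _ _ e; exact .pair (ih1 e) (.clo (ih2 (hn _ _ e)))

theorem Has.sub_id {G : SCtx} {M : X} {j : J} (h : Has s G M j) {θ : Env}
    (hθ : ∀ l i d, G l i = some d → θ l i = .ren l i) : Sub θ M M := by
  have := h.sub_rename (ρ := fun _ i => i) hθ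
  rwa [X.rename_id] at this

/-- An entry for a variable of level `l` is left unchanged if all variables of levels `≥ l` are. -/
theorem Has.ent_sub_id {G : SCtx} {F : X} {l : ℕ} {α φ : T} (h : Has s G F (.ent true l α φ))
    {θ : Env} (hθ : ∀ m i, l ≤ m → θ m i = .ren m i) : Sub θ F F := by
  refine Sub.enter_of_lv (θ := idE) ?_ h.lv fun m i hm => hθ m i hm
  exact h.sub_id fun _ _ _ _ => rfl

theorem Sub.inst_get {G : SCtx} {θ : Env} {n : ℕ} {σ σ' : X} {φ : T} (hσ : Has s G σ (.sbn φ))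
    (h : Sub θ σ σ') : ∀ {l i : ℕ} {α ψ : T}, φ.get l i = some (α, ψ) →
      Sub θ (inst n φ.hat σ l i) (inst n φ.hat σ' l i) := by
  induction φ generalizing σ σ' with
  | snoc φ k α ψ ih _ _ =>
    intro l i β χ hl
    cases hσ with
    | snoc h1 h2 =>
      cases h with
      | pair h3 h4 =>
        simp only [T.get, T.hat, inst, X.fst, X.snd] at hl ⊢
        rcases index_cases k l i with ⟨rfl, rfl⟩ | ⟨j, rfl⟩
        · rw [cons_zero, cons_zero]; exact h4
        · rw [cons_shift] at hl ⊢; rw [cons_shift]; exact ih h1 h3 hl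
  | _ => intro l i β χ h; simp [T.get] at h

/-- `κ` is the composition of `τ`, which is applied first, with `θ`, on the domain of `G`. -/
def IsComp (G : SCtx) (τ θ κ : Env) : Prop :=
  ∀ k i α φ, G k i = some (α, φ) → α.Ok none → φ.Ok (some k) → Sub θ (τ k i) (κ k i)

theorem IsComp.under {G : SCtx} {τ θ κ : Env} (h : IsComp G τ θ κ) (k : ℕ) (d : Option (T × T)) :
    IsComp (cons k d G) (under k τ) (under k θ) (under k κ) := by
  intro l i α φ hl h1 h2
  rcases index_cases k l i with ⟨rfl, rfl⟩ | ⟨j, rfl⟩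
  · rw [under_zero, under_zero]; exact .ren (under_zero _ _) (.ren 0)
  · rw [cons_shift] at hl; rw [under_shift, under_shift]; exact (h l j α φ hl h1 h2).weak k

theorem IsComp.enter {G G1 : SCtx} {τ θ κ : Env} (h : IsComp G τ θ κ) (hτ : HasEnv s G1 τ G)
    (k : ℕ) (f : SCtx) : IsComp (belowOr k f G) (enterE k τ) (enterE k θ) (enterE k κ) := by
  intro l i α φ hl h1 h2
  rcases Nat.lt_or_ge l k with hlk | hlk
  · simp only [enterE, belowOr_lt hlk, idE]; exact .ren (belowOr_lt hlk _ _ _) (.ren i)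
  · simp only [belowOr_ge hlk, enterE] at hl ⊢
    exact (h l i α φ hl h1 h2).enter_of_lv (hτ l i α φ hl h1 h2).lv
      fun m j hm => belowOr_ge (hlk.trans hm) _ _ _

/-- The composition property for environments whose bounds have sum at most `b`. -/
def CompAt (s : SSig) (b : ℕ) : Prop :=
  ∀ {b1 b2 : ℕ}, b1 + b2 ≤ b → ∀ {G : SCtx} {M : X} {j : J}, Has s G M j →
    ∀ {G1 G2 : SCtx} {τ θ κ : Env}, HasEnv s G1 τ G → HasEnv s G2 θ G1 → Bd b1 G τ → Bd b2 G1 θ →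
    IsComp G τ θ κ → ∀ {Y Z : X}, Sub τ M Y → Sub θ Y Z → Sub κ M Z

/-- Commutation of `θ` with a simultaneous substitution: `θ ([σ] N) = [θ σ] (θ N)`.  Both sides are
the result of one environment, which sends the domain of `σ` to the entries of `θ σ` and the other
variables to their images under `θ`. -/
theorem CompAt.inst {b b' n : ℕ} (hb : CompAt s b) {G G' : SCtx} {θ : Env} {φ : T}
    (hφ : φ.Ok (some n)) (hs : φ.size + b' ≤ b) (hE : HasEnv s G' θ G) (hB : Bd b' G θ) {σ σ' N N1 N2 Z : X}
    {j : J} (hσ : Has s G σ (.sbn φ)) (hN : Has s (belowOr n φ.get G) N j)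
    (hN2 : Has s (belowOr n φ.get G') N2 j)
    (h1 : Sub θ σ σ') (h2 : Sub (inst n φ.hat σ) N N1) (h3 : Sub θ N1 Z)
    (h4 : Sub (enterE n θ) N N2) : Sub (MLCTT.inst n φ.hat σ') N2 Z := by
  obtain ⟨σ'', h1', hσ'⟩ := Sub.total b' hσ hE hB
  cases h1.det h1'
  replace hσ' : Has s G' σ' (.sbn φ) := hσ'
  -- The composition of the two substitutions, in either order.
  set κ : Env := belowOr n (MLCTT.inst n φ.hat σ') θ with hκ
  have hZ : Sub κ N Z := by
    refine hb hs hN (HasEnv.inst hφ hσ) hE (Bd.inst hφ) hB ?_ h2 h3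
    intro l i α ψ hl o1 o2
    rcases Nat.lt_or_ge l n with hln | hln
    · rw [belowOr_lt hln] at hl; rw [hκ, belowOr_lt hln]; exact Sub.inst_get hσ h1 hl
    · rw [belowOr_ge hln] at hl; rw [hκ, belowOr_ge hln, inst_ge hφ.lt hln]
      exact .ren rfl (hE l i α ψ hl o1 o2).lv
  obtain ⟨W, hW, -⟩ := Sub.total φ.size hN2 (HasEnv.inst hφ hσ') (Bd.inst hφ)
  have hW' : Sub κ N W := by
    refine hb (b1 := b') (b2 := φ.size) (by omega) hN (hE.enter n _) (HasEnv.inst hφ hσ')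
      (hB.enter n _) (Bd.inst hφ) ?_ h4 hW
    intro l i α ψ hl o1 o2
    rcases Nat.lt_or_ge l n with hln | hln
    · rw [belowOr_lt hln] at hl; rw [hκ, belowOr_lt hln]
      simp only [enterE, belowOr_lt hln, idE]
      exact .ren rfl (hσ'.inst_get hl).lv
    · rw [belowOr_ge hln] at hl; rw [hκ, belowOr_ge hln]
      simp only [enterE, belowOr_ge hln]
      exact (hE l i α ψ hl o1 o2).ent_sub_id fun m j hm => inst_ge hφ.lt (hln.trans hm)
  rwa [hZ.det hW']

/-- Commutation of `θ` with a single substitution, by the argument of `CompAt.inst`. -/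
theorem CompAt.single {b b' k : ℕ} (hb : CompAt s b) {G G' : SCtx} {θ : Env} {α φ : T}
    (hs : α.size + φ.size + 1 + b' ≤ b) (hE : HasEnv s G' θ G) (hB : Bd b' G θ)
    {h : List ℕ} {N N' B B1 B2 Z : X} {j : J} (hN : Has s G (.clo false k h N) (.ent false k α φ))
    (hM : Has s (cons k (some (α, φ)) G) B j) (hM2 : Has s (cons k (some (α, φ)) G') B2 j)
    (h1 : Sub θ (.clo false k h N) (.clo false k h N')) (h2 : Sub (single k h N) B B1)
    (h3 : Sub θ B1 Z) (h4 : Sub (under k θ) B B2) : Sub (MLCTT.single k h N') B2 Z := by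
  obtain ⟨F', h1', hF'⟩ := Sub.total b' hN hE hB
  cases h1.det h1'
  replace hF' : Has s G' (.clo false k h N') (.ent false k α φ) := hF'
  -- The composition of the two substitutions, in either order.
  set κ : Env := cons k (.clo true k h N') θ with hκ
  have hZ : Sub κ B Z := by
    refine hb hs hM (HasEnv.single hN) hE Bd.single hB ?_ h2 h3
    intro l i β ψ hl o1 o2
    rcases index_cases k l i with ⟨rfl, rfl⟩ | ⟨j, rfl⟩
    · rw [single_zero, hκ, cons_zero]; cases h1 with | clo h1 => exact .clo h1
    · rw [cons_shift] at hl; rw [single_shift, hκ, cons_shift]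
      exact .ren rfl (hE l j β ψ hl o1 o2).lv
  obtain ⟨W, hW, -⟩ := Sub.total _ hM2 (HasEnv.single hF') Bd.single
  have hW' : Sub κ B W := by
    refine hb (b1 := b') (b2 := α.size + φ.size + 1) (by omega) hM (hE.under k _)
      (HasEnv.single hF') (hB.under k _) Bd.single ?_ h4 hW
    intro l i β ψ hl o1 o2
    rcases index_cases k l i with ⟨rfl, rfl⟩ | ⟨j, rfl⟩
    · rw [under_zero, hκ, cons_zero]; exact .ren (single_zero _ _ _) (.clo _ _)
    · rw [cons_shift] at hl; rw [under_shift, hκ, cons_shift]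
      have := ((hE l j β ψ hl o1 o2).sub_id (θ := idE) fun _ _ _ _ => rfl).rename
        (ρ := shift k) (ρ' := fun _ i => i) (θ' := MLCTT.single k h N')
        (fun m i _ => by simp [idE, X.rename])
      rwa [X.rename_id] at this
  rwa [hZ.det hW']

/-- Hereditary substitution is functorial on simply typed trees: a substitution followed by a
second one is the substitution of the composed environment. -/
theorem Sub.comp (b : ℕ) : CompAt s b := by
  induction b using Nat.strong_induction_on with
  | _ b IH =>
  intro b1 b2 hb G M j h
  induction h with
  | con => intro G1 G2 τ θ κ _ _ _ _ _ Y Z h1 h2; cases h1; cases h2; exact .leaf _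
  | @var G k i σ α φ g1 g2 g3 hσ ih =>
    intro G1 G2 τ θ κ hτ hθ hBτ hBθ hC Y Z h1 h2
    have hk := hC k i α φ g1 g2 g3
    cases h1 with
    | vren e h1 =>
      rw [e] at hk
      cases hk with
      | ren hk hl =>
        cases h2 with
        | vren e' h2 =>
          exact .vren (hk.symm.trans e') (ih hτ hθ hBτ hBθ hC h1 h2)
        | vclo e' hlt h2 h3 =>
          exact .vclo (hk.symm.trans e') hlt (ih hτ hθ hBτ hBθ hC h1 h2) h3
    | @vclo _ _ _ hh _ σ1 N _ e hlt h1 h3 =>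
      have hF := hτ k i α φ g1 g2 g3
      rcases hBτ k i α φ g1 with ⟨i', e'⟩ | hbd
      · rw [e] at e'; cases e'
      obtain ⟨σ1', hs1, hσ1⟩ := Sub.total b1 hσ hτ hBτ
      cases h1.det hs1
      replace hσ1 : Has s G1 σ1 (.sbn φ) := hσ1
      obtain ⟨σ2, hs2, hσ2⟩ := Sub.total b2 hσ1 hθ hBθ
      rw [e] at hk hF
      generalize hK : κ k i = K at hk
      cases hF with
      | clo _ hN =>
        cases hk with
        | @clo _ _ _ _ _ N' hk =>
          obtain ⟨N'', hN'', hN'⟩ := Sub.total b2 hN (hθ.enter k _) (hBθ.enter k _)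
          cases hk.det hN''
          -- It remains to see that `θ` commutes with the instantiation by `σ1`, whose bound is
          -- less than `b1`.
          refine .vclo hK hlt (ih hτ hθ hBτ hBθ hC h1 hs2) ?_
          exact CompAt.inst (IH (φ.size + b2) (by omega)) g3 le_rfl hθ hBθ hσ1 hN hN' hs2 h3 h2 hk
  | @app G R F k α φ β hR hF ih1 ih2 =>
    intro G1 G2 τ θ κ hτ hθ hBτ hBθ hC Y Z h1 h2
    cases h1 with
    | app h3 h4 h5 =>
      cases h2 with
      | app h6 h7 h8 =>
        exact .app (ih1 hτ hθ hBτ hBθ hC h3 h6) h7 (ih2 hτ hθ hBτ hBθ hC h5 h8)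
      | beta h6 h7 h8 =>
        exact .beta (ih1 hτ hθ hBτ hBθ hC h3 h6) (ih2 hτ hθ hBτ hBθ hC h5 h7) h8
    | @beta _ _ _ B _ N m hh h3 h4 h5 =>
      obtain ⟨R', hR1, hR2⟩ := Sub.total b1 hR hτ hBτ
      cases h3.det hR1
      obtain ⟨F', hF1, hF2⟩ := Sub.total b1 hF hτ hBτ
      cases h4.det hF1
      rcases hR2 with hR2 | ⟨hR2, hbd⟩
      · cases hR2
      simp only [T.size] at hbd
      replace hF2 : Has s G1 (.clo false m hh N) (.ent false k α φ) := hF2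
      obtain ⟨L, hL1, hL2⟩ := Sub.total b2 hR2 hθ hBθ
      replace hL2 : Has s G2 L (.chk (.arrow k α φ β)) := hL2
      obtain ⟨F2, hF3, hF4⟩ := Sub.total b2 hF2 hθ hBθ
      have hBR := ih1 hτ hθ hBτ hBθ hC h3 hL1
      have hBF := ih2 hτ hθ hBτ hBθ hC h4 hF3
      cases hR2 with
      | lam o1 o2 hB =>
        cases hL1 with
        | @lam _ _ _ B2 hL1 =>
          cases hL2 with
          | lam _ _ hB2 =>
            cases hF3 with
            | @clo _ _ _ _ _ N2 hF3 =>
              -- It remains to see that `θ` commutes with the reduction of the redex, whose bound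
              -- is less than `b1`.
              refine .beta hBR hBF ?_
              exact CompAt.single (IH (α.size + φ.size + 1 + b2) (by omega)) le_rfl hθ hBθ hF2 hB hB2
                (.clo hF3) h5 h2 hL1
  | ne _ ih => exact ih
  | lam _ _ _ ih =>
    intro G1 G2 τ θ κ hτ hθ hBτ hBθ hC Y Z h1 h2
    cases h1 with
    | lam h1 =>
      cases h2 with
      | lam h2 => exact .lam (ih (hτ.under _ _) (hθ.under _ _) (hBτ.under _ _) (hBθ.under _ _)
          (hC.under _ _) h1 h2)
  | @ren G k i α φ g1 g2 g3 =>
    intro G1 G2 τ θ κ hτ hθ hBτ hBθ hC Y Z h1 h2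
    have hk := hC k i α φ g1 g2 g3
    cases h1 with
    | ren e hl =>
      rw [e] at hk
      rw [h2.det hk]
      exact .ren rfl (hk.lv hl)
  | clo _ _ ih =>
    intro G1 G2 τ θ κ hτ hθ hBτ hBθ hC Y Z h1 h2
    cases h1 with
    | clo h1 =>
      cases h2 with
      | clo h2 => exact .clo (ih (hτ.enter _ _) (hθ.enter _ _) (hBτ.enter _ _) (hBθ.enter _ _)
          (hC.enter hτ _ _) h1 h2)
  | nil => intro G1 G2 τ θ κ _ _ _ _ _ Y Z h1 h2; cases h1; cases h2; exact .leaf _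
  | snoc _ _ ih1 ih2 =>
    intro G1 G2 τ θ κ hτ hθ hBτ hBθ hC Y Z h1 h2
    cases h1 with
    | pair h3 h4 =>
      cases h2 with
      | pair h5 h6 => exact .pair (ih1 hτ hθ hBτ hBθ hC h3 h5) (ih2 hτ hθ hBτ hBθ hC h4 h6)
  | acon => intro G1 G2 τ θ κ _ _ _ _ _ Y Z h1 h2; cases h1; cases h2; exact .leaf _
  | aapp _ _ ih1 ih2 =>
    intro G1 G2 τ θ κ hτ hθ hBτ hBθ hC Y Z h1 h2
    cases h1 with
    | pair h3 h4 =>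
      cases h2 with
      | pair h5 h6 => exact .pair (ih1 hτ hθ hBτ hBθ hC h3 h5) (ih2 hτ hθ hBτ hBθ hC h4 h6)
  | sort t => intro G1 G2 τ θ κ _ _ _ _ _ Y Z h1 h2; cases h1; cases h2; exact .leaf _
  | atom _ ih => exact ih
  | pi _ _ ih1 ih2 =>
    intro G1 G2 τ θ κ hτ hθ hBτ hBθ hC Y Z h1 h2
    cases h1 with
    | pair h3 h4 =>
      cases h4 with
      | lam h4 =>
        cases h2 with
        | pair h5 h6 =>
          cases h6 with
          | lam h6 =>
            exact .pair (ih1 hτ hθ hBτ hBθ hC h3 h5) (.lam (ih2 (hτ.under _ _) (hθ.under _ _)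
              (hBτ.under _ _) (hBθ.under _ _) (hC.under _ _) h4 h6))
  | decl _ _ ih1 ih2 =>
    intro G1 G2 τ θ κ hτ hθ hBτ hBθ hC Y Z h1 h2
    cases h1 with
    | pair h3 h4 =>
      cases h3 with
      | clo h3 =>
        cases h2 with
        | pair h5 h6 =>
          cases h5 with
          | clo h5 =>
            exact .pair (.clo (ih1 (hτ.enter _ _) (hθ.enter _ _) (hBτ.enter _ _) (hBθ.enter _ _)
              (hC.enter hτ _ _) h3 h5)) (ih2 hτ hθ hBτ hBθ hC h4 h6)
  | cnil => intro G1 G2 τ θ κ _ _ _ _ _ Y Z h1 h2; cases h1; cases h2; exact .leaf _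
  | csnoc _ _ _ ih1 ih2 =>
    intro G1 G2 τ θ κ hτ hθ hBτ hBθ hC Y Z h1 h2
    cases h1 with
    | pair h3 h4 =>
      cases h4 with
      | clo h4 =>
        cases h2 with
        | pair h5 h6 =>
          cases h6 with
          | clo h6 =>
            exact .pair (ih1 hτ hθ hBτ hBθ hC h3 h5) (.clo (ih2 (hτ.enter _ _) (hθ.enter _ _)
              (hBτ.enter _ _) (hBθ.enter _ _) (hC.enter hτ _ _) h4 h6))

/-! ### Expansions and contractions of variables -/

/-- The identity substitution for variables of levels `h`. -/
def idX : List ℕ → X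
  | [] => .leaf .nil
  | l :: h => .pair ((idX h).weak l) (.ren l 0)

/-- Whether the tree has the form of a neutral term. -/
def X.isNeut : X → Bool
  | .var _ _ _ => true
  | .leaf (.tm _) => true
  | .app _ _ => true
  | _ => false

/-- `EtaX R N`: the normal term `N` is an `η`-expansion of the neutral term `R`. -/
inductive EtaX : X → X → Prop
  | ne {R : X} : R.isNeut = true → EtaX R R
  | lam {R N M : X} {k : ℕ} {h : List ℕ} :
      EtaX (.var k 0 (idX h)) N → EtaX (.app (R.weak k) (.clo false k h N)) M → EtaX R (.lam k M)

/-- The full `η`-expansion of a neutral term of type `α`. -/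
def T.eta : T → X → X
  | .arrow k α φ β, R =>
      .lam k (β.eta (.app (R.weak k) (.clo false k φ.hat (α.eta (.var k 0 (idX φ.hat))))))
  | _, R => R

/-- The full `η`-expansion of a term of type `α` that is neutral or normal. -/
def T.ex (α : T) (M : X) : X := if M.isLam then M else α.eta M

open Classical in
/-- The entry `ĥᵏ. N`, contracted to a variable if possible. -/
noncomputable def contract (k : ℕ) (h : List ℕ) (N : X) : X :=
  if p : ∃ i, EtaX (.var k i (idX h)) N then .ren k p.choose else .clo true k h N

/-- The normal form with respect to contractions of entries. -/
noncomputable def X.nf : X → X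
  | .leaf l => .leaf l
  | .var k i σ => .var k i σ.nf
  | .ren k i => .ren k i
  | .clo true k h M => contract k h M.nf
  | .clo false k h M => .clo false k h M.nf
  | .lam k M => .lam k M.nf
  | .app R F => .app R.nf F.nf
  | .pair A B => .pair A.nf B.nf

/-- The variable at the head of a neutral term. -/
inductive HeadVar : X → ℕ → ℕ → Prop
  | var (k i : ℕ) (σ : X) : HeadVar (.var k i σ) k i
  | app {R F : X} {k i : ℕ} : HeadVar R k i → HeadVar (.app R F) k i

/-- The head variable of a normal term, as a variable outside of its abstractions. -/
def X.head : X → ℕ × ℕ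
  | .var k i _ => (k, i)
  | .app R _ => R.head
  | .lam k M => (M.head.1, if M.head.1 = k then M.head.2 - 1 else M.head.2)
  | _ => (0, 0)

theorem HeadVar.rename {R : X} {k i : ℕ} (h : HeadVar R k i) (ρ : ℕ → ℕ → ℕ) :
    HeadVar (R.rename ρ) k (ρ k i) := by
  induction h with
  | var => exact .var _ _ _
  | app _ ih => exact .app ih

theorem HeadVar.head {R : X} {k i : ℕ} (h : HeadVar R k i) : R.head = (k, i) := by
  induction h with
  | var => rfl
  | app _ ih => exact ih

theorem EtaX.head {R N : X} (h : EtaX R N) : ∀ {k i : ℕ}, HeadVar R k i → N.head = (k, i) := by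
  induction h with
  | ne => intro k i h; exact h.head
  | @lam _ _ _ m _ _ _ _ ih =>
    intro k i h
    have := ih (.app (h.rename _))
    simp only [X.head, this]
    by_cases hk : k = m <;> simp [shift, hk]

/-- The variable to which an entry contracts is unique, because it is the head of the entry. -/
theorem contract_eq {k i : ℕ} {h : List ℕ} {N : X} (hN : EtaX (.var k i (idX h)) N) :
    contract k h N = .ren k i := by
  have p : ∃ i, EtaX (.var k i (idX h)) N := ⟨i, hN⟩
  have e := (p.choose_spec.head (.var _ _ _)).symm.trans (hN.head (.var _ _ _))
  simp only [Prod.mk.injEq, true_and] at e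
  rw [contract, dif_pos p, e]

theorem contract_cases (k : ℕ) (h : List ℕ) (N : X) :
    (∃ i, EtaX (.var k i (idX h)) N ∧ contract k h N = .ren k i) ∨
      ((∀ i, ¬ EtaX (.var k i (idX h)) N) ∧ contract k h N = .clo true k h N) := by
  by_cases p : ∃ i, EtaX (.var k i (idX h)) N
  · exact .inl ⟨_, p.choose_spec, by rw [contract, dif_pos p]⟩
  · exact .inr ⟨fun i hi => p ⟨i, hi⟩, by rw [contract, dif_neg p]⟩

/-- `M` contains no entries which are closures. -/
def X.Plain : X → Prop
  | .leaf _ => True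
  | .var _ _ σ => σ.Plain
  | .ren _ _ => True
  | .clo e _ _ M => e = false ∧ M.Plain
  | .lam _ M => M.Plain
  | .app R F => R.Plain ∧ F.Plain
  | .pair A B => A.Plain ∧ B.Plain

theorem X.Plain.rename {M : X} (h : M.Plain) : ∀ ρ : ℕ → ℕ → ℕ, (M.rename ρ).Plain := by
  induction M <;> intro ρ <;> simp_all [X.Plain, X.rename]

theorem X.Plain.nf {M : X} (h : M.Plain) : M.nf = M := by
  induction M <;> simp_all [X.Plain, X.nf]

theorem idX_plain : ∀ h : List ℕ, (idX h).Plain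
  | [] => trivial
  | _ :: h => ⟨(idX_plain h).rename _, trivial⟩

theorem EtaX.plain {R N : X} (h : EtaX R N) (hR : R.Plain) : N.Plain := by
  induction h with
  | ne => exact hR
  | lam _ _ ih1 ih2 => exact ih2 ⟨hR.rename _, rfl, ih1 (idX_plain _)⟩

theorem EtaX.eta (α : T) : ∀ {R : X}, R.isNeut = true → EtaX R (α.eta R) := by
  induction α with
  | arrow k α φ β ih1 _ ih2 => intro R _; exact .lam (ih1 rfl) (ih2 rfl)
  | _ => intro R h; exact .ne h

theorem eta_plain (α : T) (k i : ℕ) (h : List ℕ) : (α.eta (.var k i (idX h))).Plain :=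
  (EtaX.eta α rfl).plain (idX_plain h)

theorem idX_congr {ρ ρ' : ℕ → ℕ → ℕ} : ∀ {h : List ℕ}, (∀ l ∈ h, ∀ i, ρ l i = ρ' l i) →
    (idX h).rename ρ = (idX h).rename ρ'
  | [], _ => rfl
  | m :: h, hρ => by
    simp only [idX, X.rename, X.weak, X.rename_rename]
    rw [hρ m List.mem_cons_self 0, idX_congr fun l hl i => hρ l (List.mem_cons_of_mem _ hl) _]

theorem idX_rename {ρ : ℕ → ℕ → ℕ} {h : List ℕ} (hρ : ∀ l ∈ h, ∀ i, ρ l i = i) :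
    (idX h).rename ρ = idX h := by
  rw [idX_congr (ρ' := fun _ i => i) hρ, X.rename_id]

theorem eta_rename {α : T} (hα : α.Ok none) : ∀ (R : X) (ρ : ℕ → ℕ → ℕ),
    (α.eta R).rename ρ = α.eta (R.rename ρ) := by
  induction α with
  | arrow k α φ β ih1 _ ih2 =>
    intro R ρ
    have e : (idX φ.hat).rename (enterR k (lift k ρ)) = idX φ.hat :=
      idX_rename fun l hl i => belowOr_lt (hα.2.1.lt l hl) _ _ _
    simp only [T.eta, X.rename]
    rw [ih2 hα.2.2, X.rename, X.weak_rename, X.rename, ih1 hα.1, X.rename, e]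
    simp [enterR, belowOr_ge le_rfl]
  | _ => intro R ρ; rfl

theorem Has.idX {G : SCtx} {φ : T} {n : ℕ} (hφ : φ.Ok (some n))
    (hG : ∀ l i d, φ.get l i = some d → G l i = some d) : Has s G (idX φ.hat) (.sbn φ) := by
  induction φ generalizing G with
  | nil => exact .nil
  | snoc φ k α ψ ih _ _ =>
    refine .snoc (Has.rename (ih hφ.1 fun l i d h => ?_) rfl) (.ren ?_ hφ.2.2.1 hφ.2.2.2)
    · exact hG l _ d (by rwa [T.get, cons_shift])
    · exact hG k 0 _ (by rw [T.get, cons_zero])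
  | _ => cases hφ

theorem Has.var_idX {G : SCtx} {φ α : T} {k i : ℕ} (hG : G k i = some (α, φ)) (hα : α.Ok none)
    (hφ : φ.Ok (some k)) :
    Has s (belowOr k φ.get G) (.var k i (MLCTT.idX φ.hat)) (.syn α) :=
  .var (by rwa [belowOr_ge le_rfl]) hα hφ <| Has.idX hφ fun l i d h => by
    rwa [belowOr_lt (hφ.lt l (T.get_mem (α := d.1) (ψ := d.2) h))]

theorem Has.eta (α : T) : ∀ {G : SCtx} {R : X}, Has s G R (.syn α) → Has s G (α.eta R) (.chk α) := by
  induction α with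
  | base l => intro G R h; exact .ne h
  | arrow k α φ β ih1 _ ih2 =>
    intro G R h
    have o := h.ok
    exact .lam o.1 o.2.1 (ih2 (.app (h.weak _ _) (.clo o.2.1
      (ih1 (Has.var_idX (cons_zero _ _ _) o.1 o.2.1)))))
  | _ => intro G R h; cases h.ok

/-- Simple contexts with the same list of levels are equal if their declarations occur in the same
assignment. -/
theorem T.get_inj {G : SCtx} {φ φ' : T} {n n' : ℕ} (hφ : φ.Ok (some n)) (hφ' : φ'.Ok (some n'))
    (e : φ.hat = φ'.hat) (h : ∀ l i d, φ.get l i = some d → G l i = some d)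
    (h' : ∀ l i d, φ'.get l i = some d → G l i = some d) : φ = φ' := by
  induction φ generalizing φ' G with
  | nil => cases φ' <;> first | rfl | exact hφ'.elim | cases e
  | snoc φ k α ψ ih _ _ =>
    cases φ' with
    | snoc φ' k' α' ψ' =>
      simp only [T.hat, List.cons.injEq] at e
      obtain ⟨rfl, e⟩ := e
      have h0 := (h k 0 (α, ψ) (by rw [T.get, cons_zero])).symm.trans
        (h' k 0 (α', ψ') (by rw [T.get, cons_zero]))
      cases h0
      rw [ih (G := fun l i => G l (shift k l i)) hφ.1 hφ'.1 e
        (fun l i d hl => h l _ d (by rwa [T.get, cons_shift]))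
        (fun l i d hl => h' l _ d (by rwa [T.get, cons_shift]))]
    | nil => cases e
    | _ => cases hφ'
  | _ => cases hφ

theorem Has.clo_inv {G : SCtx} {e e' : Bool} {k k' : ℕ} {h : List ℕ} {N : X} {α φ : T}
    (hN : Has s G (.clo e k h N) (.ent e' k' α φ)) :
    e = e' ∧ k = k' ∧ h = φ.hat ∧ φ.Ok (some k) ∧ Has s (belowOr k φ.get G) N (.chk α) := by
  generalize eM : X.clo e k h N = M at hN
  cases hN <;> cases eM
  exact ⟨rfl, rfl, rfl, ‹_›, ‹_›⟩

theorem Has.ren_inv {G : SCtx} {k i : ℕ} {α φ : T}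
    (h : Has s G (.ren k i) (.ent true k α φ)) : G k i = some (α, φ) := by
  cases h; assumption

theorem Has.sbn_inv {G : SCtx} {σ : X} {φ : T} (h : Has s G σ (.sbn φ)) :
    (σ = .leaf .nil ∧ φ = .nil) ∨ ∃ σ' F φ' k α ψ, σ = .pair σ' F ∧ φ = .snoc φ' k α ψ ∧
      Has s G σ' (.sbn φ') ∧ Has s G F (.ent true k α ψ) := by
  generalize e : J.sbn φ = j at h
  cases h <;> cases e
  · exact .inl ⟨rfl, rfl⟩
  · exact .inr ⟨_, _, _, _, _, _, rfl, rfl, ‹_›, ‹_›⟩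

/-- If the identity substitution has the simple context `φ`, then the surrounding assignment extends
`φ`. -/
theorem Has.idX_inv {G : SCtx} {φ : T} {h : List ℕ} (hh : Has s G (MLCTT.idX h) (.sbn φ)) :
    φ.hat = h ∧ ∀ l i d, φ.get l i = some d → G l i = some d := by
  induction h generalizing G φ with
  | nil =>
    rcases hh.sbn_inv with ⟨-, rfl⟩ | ⟨_, _, _, _, _, _, e, -⟩
    · exact ⟨rfl, fun l i d h => by cases h⟩
    · cases e
  | cons m h ih =>
    rcases hh.sbn_inv with ⟨e, -⟩ | ⟨_, _, φ, k, α, ψ, e, rfl, h1, h2⟩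
    · cases e
    · cases e
      cases h2 with
      | ren h2 =>
        obtain ⟨rfl, h4⟩ := ih (h1.of_rename rfl)
        refine ⟨rfl, fun l i d hl => ?_⟩
        rw [T.get] at hl
        rcases index_cases m l i with ⟨rfl, rfl⟩ | ⟨j, rfl⟩
        · rw [cons_zero] at hl; rwa [h2]
        · rw [cons_shift] at hl; exact h4 l j d hl

/-- A simply typed `η`-expansion is the full `η`-expansion. -/
theorem EtaX.typed {R N : X} (h : EtaX R N) : ∀ {G : SCtx} {α : T}, Has s G N (.chk α) →
    Has s G R (.syn α) ∧ N = α.eta R := by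
  induction h with
  | ne hn =>
    intro G α h
    cases h with
    | ne h => exact ⟨h, rfl⟩
    | lam => cases hn
  | lam _ _ ih1 ih2 =>
    intro G α h
    cases h with
    | ne h => cases h
    | lam o1 o2 h =>
      obtain ⟨h3, rfl⟩ := ih2 h
      cases h3 with
      | app h4 h5 =>
        have h4' := h4.of_weak
        cases h5 with
        | clo h6 h7 =>
          obtain ⟨h8, rfl⟩ := ih1 h7
          cases h8 with
          | @var _ _ _ _ _ φ1 h9 o3 o4 h10 =>
            rw [belowOr_ge le_rfl, cons_zero] at h9
            cases h9
            obtain ⟨e, h11⟩ := h10.idX_inv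
            have := T.get_inj o4 h6 e h11 fun l i d hl => by
              rwa [belowOr_lt (h6.lt l (T.get_mem (α := d.1) (ψ := d.2) hl))]
            subst this
            exact ⟨h4', rfl⟩

/-- If a simply typed entry contracts to a variable, then this variable has the same type. -/
theorem EtaX.entry {G : SCtx} {k i : ℕ} {N : X} {α φ : T} (h : EtaX (.var k i (MLCTT.idX φ.hat)) N)
    (hφ : φ.Ok (some k)) (hN : Has s (belowOr k φ.get G) N (.chk α)) :
    G k i = some (α, φ) ∧ N = α.eta (.var k i (MLCTT.idX φ.hat)) := by
  obtain ⟨h1, h2⟩ := h.typed hN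
  refine ⟨?_, h2⟩
  cases h1 with
  | @var _ _ _ _ _ φ1 h3 o3 o4 h4 =>
    rw [belowOr_ge le_rfl] at h3
    obtain ⟨e, h5⟩ := h4.idX_inv
    have := T.get_inj o4 hφ e h5 fun l i d hl => by
      rwa [belowOr_lt (hφ.lt l (T.get_mem (α := d.1) (ψ := d.2) hl))]
    subst this
    exact h3

/-- Contraction preserves simple types. -/
theorem Has.nf {G : SCtx} {M : X} {j : J} (h : Has s G M j) : Has s G M.nf j := by
  induction h with
  | con h1 h2 => exact .con h1 h2
  | var h1 h2 h3 _ ih => exact .var h1 h2 h3 ih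
  | app _ _ ih1 ih2 => exact .app ih1 ih2
  | ne _ ih => exact .ne ih
  | lam h1 h2 _ ih => exact .lam h1 h2 ih
  | ren h1 h2 h3 => exact .ren h1 h2 h3
  | @clo G e k M α φ h1 _ ih =>
    cases e with
    | false => exact .clo h1 ih
    | true =>
      rcases contract_cases k φ.hat M.nf with ⟨i, h2, h3⟩ | ⟨_, h3⟩
      · rw [X.nf, h3]; exact .ren (h2.entry h1 ih).1 ih.ok h1
      · rw [X.nf, h3]; exact .clo h1 ih
  | nil => exact .nil
  | snoc _ _ ih1 ih2 => exact .snoc ih1 ih2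
  | acon h1 h2 => exact .acon h1 h2
  | aapp _ _ ih1 ih2 => exact .aapp ih1 ih2
  | sort t => exact .sort t
  | atom _ ih => exact .atom ih
  | pi _ _ ih1 ih2 => exact .pi ih1 ih2
  | decl _ _ ih1 ih2 => exact .decl ih1 ih2
  | cnil => exact .cnil
  | csnoc _ h _ ih1 ih2 => exact .csnoc ih1 h ih2

theorem lift_inv {ρ ρi : ℕ → ℕ → ℕ} (h : ∀ l i, ρi l (ρ l i) = i) (k l i : ℕ) :
    lift k ρi l (lift k ρ l i) = i := by
  have := congrFun (congrFun (lift_comp k ρ ρi) l) i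
  simp only [h, lift_id] at this
  exact this

theorem enterR_inv {ρ ρi : ℕ → ℕ → ℕ} (h : ∀ l i, ρi l (ρ l i) = i) (k l i : ℕ) :
    enterR k ρi l (enterR k ρ l i) = i := by
  have := congrFun (congrFun (enterR_comp k ρ ρi) l) i
  simp only [h, enterR_id] at this
  exact this

theorem rename_inv {ρ ρi : ℕ → ℕ → ℕ} (h : ∀ l i, ρi l (ρ l i) = i) (M : X) :
    (M.rename ρ).rename ρi = M := by
  rw [X.rename_rename]; simp only [h]; exact X.rename_id M

/-- Contraction commutes with injective renamings. -/
theorem Has.nf_rename {G : SCtx} {M : X} {j : J} (h : Has s G M j) :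
    ∀ {ρ ρi : ℕ → ℕ → ℕ}, (∀ l i, ρi l (ρ l i) = i) → (M.rename ρ).nf = M.nf.rename ρ := by
  induction h with
  | @clo G e k M α φ h1 h2 ih =>
    intro ρ ρi hρ
    have ih' := ih (enterR_inv hρ k)
    cases e with
    | false => simp only [X.rename, X.nf, ih']
    | true =>
      have he : ∀ (ρ : ℕ → ℕ → ℕ) (i : ℕ),
          (α.eta (.var k i (MLCTT.idX φ.hat))).rename (enterR k ρ)
            = α.eta (.var k (ρ k i) (MLCTT.idX φ.hat)) := by
        intro ρ i
        rw [eta_rename h2.ok, X.rename, idX_rename fun l hl i => belowOr_lt (h1.lt l hl) _ _ _,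
          enterR, belowOr_ge le_rfl]
      simp only [X.rename, X.nf, ih']
      rcases contract_cases k φ.hat M.nf with ⟨i, h3, h4⟩ | ⟨h3, h4⟩
      · rw [h4, (h3.entry h1 h2.nf).2, he]
        exact contract_eq (EtaX.eta α rfl)
      · rcases contract_cases k φ.hat (M.nf.rename (enterR k ρ)) with ⟨i, h5, h6⟩ | ⟨h5, h6⟩
        · have hG : (fun l i => belowOr k φ.get (fun l i => G l (ρi l i)) l (enterR k ρ l i))
              = belowOr k φ.get G := by
            rw [belowOr_comp_enterR]; simp only [hρ]
          have h7 := congrArg (X.rename (enterR k ρi)) (h5.entry h1 (h2.nf.rename hG)).2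
          rw [rename_inv (enterR_inv hρ k), he] at h7
          exact absurd (h7 ▸ EtaX.eta α rfl) (h3 (ρi k i))
        · rw [h4, h6]; rfl
  | lam _ _ _ ih => intro ρ ρi hρ; simp only [X.rename, X.nf, ih (lift_inv hρ _)]
  | ne _ ih => exact ih
  | atom _ ih => exact ih
  | con => intros; rfl
  | ren => intros; rfl
  | nil => intros; rfl
  | acon => intros; rfl
  | sort => intros; rfl
  | cnil => intros; rfl
  | var _ _ _ _ ih => intro ρ ρi hρ; simp only [X.rename, X.nf, ih hρ]
  | app _ _ ih1 ih2 => intro ρ ρi hρ; simp only [X.rename, X.nf, ih1 hρ, ih2 hρ]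
  | snoc _ _ ih1 ih2 => intro ρ ρi hρ; simp only [X.rename, X.nf, ih1 hρ, ih2 hρ]
  | aapp _ _ ih1 ih2 => intro ρ ρi hρ; simp only [X.rename, X.nf, ih1 hρ, ih2 hρ]
  | pi _ _ ih1 ih2 =>
    intro ρ ρi hρ; simp only [X.rename, X.nf, ih1 hρ, ih2 (lift_inv hρ _)]
  | decl _ _ ih1 ih2 =>
    intro ρ ρi hρ; simp only [X.rename, X.nf, ih1 (enterR_inv hρ _), ih2 hρ]
  | csnoc _ _ _ ih1 ih2 =>
    intro ρ ρi hρ; simp only [X.rename, X.nf, ih1 hρ, ih2 (enterR_inv hρ _)]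

/-- A left inverse of `shift k`. -/
def unshift (k l i : ℕ) : ℕ := if l = k then i - 1 else i

theorem unshift_shift (k l i : ℕ) : unshift k l (shift k l i) = i := by
  by_cases h : l = k <;> simp [shift, unshift, h]

theorem X.weak_inj {k : ℕ} {M N : X} (h : M.weak k = N.weak k) : M = N := by
  have := congrArg (X.rename (unshift k)) h
  rwa [rename_inv (unshift_shift k), rename_inv (unshift_shift k)] at this

theorem Has.nf_weak {G : SCtx} {M : X} {j : J} (h : Has s G M j) (k : ℕ) :
    (M.weak k).nf = M.nf.weak k :=
  h.nf_rename (unshift_shift k)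

theorem eta_inj (α : T) : ∀ {R R' : X}, α.eta R = α.eta R' → R = R' := by
  induction α with
  | arrow k α φ β _ _ ih =>
    intro R R' h
    simp only [T.eta, X.lam.injEq, true_and] at h
    have := ih h
    simp only [X.app.injEq, and_true] at this
    exact X.weak_inj this
  | _ => intro R R' h; exact h

theorem Has.nf_eta (α : T) : ∀ {G : SCtx} {R : X}, Has s G R (.syn α) →
    (α.eta R).nf = α.eta R.nf := by
  induction α with
  | arrow k α φ β _ _ ih =>
    intro G R h
    have o := h.ok
    simp only [T.eta, X.nf]
    rw [ih (.app (h.weak k (some (α, φ))) (.clo o.2.1 (Has.eta α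
      (Has.var_idX (cons_zero _ _ _) o.1 o.2.1)))), X.nf, X.nf, h.nf_weak, (eta_plain α k 0 _).nf]
  | _ => intro G R h; rfl

theorem X.nf_clo_congr {e : Bool} {k : ℕ} {h : List ℕ} {N N' : X} (hN : N.nf = N'.nf) :
    (X.clo e k h N).nf = (X.clo e k h N').nf := by
  cases e <;> simp only [X.nf, hN]

theorem Has.sub_idX {θ : Env} {φ : T} {n : ℕ} (hφ : φ.Ok (some n))
    (hθ : ∀ l i, l < n → θ l i = .ren l i) : Sub θ (MLCTT.idX φ.hat) (MLCTT.idX φ.hat) :=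
  (Has.idX (s := ⟨fun _ => none, fun _ => none⟩) hφ fun _ _ _ h => h).sub_id fun l i d h =>
    hθ l i (hφ.lt l (T.get_mem (α := d.1) (ψ := d.2) h))

theorem Sub.var_idX {θ : Env} {φ : T} {k i i' : ℕ} (hφ : φ.Ok (some k)) (h : θ k i = .ren k i') :
    Sub (enterE k θ) (.var k i (idX φ.hat)) (.var k i' (idX φ.hat)) :=
  .vren (by rw [enterE, belowOr_ge le_rfl, h])
    (Has.sub_idX hφ fun l i hl => belowOr_lt hl _ _ _)

/-- Substitution commutes with `η`-expansion as long as the term remains neutral. -/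
theorem Sub.eta {α : T} (hα : α.Ok none) : ∀ {θ : Env} {R R' : X}, Sub θ R R' →
    R'.isLam = false → Sub θ (α.eta R) (α.eta R') := by
  induction α with
  | arrow k α φ β ih1 _ ih2 =>
    intro θ R R' h hR
    refine .lam (ih2 hα.2.2 (.app (h.weak k) (by rwa [isLam_rename]) (.clo (ih1 hα.1 ?_ rfl))) rfl)
    exact Sub.var_idX hα.2.1 (under_zero _ _)
  | _ => intro θ R R' h _; exact h

/-- Substituting into the identity substitution gives the substitution itself. -/
theorem Sub.inst_idX {G : SCtx} {n : ℕ} {σ : X} {φ : T} (hσ : Has s G σ (.sbn φ)) :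
    Sub (inst n φ.hat σ) (idX φ.hat) σ := by
  induction φ generalizing σ with
  | nil => cases hσ; exact .leaf _
  | snoc φ k α ψ ih _ _ =>
    cases hσ with
    | @snoc _ σ F _ _ _ _ h1 h2 =>
      refine .pair ?_ (.ren (cons_zero _ _ _) h2.lv)
      have := (ih h1).rename (ρ := shift k) (ρ' := fun _ i => i)
        (θ' := inst n (T.hat (.snoc φ k α ψ)) (.pair σ F)) fun l i _ => by
          rw [T.hat, inst, cons_shift, X.rename_id]; rfl
      rwa [X.rename_id] at this
  | _ => cases hσ

theorem inst_rename_get {n : ℕ} {φ : T} {ρ : ℕ → ℕ → ℕ} : ∀ {σ : X} {l i : ℕ} {d : T × T},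
    φ.get l i = some d → inst n φ.hat (σ.rename ρ) l i = (inst n φ.hat σ l i).rename ρ := by
  induction φ with
  | snoc φ k α ψ ih _ _ =>
    intro σ l i d h
    simp only [T.get, T.hat, inst, X.fst_rename, X.snd_rename] at h ⊢
    rcases index_cases k l i with ⟨rfl, rfl⟩ | ⟨j, rfl⟩
    · rw [cons_zero, cons_zero]
    · rw [cons_shift] at h ⊢; rw [cons_shift]; exact ih h
  | _ => intro σ l i d h; cases h

theorem inst_idX_get {n : ℕ} {φ : T} : ∀ {l i : ℕ} {d : T × T},
    φ.get l i = some d → inst n φ.hat (idX φ.hat) l i = .ren l i := by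
  induction φ with
  | snoc φ k α ψ ih _ _ =>
    intro l i d h
    simp only [T.get, T.hat, inst, idX, X.fst, X.snd] at h ⊢
    rcases index_cases k l i with ⟨rfl, rfl⟩ | ⟨j, rfl⟩
    · rw [cons_zero]
    · rw [cons_shift] at h ⊢; rw [inst_rename_get h, ih h]; rfl
  | _ => intro l i d h; cases h

/-- The variable `xᵏ[id]` is replaced by the closure's body. -/
theorem Sub.var_idX_clo {G : SCtx} {θ : Env} {φ α : T} {k i : ℕ} {N : X} (hφ : φ.Ok (some k))
    (h : θ k i = .clo true k φ.hat N) (hN : Has s (belowOr k φ.get G) N (.chk α)) :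
    Sub (enterE k θ) (.var k i (idX φ.hat)) N := by
  refine .vclo (by rw [enterE, belowOr_ge le_rfl, h]) hφ.lt
    (Has.sub_idX hφ fun l i hl => belowOr_lt hl _ _ _) (hN.sub_id fun l i d hl => ?_)
  rcases Nat.lt_or_ge l k with hlk | hlk
  · rw [belowOr_lt hlk] at hl; exact inst_idX_get hl
  · exact inst_ge hφ.lt hlk

theorem Has.ex_chk {G : SCtx} {M : X} {α : T} (h : Has s G M (.chk α)) : α.ex M = M := by
  cases h with
  | ne h => rw [T.ex, h.syn_isLam]; rfl
  | lam => rfl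

theorem Has.ex_syn {G : SCtx} {M : X} {α : T} (h : Has s G M (.syn α)) : α.ex M = α.eta M := by
  rw [T.ex, h.syn_isLam]; rfl

/-! ### Hereditary substitution respects contraction -/

/-- Equality of environments up to contraction. -/
def EqE (G : SCtx) (θ θ' : Env) : Prop :=
  ∀ k i α φ, G k i = some (α, φ) → α.Ok none → φ.Ok (some k) → (θ k i).nf = (θ' k i).nf

theorem EqE.refl (G : SCtx) (θ : Env) : EqE G θ θ := fun _ _ _ _ _ _ _ => rfl

theorem EqE.under {G G' : SCtx} {θ θ' : Env} (h : EqE G θ θ') (hθ : HasEnv s G' θ G)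
    (hθ' : HasEnv s G' θ' G) (k : ℕ) (d : Option (T × T)) :
    EqE (cons k d G) (under k θ) (under k θ') := by
  intro l i α φ hl h1 h2
  rcases index_cases k l i with ⟨rfl, rfl⟩ | ⟨j, rfl⟩
  · rw [under_zero, under_zero]
  · rw [cons_shift] at hl
    rw [under_shift, under_shift, (hθ l j α φ hl h1 h2).nf_weak, (hθ' l j α φ hl h1 h2).nf_weak,
      h l j α φ hl h1 h2]

theorem EqE.enter {G : SCtx} {θ θ' : Env} (h : EqE G θ θ') (k : ℕ) (f : SCtx) :
    EqE (belowOr k f G) (enterE k θ) (enterE k θ') := by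
  intro l i α φ hl h1 h2
  rcases Nat.lt_or_ge l k with hlk | hlk
  · simp only [enterE, belowOr_lt hlk]
  · simp only [belowOr_ge hlk, enterE] at hl ⊢; exact h l i α φ hl h1 h2

theorem EqE.single {G : SCtx} {k : ℕ} {h : List ℕ} {N N' : X} {d : Option (T × T)}
    (hN : N.nf = N'.nf) : EqE (cons k d G) (single k h N) (single k h N') := by
  intro l i β ψ _ _ _
  rcases index_cases k l i with ⟨rfl, rfl⟩ | ⟨j, rfl⟩
  · rw [single_zero, single_zero]; exact X.nf_clo_congr hN
  · rw [single_shift, single_shift]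

theorem X.nf_fst {σ σ' : X} (h : σ.nf = σ'.nf) : σ.fst.nf = σ'.fst.nf := by
  have : ∀ M : X, M.nf.fst = M.fst.nf := by
    intro M
    cases M with
    | clo e k h M =>
      cases e with
      | false => rfl
      | true => rcases contract_cases k h M.nf with ⟨i, _, e⟩ | ⟨_, e⟩ <;> rw [X.nf, e] <;> rfl
    | _ => rfl
  rw [← this, ← this, h]

theorem X.nf_snd {σ σ' : X} (h : σ.nf = σ'.nf) : σ.snd.nf = σ'.snd.nf := by
  have : ∀ M : X, M.nf.snd = M.snd.nf := by
    intro M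
    cases M with
    | clo e k h M =>
      cases e with
      | false => rfl
      | true => rcases contract_cases k h M.nf with ⟨i, _, e⟩ | ⟨_, e⟩ <;> rw [X.nf, e] <;> rfl
    | _ => rfl
  rw [← this, ← this, h]

theorem EqE.inst {G : SCtx} {n : ℕ} : ∀ {h : List ℕ} {σ σ' : X}, σ.nf = σ'.nf →
    EqE G (inst n h σ) (inst n h σ')
  | [], _, _, _ => fun _ _ _ _ _ _ _ => rfl
  | m :: h, σ, σ', e => by
    have ih : ∀ {G : SCtx}, EqE G _ _ := EqE.inst (n := n) (h := h) (X.nf_fst e)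
    intro l i β ψ hl o1 o2
    rw [MLCTT.inst, MLCTT.inst]
    rcases index_cases m l i with ⟨rfl, rfl⟩ | ⟨j, rfl⟩
    · rw [cons_zero, cons_zero]; exact X.nf_snd e
    · rw [cons_shift, cons_shift]
      exact ih (G := fun _ _ => some (β, ψ)) l j β ψ rfl o1 o2

/-- Equality up to contraction of the results of substitutions.  Neutral terms are compared with
normal terms by means of their full `η`-expansions. -/
def Rl (Y Y' : X) : J → Prop
  | .syn α => (α.ex Y).nf = (α.ex Y').nf
  | _ => Y.nf = Y'.nf

theorem Rl.trans {Y Y' Y'' : X} {j : J} (h : Rl Y Y' j) (h' : Rl Y' Y'' j) : Rl Y Y'' j := by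
  cases j <;> exact Eq.trans h h'

theorem Rl.symm {Y Y' : X} {j : J} (h : Rl Y Y' j) : Rl Y' Y j := by
  cases j <;> exact Eq.symm h

/-- Substitutions with bound `b` respect contraction, both of the tree and of the environment. -/
def RespAt (s : SSig) (b : ℕ) : Prop :=
  ∀ {G : SCtx} {M : X} {j : J}, Has s G M j → ∀ {G' : SCtx} {θ θ' : Env},
    HasEnv s G' θ G → HasEnv s G' θ' G → Bd b G θ → Bd b G θ' → EqE G θ θ' →
    ∀ {Y Y' : X}, Sub θ M Y → Sub θ' M.nf Y' → Rl Y Y' j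

/-- `RespAt` compares the substitution into a tree with the one into its normal form; any two trees
with equal normal forms can be compared through it. -/
theorem RespAt.full {b : ℕ} (hb : RespAt s b) {G : SCtx} {M M' : X} {j : J} (hM : Has s G M j)
    (hM' : Has s G M' j) (e : M.nf = M'.nf) {G' : SCtx} {θ θ' : Env}
    (hθ : HasEnv s G' θ G) (hθ' : HasEnv s G' θ' G) (hB : Bd b G θ) (hB' : Bd b G θ')
    (hE : EqE G θ θ') {Y Y' : X} (h1 : Sub θ M Y) (h2 : Sub θ' M' Y') : Rl Y Y' j := by
  obtain ⟨Z, hZ, -⟩ := Sub.total b hM.nf hθ' hB'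
  exact (hb hM hθ hθ' hB hB' hE h1 hZ).trans
    (hb hM' hθ' hθ' hB' hB' (EqE.refl _ _) h2 (e ▸ hZ)).symm

/-- Substitution into the full `η`-expansion of a neutral term gives, up to contraction, the result
of the substitution into the term itself. -/
theorem Sub.eta_nf {b : ℕ} (hb : ∀ b' < b, RespAt s b') (α : T) : ∀ {G G' : SCtx} {θ : Env}
    {R R' M : X}, Has s G R (.syn α) → HasEnv s G' θ G → Bd b G θ → Sub θ R R' →
    Sub θ (α.eta R) M → M.nf = (α.ex R').nf := by
  induction α with
  | arrow k α φ β _ _ ih =>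
    intro G G' θ R R' M hR hθ hB h1 h2
    have o := hR.ok
    obtain ⟨R'', h1', hR'⟩ := Sub.total b hR hθ hB
    cases h1.det h1'
    rcases hR' with hR' | ⟨hR', hbd⟩
    · rw [h2.det (Sub.eta o h1 hR'.syn_isLam), hR'.ex_syn]
    · rw [hR'.ex_chk]
      simp only [T.size] at hbd
      cases hR' with
      | @lam _ _ B _ _ _ _ _ hBt =>
        cases h2 with
        | @lam _ _ _ M0 h2 =>
          set e0 : X := α.eta (.var k 0 (idX φ.hat)) with he0
          set c : X := .clo false k φ.hat e0 with hc
          have hcv : ∀ G : SCtx, Has s (cons k (some (α, φ)) G) c (.ent false k α φ) := fun G =>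
            .clo o.2.1 (Has.eta α (Has.var_idX (cons_zero _ _ _) o.1 o.2.1))
          have hcs : Sub (under k θ) c c :=
            .clo (Sub.eta o.1 (Sub.var_idX o.2.1 (under_zero _ _)) rfl)
          -- The redex which arises substitutes in `B` the expansion of the new variable for the
          -- new variable itself.  This substitution `τ` is the identity up to contraction, so that
          -- `B` does not change up to contraction.
          set τ : Env := fun l i => single k φ.hat e0 l (lift k (shift k) l i) with hτ
          have hτ0 : τ k 0 = .clo true k φ.hat e0 := by simp [hτ]
          have hτs : ∀ l i, τ l (shift k l i) = .ren l (shift k l i) := by intro l i; simp [hτ]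
          have hτE : HasEnv s (cons k (some (α, φ)) G') τ (cons k (some (α, φ)) G') := by
            intro l i γ ψ hl o1 o2
            rcases index_cases k l i with ⟨rfl, rfl⟩ | ⟨j, rfl⟩
            · rw [cons_zero] at hl; cases hl
              rw [hτ0]
              have := (hcv G').clo_inv
              exact .clo this.2.2.2.1 this.2.2.2.2
            · rw [hτs]; exact .ren hl o1 o2
          have hτB : Bd (α.size + φ.size + 1) (cons k (some (α, φ)) G') τ := by
            intro l i γ ψ hl
            rcases index_cases k l i with ⟨rfl, rfl⟩ | ⟨j, rfl⟩
            · rw [cons_zero] at hl; cases hl; exact .inr le_rfl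
            · exact .inl ⟨_, hτs _ _⟩
          have hidE : HasEnv s (cons k (some (α, φ)) G') idE (cons k (some (α, φ)) G') :=
            fun l i γ ψ hl o1 o2 => .ren hl o1 o2
          have hτi : EqE (cons k (some (α, φ)) G') τ idE := by
            intro l i γ ψ hl o1 o2
            rcases index_cases k l i with ⟨rfl, rfl⟩ | ⟨j, rfl⟩
            · rw [hτ0, X.nf, (eta_plain α l 0 _).nf]
              exact contract_eq (EtaX.eta α rfl)
            · rw [hτs]; rfl
          obtain ⟨Z, hZ, hZt⟩ := Sub.total _ hBt hτE hτB
          replace hZt : Has s (cons k (some (α, φ)) G') Z (.chk β) := hZt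
          have hZB : Z.nf = B.nf :=
            RespAt.full (hb (α.size + φ.size + 1) (by omega)) hBt hBt rfl hτE hidE hτB
              (fun l i _ _ _ => .inl ⟨i, rfl⟩) hτi hZ (hBt.sub_id fun _ _ _ _ => rfl)
          have hZ' := hZ.rename (ρ := lift k (shift k)) (ρ' := fun _ i => i)
            (θ' := single k φ.hat e0) fun l i _ => (X.rename_id _).symm
          rw [X.rename_id] at hZ'
          have hbeta : Sub (under k θ) (.app (R.weak k) c) Z := .beta (h1.weak k) hcs hZ'
          have := ih (.app (hR.weak k (some (α, φ))) (hcv G)) (hθ.under k _) (hB.under k _) hbeta h2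
          rw [hZt.ex_chk, hZB] at this
          simp only [X.nf, this]
  | _ => intro G G' θ R R' M hR _ _ h1 h2; rw [h1.det h2, T.ex]; split <;> rfl

/-- Contracting a redex whose function is, up to contraction, the `η`-expansion of a neutral term
gives an application of this neutral term. -/
theorem Sub.beta_nf {b : ℕ} (hb : ∀ b' < b, RespAt s b') {G : SCtx} {R B N N' Y : X} {k : ℕ}
    {α φ β : T} (hs : α.size + φ.size + 1 < b) (hR : Has s G R (.syn (.arrow k α φ β)))
    (hB : Has s (cons k (some (α, φ)) G) B (.chk β))
    (hN : Has s G (.clo false k φ.hat N) (.ent false k α φ))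
    (hN' : Has s G (.clo false k φ.hat N') (.ent false k α φ)) (e : N.nf = N'.nf)
    (eB : (X.lam k B).nf = ((T.arrow k α φ β).eta R).nf) (h : Sub (single k φ.hat N') B Y) :
    Y.nf = (β.eta (.app R (.clo false k φ.hat N))).nf := by
  have o := hR.ok
  have hNt : Has s (belowOr k φ.get G) N (.chk α) := hN.clo_inv.2.2.2.2
  set e0 : X := α.eta (.var k 0 (idX φ.hat)) with he0
  have hv : Has s (belowOr k φ.get (cons k (some (α, φ)) G)) (.var k 0 (idX φ.hat)) (.syn α) :=
    Has.var_idX (cons_zero _ _ _) o.1 o.2.1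
  set E : X := β.eta (.app (R.weak k) (.clo false k φ.hat e0)) with hE
  have hEt : Has s (cons k (some (α, φ)) G) E (.chk β) :=
    Has.eta β (.app (hR.weak _ _) (.clo o.2.1 (Has.eta α hv)))
  have eB' : B.nf = E.nf := by simpa [T.eta, X.nf] using eB
  have hN1 : HasEnv s (belowOr k φ.get G) (enterE k (single k φ.hat N))
      (belowOr k φ.get (cons k (some (α, φ)) G)) := (HasEnv.single hN).enter k _
  have hNB : Bd (α.size + φ.size + 1) (belowOr k φ.get (cons k (some (α, φ)) G))
      (enterE k (single k φ.hat N)) := Bd.single.enter k _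
  obtain ⟨Z, hZ, hZt⟩ := Sub.total _ (Has.eta α hv) hN1 hNB
  replace hZt : Has s (belowOr k φ.get G) Z (.chk α) := hZt
  -- The expansion of the bound variable becomes the argument `N`, by `Sub.eta_nf`.
  have hZN : Z.nf = N.nf := by
    rw [Sub.eta_nf (fun b' hb' => hb b' (by omega)) α hv hN1 hNB
      (Sub.var_idX_clo o.2.1 (single_zero _ _ _) hNt) hZ, hNt.ex_chk]
  have hRs : Sub (single k φ.hat N) (R.weak k) R := by
    have := (hR.sub_id (θ := idE) fun _ _ _ _ => rfl).rename (ρ := shift k) (ρ' := fun _ i => i)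
      (θ' := single k φ.hat N) fun l i _ => by rw [single_shift]; rfl
    rwa [X.rename_id] at this
  have hEs : Sub (single k φ.hat N) E (β.eta (.app R (.clo false k φ.hat Z))) :=
    Sub.eta o.2.2 (.app hRs hR.syn_isLam (.clo hZ)) rfl
  have key : Y.nf = _ := RespAt.full (hb _ hs) hB hEt eB' (HasEnv.single hN') (HasEnv.single hN)
    Bd.single Bd.single (EqE.single e.symm) h hEs
  rw [key, Has.nf_eta β (.app hR (.clo o.2.1 hZt)), Has.nf_eta β (.app hR hN)]
  simp only [X.nf, hZN]

/-- Closures of the same simple type contract to the same entry only if their bodies have the same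
normal form. -/
theorem Has.nf_clo_inj {G : SCtx} {k : ℕ} {h h' : List ℕ} {N N' : X} {α φ : T}
    (hN : Has s G (.clo true k h N) (.ent true k α φ))
    (hN' : Has s G (.clo true k h' N') (.ent true k α φ))
    (e : (X.clo true k h N).nf = (X.clo true k h' N').nf) : N.nf = N'.nf := by
  obtain ⟨-, -, rfl, o, h1⟩ := hN.clo_inv
  obtain ⟨-, -, rfl, -, h2⟩ := hN'.clo_inv
  simp only [X.nf] at e
  rcases contract_cases k φ.hat N.nf with ⟨i, h3, e1⟩ | ⟨h3, e1⟩ <;>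
    rcases contract_cases k φ.hat N'.nf with ⟨i', h4, e2⟩ | ⟨h4, e2⟩ <;> rw [e1, e2] at e
  · cases e
    rw [(h3.entry o h1.nf).2, (h4.entry o h2.nf).2]
  · cases e
  · cases e
  · simpa using e

/-- The body of a simply typed closure that contracts to a variable is, up to contraction, the full
`η`-expansion of this variable. -/
theorem Has.nf_clo_ren {G : SCtx} {k i : ℕ} {h : List ℕ} {N : X} {α φ : T}
    (hN : Has s G (.clo true k h N) (.ent true k α φ)) (e : (X.clo true k h N).nf = .ren k i) :
    N.nf = α.eta (.var k i (MLCTT.idX φ.hat)) := by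
  cases hN with
  | clo o h1 =>
    simp only [X.nf] at e
    rcases contract_cases k φ.hat N.nf with ⟨i, h3, e1⟩ | ⟨h3, e1⟩ <;> rw [e1] at e <;> cases e
    exact (h3.entry o h1.nf).2

/-- The instantiation of a variable by a closure which contracts to a variable `yᵏ` gives, up to
contraction, `yᵏ[σ]`. -/
theorem Sub.inst_nf {b : ℕ} (hb : ∀ b' < b, RespAt s b') {G : SCtx} {k i : ℕ} {N σ σ' Y : X}
    {α φ : T} (hs : φ.size < b)
    (hN : Has s G (.clo true k φ.hat N) (.ent true k α φ)) (hσ : Has s G σ (.sbn φ))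
    (hσ' : Has s G σ' (.sbn φ)) (e : σ.nf = σ'.nf) (eN : (X.clo true k φ.hat N).nf = .ren k i)
    (h : Sub (inst k φ.hat σ) N Y) : Y.nf = (α.eta (.var k i σ')).nf := by
  have hN2 := hN.nf_clo_ren eN
  obtain ⟨-, -, -, o, h1⟩ := hN.clo_inv
  have hσi : Sub (inst k φ.hat σ') (.var k i (idX φ.hat)) (.var k i σ') :=
      .vren (inst_ge o.lt le_rfl) (Sub.inst_idX hσ')
  have key := Sub.eta h1.ok hσi rfl
  rw [← hN2] at key
  exact hb _ hs h1 (HasEnv.inst o hσ) (HasEnv.inst o hσ') (Bd.inst o) (Bd.inst o) (EqE.inst e) h key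

/-- Hereditary substitution respects contraction on simply typed trees. -/
theorem Sub.resp (b : ℕ) : RespAt s b := by
  induction b using Nat.strong_induction_on with
  | _ b IH =>
  intro G M j h
  induction h with
  | con => intro _ _ _ _ _ _ _ _ _ _ h1 h2; cases h1; cases h2; rfl
  | @var G k i σ α φ g1 g2 g3 hσ ih =>
    intro G' θ θ' hθ hθ' hB hB' hE Y Y' h1 h2
    have hF := hθ k i α φ g1 g2 g3
    have hF' := hθ' k i α φ g1 g2 g3
    have hFE := hE k i α φ g1 g2 g3
    have hbd := hB k i α φ g1
    have hbd' := hB' k i α φ g1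
    obtain ⟨σ1, hs1, hσ1⟩ := Sub.total b hσ hθ hB
    obtain ⟨σ2, hs2, hσ2⟩ := Sub.total b hσ.nf hθ' hB'
    have he : σ1.nf = σ2.nf := ih hθ hθ' hB hB' hE hs1 hs2
    replace hσ1 : Has s G' σ1 (.sbn φ) := hσ1
    replace hσ2 : Has s G' σ2 (.sbn φ) := hσ2
    simp only [X.nf] at h2
    cases h1 with
    | vren e1 h1 =>
      cases h1.det hs1
      rw [e1] at hFE hF
      have hi := hF.ren_inv
      cases h2 with
      | vren e2 h2 =>
        cases h2.det hs2
        rw [e2] at hFE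
        cases hFE
        change (α.eta (.var k _ σ1)).nf = (α.eta (.var k _ σ2)).nf
        rw [Has.nf_eta α (.var hi g2 g3 hσ1), Has.nf_eta α (.var hi g2 g3 hσ2), X.nf, X.nf, he]
      | @vclo _ _ _ hh _ _ N _ e2 hlt h2 h3 =>
        cases h2.det hs2
        rw [e2] at hFE hF' hbd'
        have hbd' : α.size + φ.size + 1 ≤ b := by
          rcases hbd' with ⟨_, h⟩ | h
          · cases h
          · exact h
        have hh := hF'.clo_inv.2.2.1
        subst hh
        have hYt : Has s G' Y' (.chk α) := by
          · obtain ⟨_, h4, h5⟩ := Sub.total _ hF'.clo_inv.2.2.2.2 (HasEnv.inst g3 hσ2) (Bd.inst g3)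
            rw [h3.det h4]; exact h5
        change (α.eta (.var k _ σ1)).nf = (α.ex Y').nf
        rw [hYt.ex_chk]
        exact (Sub.inst_nf IH (by omega) hF' hσ2 hσ1 he.symm hFE.symm h3).symm
    | @vclo _ _ _ hh _ _ N _ e1 hlt h1 h3 =>
      cases h1.det hs1
      rw [e1] at hFE hF hbd
      have hbd : α.size + φ.size + 1 ≤ b := by
        rcases hbd with ⟨_, h⟩ | h
        · cases h
        · exact h
      have hh := hF.clo_inv.2.2.1
      subst hh
      have hNt : Has s (belowOr k φ.get G') N (.chk α) := hF.clo_inv.2.2.2.2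
      have hYt : Has s G' Y (.chk α) := by
        obtain ⟨_, h4, h5⟩ := Sub.total _ hNt (HasEnv.inst g3 hσ1) (Bd.inst g3)
        rw [h3.det h4]; exact h5
      cases h2 with
      | vren e2 h2 =>
        cases h2.det hs2
        rw [e2] at hFE hF'
        change (α.ex Y).nf = (α.eta (.var k _ σ2)).nf
        rw [hYt.ex_chk]
        exact Sub.inst_nf IH (by omega) hF hσ1 hσ2 he hFE h3
      | @vclo _ _ _ hh _ _ N' _ e2 hlt' h2 h4 =>
        cases h2.det hs2
        rw [e2] at hFE hF'
        have hh := hF'.clo_inv.2.2.1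
        subst hh
        have hNt' : Has s (belowOr k φ.get G') N' (.chk α) := hF'.clo_inv.2.2.2.2
        have hYt' : Has s G' Y' (.chk α) := by
          obtain ⟨_, h5, h6⟩ := Sub.total _ hNt' (HasEnv.inst g3 hσ2) (Bd.inst g3)
          rw [h4.det h5]; exact h6
        change (α.ex Y).nf = (α.ex Y').nf
        rw [hYt.ex_chk, hYt'.ex_chk]
        exact RespAt.full (IH φ.size (by omega)) hNt hNt' (hF.nf_clo_inj hF' hFE)
          (HasEnv.inst g3 hσ1) (HasEnv.inst g3 hσ2) (Bd.inst g3) (Bd.inst g3) (EqE.inst he) h3 h4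
  | @app G R F k α φ β hR hF ih1 ih2 =>
    intro G' θ θ' hθ hθ' hB hB' hE Y Y' h1 h2
    have o := hR.ok
    obtain ⟨R1, hR1, hRt1⟩ := Sub.total b hR hθ hB
    obtain ⟨R2, hR2, hRt2⟩ := Sub.total b hR.nf hθ' hB'
    obtain ⟨F1, hF1, hFt1⟩ := Sub.total b hF hθ hB
    obtain ⟨F2, hF2, hFt2⟩ := Sub.total b hF.nf hθ' hB'
    have eR := ih1 hθ hθ' hB hB' hE hR1 hR2
    have eF : F1.nf = F2.nf := ih2 hθ hθ' hB hB' hE hF1 hF2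
    replace hFt1 : Has s G' F1 (.ent false k α φ) := hFt1
    replace hFt2 : Has s G' F2 (.ent false k α φ) := hFt2
    cases hFt1 with
    | @clo _ _ _ N1 _ _ o1 hN1 =>
    cases hFt2 with
    | @clo _ _ _ N2 _ _ o2 hN2 =>
    have eN : N1.nf = N2.nf := by simpa [X.nf] using eF
    have hC1 : Has s G' (.clo false k φ.hat N1) (.ent false k α φ) := .clo o1 hN1
    have hC2 : Has s G' (.clo false k φ.hat N2) (.ent false k α φ) := .clo o2 hN2
    replace eR : ((T.arrow k α φ β).ex R1).nf = ((T.arrow k α φ β).ex R2).nf := eR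
    simp only [X.nf] at h2
    change (β.ex Y).nf = (β.ex Y').nf
    rcases hRt1 with hRt1 | ⟨hRt1, hb1⟩
    · have hY : Y = .app R1 (.clo false k φ.hat N1) :=
        h1.det (.app hR1 hRt1.syn_isLam hF1)
      subst hY
      rw [hRt1.ex_syn] at eR
      rcases hRt2 with hRt2 | ⟨hRt2, hb2⟩
      · have hY' : Y' = .app R2 (.clo false k φ.hat N2) :=
          h2.det (.app hR2 hRt2.syn_isLam hF2)
        subst hY'
        rw [hRt2.ex_syn, Has.nf_eta _ hRt1, Has.nf_eta _ hRt2] at eR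
        rw [(Has.app hRt1 hC1).ex_syn, (Has.app hRt2 hC2).ex_syn, Has.nf_eta β (.app hRt1 hC1),
          Has.nf_eta β (.app hRt2 hC2)]
        simp only [X.nf, eta_inj _ eR, eN]
      · rw [hRt2.ex_chk] at eR
        simp only [T.size] at hb2
        cases hRt2 with
        | @lam _ _ B _ _ _ _ _ hBt =>
          obtain ⟨Y2, hY2, hYt2⟩ := Sub.total _ hBt (HasEnv.single hC2) Bd.single
          cases h2.det (.beta hR2 hF2 hY2)
          rw [(Has.app hRt1 hC1).ex_syn, Has.ex_chk hYt2]
          exact (Sub.beta_nf IH (by omega) hRt1 hBt hC1 hC2 eN eR.symm hY2).symm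
    · rw [hRt1.ex_chk] at eR
      simp only [T.size] at hb1
      cases hRt1 with
      | @lam _ _ B _ _ _ _ _ hBt =>
        obtain ⟨Y1, hY1, hYt1⟩ := Sub.total _ hBt (HasEnv.single hC1) Bd.single
        cases h1.det (.beta hR1 hF1 hY1)
        rw [Has.ex_chk hYt1]
        rcases hRt2 with hRt2 | ⟨hRt2, hb2⟩
        · have hY' : Y' = .app R2 (.clo false k φ.hat N2) :=
            h2.det (.app hR2 hRt2.syn_isLam hF2)
          subst hY'
          rw [hRt2.ex_syn] at eR
          rw [(Has.app hRt2 hC2).ex_syn]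
          exact Sub.beta_nf IH (by omega) hRt2 hBt hC2 hC1 eN.symm eR hY1
        · rw [hRt2.ex_chk] at eR
          cases hRt2 with
          | @lam _ _ B' _ _ _ _ _ hBt' =>
            obtain ⟨Y2, hY2, hYt2⟩ := Sub.total _ hBt' (HasEnv.single hC2) Bd.single
            cases h2.det (.beta hR2 hF2 hY2)
            rw [Has.ex_chk hYt2]
            exact RespAt.full (IH (α.size + φ.size + 1) (by omega)) hBt hBt'
              (by simpa [X.nf] using eR) (HasEnv.single hC1) (HasEnv.single hC2)
              Bd.single Bd.single (EqE.single eN) hY1 hY2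
  | @ne G R l hR ih =>
    intro G' θ θ' hθ hθ' hB hB' hE Y Y' h1 h2
    have he := ih hθ hθ' hB hB' hE h1 h2
    have hex : ∀ Y : X, (T.base l).ex Y = Y := by intro Y; rw [T.ex]; split <;> rfl
    change ((T.base l).ex Y).nf = ((T.base l).ex Y').nf at he
    rwa [hex, hex] at he
  | @lam G k M α φ β _ _ _ ih =>
    intro G' θ θ' hθ hθ' hB hB' hE Y Y' h1 h2
    cases h1 with
    | lam h1 =>
      cases h2 with
      | lam h2 =>
        exact congrArg (X.lam k) (ih (hθ.under k _) (hθ'.under k _) (hB.under k _) (hB'.under k _)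
          (hE.under hθ hθ' k _) h1 h2)
  | @ren G k i α φ g1 g2 g3 =>
    intro G' θ θ' hθ hθ' hB hB' hE Y Y' h1 h2
    cases h1 with
    | ren e1 =>
      cases h2 with
      | ren e2 => subst e1; subst e2; exact hE k i α φ g1 g2 g3
  | @clo G e k M α φ o hM ih =>
    intro G' θ θ' hθ hθ' hB hB' hE Y Y' h1 h2
    cases h1 with
    | @clo _ _ _ _ _ M1 h1 =>
      have hθe := hθ.enter k φ.get
      have hθe' := hθ'.enter k φ.get
      have hBe := hB.enter k φ.get
      have hBe' := hB'.enter k φ.get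
      obtain ⟨M2, hM2, hMt2⟩ := Sub.total b hM.nf hθe' hBe'
      have he : M1.nf = M2.nf := ih hθe hθe' hBe hBe' (hE.enter k _) h1 hM2
      cases e with
      | false => cases h2 with | clo h2 => cases h2.det hM2; exact X.nf_clo_congr he
      | true =>
        simp only [X.nf] at h2
        change _ = Y'.nf
        rw [X.nf_clo_congr (e := true) he]
        -- If the entry contracts to a variable, then its body is the expansion of this variable,
        -- and `Sub.eta_nf` compares the two substitutions.
        rcases contract_cases k φ.hat M.nf with ⟨i, h3, h4⟩ | ⟨_, h4⟩
        · rw [h4] at h2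
          obtain ⟨h5, h6⟩ := h3.entry o hM.nf
          have hF' := hθ' k i α φ h5 hM.ok o
          cases h2 with
          | ren h7 h8 =>
            subst h7
            rw [h6] at hM2
            have hv : Has s (belowOr k φ.get G) (.var k i (MLCTT.idX φ.hat)) (.syn α) :=
              Has.var_idX h5 hM.ok o
            generalize hFe : θ' k i = F' at hF'
            cases hF' with
            | ren h9 =>
              rw [hM2.det (Sub.eta hM.ok (Sub.var_idX o hFe) rfl)]
              simp only [X.nf, (eta_plain α k _ φ.hat).nf]
              exact contract_eq (EtaX.eta α rfl)
            | clo _ hN =>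
              have := Sub.eta_nf IH α hv hθe' hBe' (Sub.var_idX_clo o hFe hN) hM2
              rw [hN.ex_chk] at this
              exact X.nf_clo_congr this
        · rw [h4] at h2
          cases h2 with
          | clo h2 => cases h2.det hM2; rfl
  | nil => intro _ _ _ _ _ _ _ _ _ _ h1 h2; cases h1; cases h2; rfl
  | snoc _ _ ih1 ih2 =>
    intro G' θ θ' hθ hθ' hB hB' hE Y Y' h1 h2
    cases h1 with
    | pair h3 h4 =>
      cases h2 with
      | pair h5 h6 =>
        exact congrArg₂ X.pair (ih1 hθ hθ' hB hB' hE h3 h5) (ih2 hθ hθ' hB hB' hE h4 h6)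
  | acon => intro _ _ _ _ _ _ _ _ _ _ h1 h2; cases h1; cases h2; rfl
  | aapp _ _ ih1 ih2 =>
    intro G' θ θ' hθ hθ' hB hB' hE Y Y' h1 h2
    cases h1 with
    | pair h3 h4 =>
      cases h2 with
      | pair h5 h6 =>
        exact congrArg₂ X.pair (ih1 hθ hθ' hB hB' hE h3 h5) (ih2 hθ hθ' hB hB' hE h4 h6)
  | sort t => intro _ _ _ _ _ _ _ _ _ _ h1 h2; cases h1; cases h2; rfl
  | atom _ ih => exact ih
  | @pi G D B k α φ β _ _ ih1 ih2 =>
    intro G' θ θ' hθ hθ' hB hB' hE Y Y' h1 h2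
    cases h1 with
    | pair h3 h4 =>
      cases h4 with
      | lam h4 =>
        cases h2 with
        | pair h5 h6 =>
          cases h6 with
          | lam h6 =>
            exact congrArg₂ X.pair (ih1 hθ hθ' hB hB' hE h3 h5) (congrArg (X.lam k)
              (ih2 (hθ.under k _) (hθ'.under k _) (hB.under k _) (hB'.under k _)
                (hE.under hθ hθ' k _) h4 h6))
  | @decl G A Γ k α φ _ _ ih1 ih2 =>
    intro G' θ θ' hθ hθ' hB hB' hE Y Y' h1 h2
    cases h1 with
    | pair h3 h4 =>
      cases h3 with
      | clo h3 =>
        cases h2 with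
        | pair h5 h6 =>
          cases h5 with
          | clo h5 =>
            exact congrArg₂ X.pair (X.nf_clo_congr (e := false)
              (ih1 (hθ.enter k _) (hθ'.enter k _) (hB.enter k _) (hB'.enter k _)
                (hE.enter k _) h3 h5)) (ih2 hθ hθ' hB hB' hE h4 h6)
  | cnil => intro _ _ _ _ _ _ _ _ _ _ h1 h2; cases h1; cases h2; rfl
  | @csnoc G Γ D m k α φ ψ _ _ _ ih1 ih2 =>
    intro G' θ θ' hθ hθ' hB hB' hE Y Y' h1 h2
    cases h1 with
    | pair h3 h4 =>
      cases h4 with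
      | clo h4 =>
        cases h2 with
        | pair h5 h6 =>
          cases h6 with
          | clo h6 =>
            exact congrArg₂ X.pair (ih1 hθ hθ' hB hB' hE h3 h5) (X.nf_clo_congr (e := false)
              (ih2 (hθ.enter m _) (hθ'.enter m _) (hB.enter m _) (hB'.enter m _)
                (hE.enter m _) h4 h6))

/-! ### Expressions as trees -/

mutual
/-- The tree of an atomic type. -/
def ATy.toX : ATy → X
  | .sort t => .leaf (.srt t)
  | .con a => .leaf (.ty a)
  | .app P k h N => .pair P.toX (.clo false k h N.toX)
/-- The tree of a type.  A function type becomes the pair of its domain, as a declaration, and of an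
abstraction of its codomain. -/
def Ty.toX : Ty → X
  | .atom P => P.toX
  | .pi k A Γ B => .pair (.pair (.clo false k Γ.hat A.toX) (Γ.toX k)) (.lam k B.toX)
/-- The tree of a neutral term. -/
def Ne.toX : Ne → X
  | .var k i σ => .var k i σ.toX
  | .con c => .leaf (.tm c)
  | .app R k h N => .app R.toX (.clo false k h N.toX)
/-- The tree of a normal term. -/
def Tm.toX : Tm → X
  | .ne R => R.toX
  | .lam k M => .lam k M.toX
/-- The tree of an entry of a substitution. -/
def Ent.toX : Ent → X
  | .ren k i => .ren k i
  | .clo k h M => .clo true k h M.toX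
/-- The tree of a substitution. -/
def Sbn.toX : Sbn → X
  | .nil => .leaf .nil
  | .snoc σ F => .pair σ.toX F.toX
/-- A context as a tree, at the level `m` of the context: its declarations are placed inside of
closures which bind the levels `< m`. -/
def Ctx.toX : Ctx → ℕ → X
  | .nil, _ => .leaf .nil
  | .snoc Ψ k A Γ, m =>
      .pair (Ψ.toX m) (.clo false m Ψ.hat (.pair (.clo false k Γ.hat A.toX) (Γ.toX k)))
end

/-- The declaration `A[Γᵏ]` as a tree. -/
def declX (k : ℕ) (A : Ty) (Γ : Ctx) : X := .pair (.clo false k Γ.hat A.toX) (Γ.toX k)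

theorem Ne.toX_isNeut : ∀ R : Ne, R.toX.isNeut = true
  | .var _ _ _ => rfl
  | .con _ => rfl
  | .app _ _ _ _ => rfl

theorem Ne.toX_isLam : ∀ R : Ne, R.toX.isLam = false
  | .var _ _ _ => rfl
  | .con _ => rfl
  | .app _ _ _ _ => rfl

/-- The trees of atomic types are distinct from those of function types. -/
theorem ATy.toX_ne_pi (P : ATy) (D : X) (k : ℕ) (B : X) : P.toX ≠ .pair D (.lam k B) := by
  intro h; cases P <;> simp [ATy.toX] at h

mutual
theorem ATy.toX_inj : ∀ {P Q : ATy}, P.toX = Q.toX → P = Q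
  | .sort _, Q, h => by cases Q <;> simp_all [ATy.toX]
  | .con _, Q, h => by cases Q <;> simp_all [ATy.toX]
  | .app P k h' N, Q, h => by
    cases Q with
    | app P' k' h'' N' =>
      simp only [ATy.toX, X.pair.injEq, X.clo.injEq, true_and] at h
      obtain ⟨h1, rfl, rfl, h2⟩ := h
      rw [ATy.toX_inj h1, Tm.toX_inj h2]
    | _ => simp [ATy.toX] at h
theorem Ty.toX_inj : ∀ {A B : Ty}, A.toX = B.toX → A = B
  | .atom P, B, h => by
    cases B with
    | atom Q => rw [ATy.toX_inj (show P.toX = Q.toX from h)]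
    | pi => exact absurd h (P.toX_ne_pi _ _ _)
  | .pi k A Γ B, C, h => by
    cases C with
    | atom Q => exact absurd h.symm (Q.toX_ne_pi _ _ _)
    | pi k' A' Γ' B' =>
      simp only [Ty.toX, X.pair.injEq, X.clo.injEq, X.lam.injEq, true_and] at h
      obtain ⟨⟨⟨rfl, _, h1⟩, h2⟩, _, h3⟩ := h
      rw [Ty.toX_inj h1, Ctx.toX_inj h2, Ty.toX_inj h3]
theorem Ne.toX_inj : ∀ {R R' : Ne}, R.toX = R'.toX → R = R'
  | .var k i σ, R', h => by
    cases R' <;> simp only [Ne.toX, X.var.injEq, reduceCtorEq] at h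
    obtain ⟨rfl, rfl, h⟩ := h
    rw [Sbn.toX_inj h]
  | .con _, R', h => by cases R' <;> simp_all [Ne.toX]
  | .app R k h' N, R', h => by
    cases R' <;> simp only [Ne.toX, X.app.injEq, X.clo.injEq, true_and, reduceCtorEq] at h
    obtain ⟨h1, rfl, rfl, h2⟩ := h
    rw [Ne.toX_inj h1, Tm.toX_inj h2]
theorem Tm.toX_inj : ∀ {M N : Tm}, M.toX = N.toX → M = N
  | .ne R, N, h => by
    cases N with
    | ne R' => rw [Ne.toX_inj (show R.toX = R'.toX from h)]
    | lam k M => have := congrArg X.isLam h; rw [Tm.toX, Ne.toX_isLam] at this; cases this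
  | .lam k M, N, h => by
    cases N with
    | ne R' => have := congrArg X.isLam h.symm; rw [Tm.toX, Ne.toX_isLam] at this; cases this
    | lam k' M' =>
      simp only [Tm.toX, X.lam.injEq] at h
      rw [h.1, Tm.toX_inj h.2]
theorem Ent.toX_inj : ∀ {F F' : Ent}, F.toX = F'.toX → F = F'
  | .ren _ _, F', h => by cases F' <;> simp_all [Ent.toX]
  | .clo k h' M, F', h => by
    cases F' <;> simp only [Ent.toX, X.clo.injEq, true_and, reduceCtorEq] at h
    obtain ⟨rfl, rfl, h⟩ := h
    rw [Tm.toX_inj h]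
theorem Sbn.toX_inj : ∀ {σ σ' : Sbn}, σ.toX = σ'.toX → σ = σ'
  | .nil, σ', h => by cases σ' <;> simp_all [Sbn.toX]
  | .snoc σ F, σ', h => by
    cases σ' <;> simp only [Sbn.toX, X.pair.injEq, reduceCtorEq] at h
    rw [Sbn.toX_inj h.1, Ent.toX_inj h.2]
theorem Ctx.toX_inj : ∀ {Γ Γ' : Ctx} {m : ℕ}, Γ.toX m = Γ'.toX m → Γ = Γ'
  | .nil, Γ', _, h => by cases Γ' <;> simp_all [Ctx.toX]
  | .snoc Ψ k A Γ, Γ', _, h => by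
    cases Γ' <;> simp only [Ctx.toX, X.pair.injEq, X.clo.injEq, true_and, reduceCtorEq] at h
    obtain ⟨h1, _, ⟨rfl, _, h2⟩, h3⟩ := h
    rw [Ctx.toX_inj h1, Ty.toX_inj h2, Ctx.toX_inj h3]
end

theorem declX_inj : ∀ {Γ Γ' : Ctx} {k : ℕ} {A A' : Ty}, declX k A Γ = declX k A' Γ' →
    A = A' ∧ Γ = Γ' := by
  intro Γ Γ' k A A' h
  simp only [declX, X.pair.injEq, X.clo.injEq, true_and] at h
  exact ⟨Ty.toX_inj h.1.2, Ctx.toX_inj h.2⟩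

/-! ### Erasure to simple types -/

/-- The head of an atomic type. -/
def ATy.hd : ATy → Lbl
  | .sort t => .srt t
  | .con a => .ty a
  | .app P _ _ _ => P.hd

mutual
/-- The erasure of a type to a simple type. -/
def Ty.er : Ty → T
  | .atom P => .base P.hd
  | .pi k A Γ B => .arrow k A.er Γ.er B.er
/-- The simple context of a context. -/
def Ctx.er : Ctx → T
  | .nil => .nil
  | .snoc Ψ k A Γ => .snoc Ψ.er k A.er Γ.er
end

@[simp] theorem Ctx.hat_er : ∀ Γ : Ctx, Γ.er.hat = Γ.hat
  | .nil => rfl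
  | .snoc Ψ k A Γ => by rw [Ctx.er, T.hat, Ctx.hat, Ctx.hat_er Ψ]

/-- The approximation of a label. -/
def Lbl.toApx : Lbl → Apx
  | .ty a => .base a
  | .srt t => .sort t
  | _ => .sort .type

mutual
/-- The approximation that belongs to a simple type.  It forgets the levels of arguments. -/
def T.toApx : T → Apx
  | .base l => l.toApx
  | .arrow _ α φ β => .arrow α.toApx φ.toCApx β.toApx
  | _ => .sort .type
/-- The context approximation of a simple context. -/
def T.toCApx : T → CApx
  | .snoc φ k α ψ => .snoc φ.toCApx k (.known α.toApx ψ.toCApx)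
  | _ => .nil
end

theorem ATy.hd_toApx : ∀ P : ATy, P.hd.toApx = P.erase
  | .sort _ => rfl
  | .con _ => rfl
  | .app P _ _ _ => P.hd_toApx

mutual
theorem Ty.er_toApx : ∀ A : Ty, A.er.toApx = A.erase
  | .atom P => by rw [Ty.er, T.toApx, Ty.erase, P.hd_toApx]
  | .pi k A Γ B => by
    rw [Ty.er, T.toApx, Ty.erase, Ty.er_toApx A, Ctx.er_toCApx Γ, Ty.er_toApx B]
theorem Ctx.er_toCApx : ∀ Γ : Ctx, Γ.er.toCApx = Γ.erase
  | .nil => rfl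
  | .snoc Ψ k A Γ => by
    rw [Ctx.er, T.toCApx, Ctx.erase, Ctx.er_toCApx Ψ, Ty.er_toApx A, Ctx.er_toCApx Γ]
end

/-- The category of expressions from which a simply typed tree comes. -/
def Img (M : X) : J → Prop
  | .syn _ => ∃ R : Ne, M = R.toX
  | .chk _ => ∃ N : Tm, M = N.toX
  | .ent true _ _ _ => ∃ F : Ent, M = F.toX
  | .ent false k _ φ => ∃ N : Tm, M = .clo false k φ.hat N.toX
  | .sbn _ => ∃ σ : Sbn, M = σ.toX
  | .asyn _ l => ∃ P : ATy, M = P.toX ∧ P.hd = l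
  | .ty α => ∃ A : Ty, M = A.toX ∧ A.er = α
  | .ctx m φ => ∃ Γ : Ctx, M = Γ.toX m ∧ Γ.er = φ
  | .decl k α φ => ∃ (A : Ty) (Γ : Ctx), M = declX k A Γ ∧ A.er = α ∧ Γ.er = φ

/-- Simply typed trees are trees of expressions. -/
theorem Has.img {G : SCtx} {M : X} {j : J} (h : Has s G M j) : Img M j := by
  induction h with
  | @con _ c => exact ⟨.con c, rfl⟩
  | @var _ k i _ _ _ _ _ _ _ ih => obtain ⟨σ, rfl⟩ := ih; exact ⟨.var k i σ, rfl⟩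
  | @app _ _ _ k _ φ _ _ _ ih1 ih2 =>
    obtain ⟨R, rfl⟩ := ih1; obtain ⟨N, rfl⟩ := ih2; exact ⟨.app R k φ.hat N, rfl⟩
  | ne _ ih => obtain ⟨R, rfl⟩ := ih; exact ⟨.ne R, rfl⟩
  | @lam _ k _ _ _ _ _ _ _ ih => obtain ⟨M, rfl⟩ := ih; exact ⟨.lam k M, rfl⟩
  | @ren _ k i => exact ⟨.ren k i, rfl⟩
  | @clo _ e k _ _ φ _ _ ih =>
    obtain ⟨M, rfl⟩ := ih
    cases e with
    | false => exact ⟨M, rfl⟩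
    | true => exact ⟨.clo k φ.hat M, rfl⟩
  | nil => exact ⟨.nil, rfl⟩
  | snoc _ _ ih1 ih2 =>
    obtain ⟨σ, rfl⟩ := ih1; obtain ⟨F, rfl⟩ := ih2; exact ⟨.snoc σ F, rfl⟩
  | @acon _ a => exact ⟨.con a, rfl, rfl⟩
  | @aapp _ _ _ k _ φ _ _ _ _ ih1 ih2 =>
    obtain ⟨P, rfl, rfl⟩ := ih1; obtain ⟨N, rfl⟩ := ih2; exact ⟨.app P k φ.hat N, rfl, rfl⟩
  | sort t => exact ⟨.atom (.sort t), rfl, rfl⟩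
  | atom _ ih => obtain ⟨P, rfl, rfl⟩ := ih; exact ⟨.atom P, rfl, rfl⟩
  | @pi _ _ _ k _ _ _ _ _ ih1 ih2 =>
    obtain ⟨A, Γ, rfl, rfl, rfl⟩ := ih1; obtain ⟨B, rfl, rfl⟩ := ih2
    exact ⟨.pi k A Γ B, rfl, rfl⟩
  | decl _ _ ih1 ih2 =>
    obtain ⟨A, rfl, rfl⟩ := ih1; obtain ⟨Γ, rfl, rfl⟩ := ih2
    exact ⟨A, Γ, by rw [declX, Ctx.hat_er], rfl, rfl⟩
  | cnil => exact ⟨.nil, rfl, rfl⟩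
  | @csnoc _ _ _ m k _ _ _ _ _ _ ih1 ih2 =>
    obtain ⟨Γ, rfl, rfl⟩ := ih1; obtain ⟨A, Φ, rfl, rfl, rfl⟩ := ih2
    exact ⟨.snoc Γ k A Φ, by rw [Ctx.toX, Ctx.hat_er]; rfl, rfl⟩

theorem Has.ty_er {G : SCtx} {A : Ty} {α : T} (h : Has s G A.toX (.ty α)) : A.er = α := by
  obtain ⟨A', h1, h2⟩ := h.img
  rw [Ty.toX_inj h1, h2]

theorem Has.ctx_er {G : SCtx} {Γ : Ctx} {m : ℕ} {φ : T} (h : Has s G (Γ.toX m) (.ctx m φ)) :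
    Γ.er = φ := by
  obtain ⟨Γ', h1, h2⟩ := h.img
  rw [Ctx.toX_inj h1, h2]

theorem Has.decl_inv {G : SCtx} {A : Ty} {Γ : Ctx} {k : ℕ} {α φ : T}
    (h : Has s G (declX k A Γ) (.decl k α φ)) : A.er = α ∧ Γ.er = φ ∧
      Has s (belowOr k φ.get G) A.toX (.ty α) ∧ Has s G (Γ.toX k) (.ctx k φ) := by
  generalize e : declX k A Γ = D at h
  cases h with
  | decl h1 h2 =>
    simp only [declX, X.pair.injEq, X.clo.injEq, true_and] at e
    obtain ⟨⟨-, rfl⟩, rfl⟩ := e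
    exact ⟨h1.ty_er, h2.ctx_er, h1, h2⟩

theorem Has.declX {G : SCtx} {A : Ty} {Γ : Ctx} {k : ℕ} {α φ : T}
    (h1 : Has s (belowOr k φ.get G) A.toX (.ty α)) (h2 : Has s G (Γ.toX k) (.ctx k φ)) :
    Has s G (declX k A Γ) (.decl k α φ) := by
  have := Has.decl h1 h2
  rwa [← h2.ctx_er, Ctx.hat_er, h2.ctx_er] at this

/-! ### Weakening of expressions and of trees -/

/-- Weakening by a variable of level `l` at index `c`, as a renaming. -/
def shiftAt (l c : ℕ) : ℕ → ℕ → ℕ := fun k i => if k = l ∧ c ≤ i then i + 1 else i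

theorem shiftAt_zero (l : ℕ) : shiftAt l 0 = shift l := by
  funext k i; simp [shiftAt, shift]

theorem lift_shiftAt (k l c : ℕ) :
    lift k (shiftAt l c) = shiftAt l (if k = l then c + 1 else c) := by
  funext m i
  rcases index_cases k m i with ⟨rfl, rfl⟩ | ⟨j, rfl⟩
  · by_cases h : m = l <;> simp [shiftAt, h]
  · rw [lift_shift]
    by_cases h1 : m = l
    · subst h1
      by_cases h2 : k = m
      · subst h2; by_cases h3 : c ≤ j <;> simp [shiftAt, shift, h3]
      · have h2' : m ≠ k := fun h => h2 h.symm
        simp [shiftAt, shift, h2, h2']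
    · simp [shiftAt, h1]

theorem enterR_shiftAt_le {k l : ℕ} (h : k ≤ l) (c : ℕ) : enterR k (shiftAt l c) = shiftAt l c := by
  funext m i
  rcases Nat.lt_or_ge m k with hm | hm
  · rw [enterR, belowOr_lt hm, shiftAt, if_neg (by omega)]
  · rw [enterR, belowOr_ge hm]

theorem enterR_shiftAt_gt {k l : ℕ} (h : ¬ k ≤ l) (c : ℕ) :
    enterR k (shiftAt l c) = fun _ i => i := by
  funext m i
  rcases Nat.lt_or_ge m k with hm | hm
  · rw [enterR, belowOr_lt hm]
  · rw [enterR, belowOr_ge hm, shiftAt, if_neg (by omega)]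

theorem rename_ite (k l c : ℕ) (M : X) :
    M.rename (enterR k (shiftAt l c)) = if k ≤ l then M.rename (shiftAt l c) else M := by
  split
  · next h => rw [enterR_shiftAt_le h]
  · next h => rw [enterR_shiftAt_gt h, X.rename_id]

theorem Ctx.hat_wk (l c : ℕ) : ∀ Γ : Ctx, (Γ.wk l c).hat = Γ.hat
  | .nil => rfl
  | .snoc Ψ k A Γ => by rw [Ctx.wk, Ctx.hat, Ctx.hat, Ctx.hat_wk l c Ψ]

theorem ATy.hd_wk (l c : ℕ) : ∀ P : ATy, (P.wk l c).hd = P.hd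
  | .sort _ => rfl
  | .con _ => rfl
  | .app P _ _ _ => P.hd_wk l c

mutual
theorem Ty.er_wk : ∀ (A : Ty) (l c : ℕ), (A.wk l c).er = A.er
  | .atom P, l, c => by rw [Ty.wk, Ty.er, Ty.er, P.hd_wk]
  | .pi k A Γ B, l, c => by
    rw [Ty.wk, Ty.er, Ty.er, Ty.er_wk B]
    split <;> simp [Ty.er_wk A, Ctx.er_wk Γ]
theorem Ctx.er_wk : ∀ (Γ : Ctx) (l c : ℕ), (Γ.wk l c).er = Γ.er
  | .nil, _, _ => rfl
  | .snoc Ψ k A Γ, l, c => by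
    rw [Ctx.wk, Ctx.er, Ctx.er, Ctx.er_wk Ψ, Ty.er_wk A, Ctx.er_wk Γ]
end

mutual
theorem ATy.toX_wk : ∀ (P : ATy) (l c : ℕ), (P.wk l c).toX = P.toX.rename (shiftAt l c)
  | .sort _, _, _ => rfl
  | .con _, _, _ => rfl
  | .app P k h N, l, c => by
    rw [ATy.wk, ATy.toX, ATy.toX, X.rename, X.rename, ATy.toX_wk P, rename_ite, apply_ite Tm.toX,
      Tm.toX_wk N]
theorem Ty.toX_wk : ∀ (A : Ty) (l c : ℕ), A.er.Ok none →
    (A.wk l c).toX = A.toX.rename (shiftAt l c)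
  | .atom P, l, c, _ => by rw [Ty.wk, Ty.toX, Ty.toX, ATy.toX_wk P]
  | .pi k A Γ B, l, c, o => by
    obtain ⟨o1, o2, o3⟩ := o
    rw [Ty.wk, Ty.toX, Ty.toX, X.rename, X.rename, X.rename, X.rename, rename_ite, apply_ite Ty.toX,
      Ty.toX_wk A l c o1, Ty.toX_wk B _ _ o3, lift_shiftAt, Ctx.toX_wk_ite Γ l c k o2]
    split <;> simp [Ctx.hat_wk]
theorem Ne.toX_wk : ∀ (R : Ne) (l c : ℕ), (R.wk l c).toX = R.toX.rename (shiftAt l c)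
  | .var k i σ, l, c => by rw [Ne.wk, Ne.toX, Ne.toX, X.rename, Sbn.toX_wk σ, shiftAt]
  | .con _, _, _ => rfl
  | .app R k h N, l, c => by
    rw [Ne.wk, Ne.toX, Ne.toX, X.rename, X.rename, Ne.toX_wk R, rename_ite, apply_ite Tm.toX,
      Tm.toX_wk N]
theorem Tm.toX_wk : ∀ (M : Tm) (l c : ℕ), (M.wk l c).toX = M.toX.rename (shiftAt l c)
  | .ne R, l, c => by rw [Tm.wk, Tm.toX, Tm.toX, Ne.toX_wk R]
  | .lam k M, l, c => by
    rw [Tm.wk, Tm.toX, Tm.toX, X.rename, Tm.toX_wk M, lift_shiftAt]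
theorem Ent.toX_wk : ∀ (F : Ent) (l c : ℕ), (F.wk l c).toX = F.toX.rename (shiftAt l c)
  | .ren k i, l, c => by rw [Ent.wk, Ent.toX, Ent.toX, X.rename, shiftAt]
  | .clo k h M, l, c => by
    rw [Ent.wk, Ent.toX, Ent.toX, X.rename, rename_ite, apply_ite Tm.toX, Tm.toX_wk M]
theorem Sbn.toX_wk : ∀ (σ : Sbn) (l c : ℕ), (σ.wk l c).toX = σ.toX.rename (shiftAt l c)
  | .nil, _, _ => rfl
  | .snoc σ F, l, c => by
    rw [Sbn.wk, Sbn.toX, Sbn.toX, X.rename, Sbn.toX_wk σ, Ent.toX_wk F]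
/-- A context `Γᵐ` refers only to variables of levels `≥ m`, so that weakening by a variable of a
lower level leaves it unchanged. -/
theorem Ctx.toX_wk_ite : ∀ (Γ : Ctx) (l c m : ℕ), Γ.er.Ok (some m) →
    (if m ≤ l then Γ.wk l c else Γ).toX m = (Γ.toX m).rename (shiftAt l c)
  | .nil, l, c, m, _ => by split <;> rfl
  | .snoc Ψ k A Γ, l, c, m, o => by
    obtain ⟨o1, o2, o3, o4⟩ := o
    have h1 := Ctx.toX_wk_ite Ψ l c m o1
    have h2 := Ctx.toX_wk_ite Γ l c k o4
    have h3 := Ty.toX_wk A l c o3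
    rw [Ctx.toX, X.rename, X.rename, X.rename, X.rename]
    by_cases hm : m ≤ l
    · rw [if_pos hm] at h1 ⊢
      rw [if_pos (by omega)] at h2
      rw [Ctx.wk, Ctx.toX, h1, h2, h3, enterR_shiftAt_le hm, enterR_shiftAt_le (by omega),
        Ctx.hat_wk, Ctx.hat_wk]
    · rw [if_neg hm] at h1 ⊢
      rw [enterR_shiftAt_gt hm, enterR_id, X.rename_id, X.rename_id, Ctx.toX, ← h1]
end

theorem Sbn.toX_weak (σ : Sbn) (l : ℕ) : (σ.wk l 0).toX = σ.toX.weak l := by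
  rw [σ.toX_wk, shiftAt_zero]

theorem Ne.toX_weak (R : Ne) (l : ℕ) : (R.wk l 0).toX = R.toX.weak l := by
  rw [R.toX_wk, shiftAt_zero]

theorem Ent.toX_weak (F : Ent) (l : ℕ) : (F.wk l 0).toX = F.toX.weak l := by
  rw [F.toX_wk, shiftAt_zero]

theorem declX_weak {A : Ty} {Γ : Ctx} {k l : ℕ} (hA : A.er.Ok none) (hΓ : Γ.er.Ok (some k))
    (h : k ≤ l) : declX k (A.wk l 0) (Γ.wk l 0) = (declX k A Γ).weak l := by
  have := Γ.toX_wk_ite l 0 k hΓ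
  rw [if_pos h] at this
  rw [declX, declX, X.weak, X.rename, X.rename, ← shiftAt_zero, enterR_shiftAt_le h,
    A.toX_wk l 0 hA, this, Ctx.hat_wk]

theorem Ctx.toX_rename_congr {ρ ρ' : ℕ → ℕ → ℕ} {m : ℕ} (h : ∀ l i, m ≤ l → ρ l i = ρ' l i) :
    ∀ Γ : Ctx, (Γ.toX m).rename ρ = (Γ.toX m).rename ρ'
  | .nil => rfl
  | .snoc Ψ k A Γ => by
    rw [Ctx.toX, X.rename, X.rename, Ctx.toX_rename_congr h Ψ, enterR_congr h, ← X.rename, ← X.rename]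

/-- A declaration of level `k` depends only on the variables of levels `≥ k`. -/
theorem declX_rename_congr {ρ ρ' : ℕ → ℕ → ℕ} {k : ℕ} (h : ∀ l i, k ≤ l → ρ l i = ρ' l i)
    (A : Ty) (Γ : Ctx) : (declX k A Γ).rename ρ = (declX k A Γ).rename ρ' := by
  rw [declX, X.rename, X.rename, X.rename, X.rename, enterR_congr h, Ctx.toX_rename_congr h]

theorem idSbn_toX : ∀ h : List ℕ, (idSbn h).toX = idX h
  | [] => rfl
  | l :: h => by rw [idSbn, Sbn.toX, Sbn.toX_weak, idSbn_toX h, Ent.toX, idX]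

/-! ### Domains of substitutions -/

/-- The levels of the variables of a context approximation. -/
def CApx.hat : CApx → List ℕ
  | .nil => []
  | .snoc γ k _ => k :: γ.hat

/-- `σ` has as many entries as `φ` has variables. -/
def Sbn.Len : Sbn → CApx → Prop
  | .nil, .nil => True
  | .snoc σ _, .snoc φ _ _ => σ.Len φ
  | _, _ => False

theorem CApx.hat_ofHat : ∀ h : List ℕ, (CApx.ofHat h).hat = h
  | [] => rfl
  | l :: h => by rw [CApx.ofHat, CApx.hat, CApx.hat_ofHat h]

theorem T.hat_toCApx : ∀ φ : T, φ.toCApx.hat = φ.hat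
  | .snoc φ k α ψ => by rw [T.toCApx, CApx.hat, T.hat, T.hat_toCApx φ]
  | .nil => rfl
  | .base _ => rfl
  | .arrow _ _ _ _ => rfl

theorem Sbn.lookup_snoc (σ : Sbn) (F : Ent) (φ : CApx) (n : ℕ) (t : Slot) (k i : ℕ) :
    (Sbn.snoc σ F).lookup k i (.snoc φ n t) = cons n (some (F, t)) (fun k i => σ.lookup k i φ) k i := by
  by_cases h : n = k
  · subst h; cases i <;> simp [cons, Sbn.lookup]
  · rw [cons_ne (fun h' => h h'.symm)]; simp [Sbn.lookup, h]

theorem Sbn.lookup_nil (φ : CApx) (k i : ℕ) : Sbn.nil.lookup k i φ = none := by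
  cases φ <;> rfl

theorem cons_comm {α : Type*} {k l : ℕ} (h : k ≠ l) (a b : α) (f : ℕ → ℕ → α) :
    cons k a (cons l b f) = cons l b (cons k a f) := by
  funext m i
  by_cases h1 : m = k
  · subst h1
    rw [cons_ne h]
    cases i with
    | zero => simp
    | succ j => simp [cons, h]
  · rw [cons_ne h1]
    by_cases h2 : m = l
    · subst h2; cases i with
      | zero => simp
      | succ j => simp [cons, h1]
    · rw [cons_ne h2, cons_ne h2, cons_ne h1]

theorem Sbn.Len.wk : ∀ {σ : Sbn} {φ : CApx} (_ : σ.Len φ) (l c : ℕ), (σ.wk l c).Len φ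
  | .nil, .nil, h, _, _ => h
  | .snoc σ _, .snoc φ _ _, h, l, c => Sbn.Len.wk (show σ.Len φ from h) l c

theorem Sbn.Len.ins (n : ℕ) (F : Ent) (t : Slot) : ∀ {σ : Sbn} {φ : CApx}, σ.Len φ →
    (σ.ins n F φ).Len (φ.ins n t)
  | .nil, .nil, h => h
  | .snoc σ _, .snoc φ k _, h => by
    rw [Sbn.ins, CApx.ins]; split
    · exact Sbn.Len.ins n F t (show σ.Len φ from h)
    · exact h

theorem Sbn.Len.chop (n : ℕ) : ∀ {σ : Sbn} {φ : CApx}, σ.Len φ → (σ.chop n φ).Len (φ.chop n)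
  | .nil, .nil, h => h
  | .snoc σ _, .snoc φ k _, h => by
    rw [Sbn.chop, CApx.chop]; split
    · exact Sbn.Len.chop n (show σ.Len φ from h)
    · exact h

theorem Sbn.Len.merge {σ : Sbn} {ψ : CApx} (hσ : σ.Len ψ) : ∀ {τ : Sbn} {φ : CApx}, τ.Len φ →
    (σ.merge ψ τ φ).Len (ψ.merge φ)
  | .nil, .nil, _ => hσ
  | .snoc τ _, .snoc φ k _, h => by
    rw [Sbn.merge, CApx.merge]
    exact (Sbn.Len.merge hσ (show τ.Len φ from h)).ins _ _ _

theorem Sbn.lookup_wk (l c k : ℕ) : ∀ (σ : Sbn) (φ : CApx) (i : ℕ),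
    (σ.wk l c).lookup k i φ = (σ.lookup k i φ).map fun p => (p.1.wk l c, p.2)
  | .nil, φ, i => by rw [Sbn.wk, Sbn.lookup_nil]; rfl
  | .snoc σ F, .nil, i => rfl
  | .snoc σ F, .snoc φ n t, i => by
    rw [Sbn.wk, Sbn.lookup_snoc, Sbn.lookup_snoc]
    rcases index_cases n k i with ⟨rfl, rfl⟩ | ⟨j, rfl⟩
    · rw [cons_zero, cons_zero]; rfl
    · rw [cons_shift, cons_shift]; exact Sbn.lookup_wk l c k σ φ j

theorem Sbn.lookup_ins (n : ℕ) (F : Ent) (t : Slot) : ∀ {σ : Sbn} {φ : CApx}, σ.Len φ →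
    (fun k i => (σ.ins n F φ).lookup k i (φ.ins n t))
      = cons n (some (F, t)) fun k i => σ.lookup k i φ
  | .nil, .nil, _ => by funext k i; exact Sbn.lookup_snoc _ _ _ _ _ _ _
  | .snoc σ F₁, .snoc φ k t₁, h => by
    rw [Sbn.ins, CApx.ins]
    split
    · next hk =>
      have e := Sbn.lookup_ins n F t (show σ.Len φ from h)
      funext l i
      rw [Sbn.lookup_snoc, e, cons_comm (Nat.ne_of_lt hk)]
      congr 1; funext l i; rw [Sbn.lookup_snoc]
    · funext l i; rw [Sbn.lookup_snoc]
  | .nil, .snoc _ _ _, h => h.elim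
  | .snoc _ _, .nil, h => h.elim

theorem Sbn.lookup_chop {n l : ℕ} (hl : n ≤ l) (i : ℕ) : ∀ {σ : Sbn} {φ : CApx}, σ.Len φ →
    (σ.chop n φ).lookup l i (φ.chop n) = σ.lookup l i φ
  | .nil, .nil, _ => rfl
  | .snoc σ F, .snoc φ k t, h => by
    rw [Sbn.chop, CApx.chop]
    split
    · rw [Sbn.lookup_chop hl i (show σ.Len φ from h), Sbn.lookup_snoc, cons_ne (by omega)]
    · rfl

theorem Sbn.lookup_merge_some {σ : Sbn} {ψ : CApx} (hσ : σ.Len ψ) {l : ℕ} {p : Ent × Slot} :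
    ∀ {τ : Sbn} {φ : CApx} {i : ℕ}, τ.Len φ → τ.lookup l i φ = some p →
      (σ.merge ψ τ φ).lookup l i (ψ.merge φ) = some p
  | .nil, φ, i, _, h => by rw [Sbn.lookup_nil] at h; cases h
  | .snoc τ F, .snoc φ k t, i, hτ, h => by
    rw [Sbn.merge, CApx.merge]
    have e := congrFun (congrFun (Sbn.lookup_ins k F t (hσ.merge (show τ.Len φ from hτ))) l) i
    rw [e]
    rw [Sbn.lookup_snoc] at h
    rcases index_cases k l i with ⟨rfl, rfl⟩ | ⟨j, rfl⟩
    · rw [cons_zero] at h ⊢; exact h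
    · rw [cons_shift] at h ⊢
      exact Sbn.lookup_merge_some (i := j) hσ (show τ.Len φ from hτ) h

theorem Sbn.lookup_merge_other {σ : Sbn} {ψ : CApx} (hσ : σ.Len ψ) {l : ℕ} (i : ℕ) :
    ∀ {τ : Sbn} {φ : CApx}, τ.Len φ → l ∉ φ.hat →
      (σ.merge ψ τ φ).lookup l i (ψ.merge φ) = σ.lookup l i ψ
  | .nil, .nil, _, _ => rfl
  | .snoc τ F, .snoc φ k t, hτ, h => by
    rw [CApx.hat, List.mem_cons, not_or] at h
    rw [Sbn.merge, CApx.merge]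
    have e := congrFun (congrFun (Sbn.lookup_ins k F t (hσ.merge (show τ.Len φ from hτ))) l) i
    rw [e, cons_ne h.1]
    exact Sbn.lookup_merge_other hσ i (show τ.Len φ from hτ) h.2

theorem idSbn_len : ∀ {ω : CApx}, (idSbn ω.hat).Len ω
  | .nil => trivial
  | .snoc ω k _ => Sbn.Len.wk (idSbn_len (ω := ω)) k 0

theorem idSbn_lookup_some : ∀ {φ : T} {ω : CApx} {l i : ℕ} {d : T × T}, ω.hat = φ.hat →
    φ.get l i = some d → ∃ t, (idSbn ω.hat).lookup l i ω = some (.ren l i, t)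
  | .snoc φ k α ψ, .snoc ω k' t, l, i, d, e, h => by
    simp only [CApx.hat, T.hat, List.cons.injEq] at e
    obtain ⟨rfl, e⟩ := e
    rw [T.get] at h
    rw [CApx.hat, idSbn, Sbn.lookup_snoc]
    rcases index_cases k' l i with ⟨rfl, rfl⟩ | ⟨j, rfl⟩
    · rw [cons_zero]; exact ⟨_, rfl⟩
    · rw [cons_shift] at h
      obtain ⟨t', ht⟩ := idSbn_lookup_some e h
      rw [cons_shift, Sbn.lookup_wk, ht]
      exact ⟨t', by simp only [Option.map_some, Ent.wk, shift, Nat.zero_le, and_true]⟩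
  | .snoc φ k α ψ, .nil, _, _, _, e, _ => by cases e
  | .nil, _, _, _, _, _, h => by cases h
  | .base _, _, _, _, _, _, h => by cases h
  | .arrow _ _ _ _, _, _, _, _, _, h => by cases h

/-! ### Substitutions and environments -/

/-- The domain of a simultaneous substitution fits its list of entries. -/
def Sb.Wf : Sb → Prop
  | .single _ _ _ _ _ _ => True
  | .simul _ σ φ => σ.Len φ

/-- The substitution `θ` acts on the variables of `G` as the environment `e` does, and it knows the
approximate types of those variables which it replaces by closures. -/
def Agree (G : SCtx) (θ : Sb) (e : Env) : Prop :=
  θ.Wf ∧ ∀ k i α φ, G k i = some (α, φ) → ∃ F t, θ.img k i = some (F, t) ∧ e k i = F.toX ∧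
    ∀ k' h N, F = .clo k' h N → t = .known α.toApx φ.toCApx

theorem Sb.Wf.under {θ : Sb} (h : θ.Wf) (k : ℕ) : (θ.under k).Wf := by
  cases θ with
  | single => trivial
  | simul n σ φ =>
    rw [Sb.under]; split
    · exact (Sbn.Len.wk h k 0).ins _ _ _
    · exact Sbn.Len.wk h k 0

/-- Under a binder, the bound variable is its own image. -/
theorem Sb.img_under_zero {θ : Sb} (hw : θ.Wf) (k : ℕ) :
    ∃ t, (θ.under k).img k 0 = some (.ren k 0, t) := by
  cases θ with
  | single n c h N α φ =>
    by_cases hk : k = n <;> simp [Sb.under, Sb.img, hk]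
  | simul n σ φ =>
    by_cases hk : k < n
    · have e := congrFun (congrFun
        (Sbn.lookup_ins k (.ren k 0) .unknown (Sbn.Len.wk (show σ.Len φ from hw) k 0)) k) 0
      rw [cons_zero] at e
      exact ⟨.unknown, by simp only [Sb.under, if_pos hk, Sb.img, e]⟩
    · exact ⟨.unknown, by simp only [Sb.under, if_neg hk, Sb.img]⟩

/-- Under a binder, the images of the other variables are weakened. -/
theorem Sb.img_under_shift {θ : Sb} (hw : θ.Wf) (k l i : ℕ) :
    (θ.under k).img l (shift k l i) = (θ.img l i).map fun p => (p.1.wk k 0, p.2) := by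
  cases θ with
  | single n c h N α φ =>
    simp only [Sb.under, Sb.img]
    by_cases hl : l = n
    · subst hl
      by_cases hk : k = l
      · subst hk
        simp only [shift, if_true, Nat.add_right_cancel_iff, Nat.add_lt_add_iff_right, le_refl]
        split
        · simp [Ent.wk]
        · split
          · simp only [Option.map_some, Ent.wk, true_and, Nat.zero_le, if_true]
            congr 3; omega
          · simp [Ent.wk]
      · have hk' : l ≠ k := fun h => hk h.symm
        simp only [shift, if_neg hk', if_neg hk, if_true]
        split
        · simp [Ent.wk]
        · split <;> simp [Ent.wk, hk']
    · simp only [if_neg hl, Option.map_some, Ent.wk, shift, Nat.zero_le, and_true]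
  | simul n σ φ =>
    by_cases hl : l < n
    · by_cases hk : k < n
      · have e := congrFun (congrFun
          (Sbn.lookup_ins k (.ren k 0) .unknown (Sbn.Len.wk (show σ.Len φ from hw) k 0)) l)
          (shift k l i)
        rw [cons_shift, Sbn.lookup_wk] at e
        simp only [Sb.under, if_pos hk, Sb.img, if_pos hl, e]
      · simp only [Sb.under, if_neg hk, Sb.img, if_pos hl, Sbn.lookup_wk]
        rw [shift_ne (by omega)]
    · have : (Sb.under k (.simul n σ φ)).img l (shift k l i)
          = some (.ren l (shift k l i), .unknown) := by
        rw [Sb.under]; split <;> rw [Sb.img, if_neg hl]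
      rw [this, Sb.img, if_neg hl]
      simp only [Option.map_some, Ent.wk, shift, Nat.zero_le, and_true]

theorem Agree.under {G : SCtx} {θ : Sb} {e : Env} (h : Agree G θ e) (k : ℕ) (d : Option (T × T)) :
    Agree (cons k d G) (θ.under k) (MLCTT.under k e) := by
  refine ⟨h.1.under k, fun l i α φ hl => ?_⟩
  rcases index_cases k l i with ⟨rfl, rfl⟩ | ⟨j, rfl⟩
  · obtain ⟨t, ht⟩ := Sb.img_under_zero h.1 l
    exact ⟨_, t, ht, under_zero _ _, fun _ _ _ h => by cases h⟩
  · rw [cons_shift] at hl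
    obtain ⟨F, t, h1, h2, h3⟩ := h.2 l j α φ hl
    refine ⟨F.wk k 0, t, by rw [Sb.img_under_shift h.1, h1]; rfl, ?_, fun k' hh N hF => ?_⟩
    · rw [under_shift, h2, F.toX_weak]
    · cases F with
      | ren => cases hF
      | clo => exact h3 _ _ _ rfl

/-- A simultaneous substitution inside of a closure, with some approximation `ω` of the context of
the closure. -/
theorem Agree.enter_simul {G : SCtx} {n : ℕ} {σ : Sbn} {φ : CApx} {e : Env}
    (h : Agree G (.simul n σ φ) e) {k : ℕ} (hk : k ≤ n) {ψ : T} (hψ : ψ.Ok (some k)) {ω : CApx}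
    (hω : ω.hat = ψ.hat) :
    Agree (belowOr k ψ.get G) (.simul n ((σ.chop k φ).merge (φ.chop k) (idSbn ω.hat) ω)
      ((φ.chop k).merge ω)) (enterE k e) := by
  have hl : σ.Len φ := h.1
  refine ⟨(hl.chop k).merge idSbn_len, fun l i α χ hG => ?_⟩
  rcases Nat.lt_or_ge l k with hlk | hlk
  · rw [belowOr_lt hlk] at hG
    obtain ⟨t, ht⟩ := idSbn_lookup_some hω hG
    refine ⟨.ren l i, t, ?_, by rw [enterE, belowOr_lt hlk]; rfl, fun _ _ _ h => by cases h⟩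
    rw [Sb.img, if_pos (by omega)]
    exact Sbn.lookup_merge_some (i := i) (hl.chop k) idSbn_len ht
  · rw [belowOr_ge hlk] at hG
    obtain ⟨F, t, h1, h2, h3⟩ := h.2 l i α χ hG
    refine ⟨F, t, ?_, by rw [enterE, belowOr_ge hlk, h2], h3⟩
    rw [← h1, Sb.img, Sb.img]
    split
    · rw [Sbn.lookup_merge_other (hl.chop k) i idSbn_len
        (fun hm => absurd (hψ.lt l (hω ▸ hm)) (by omega)), Sbn.lookup_chop hlk i hl]
    · rfl

/-- Inside of a closure the substitution still acts as the environment does. -/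
theorem Agree.enter {G : SCtx} {θ : Sb} {e : Env} (h : Agree G θ e) {k : ℕ} (hk : θ.Enters k)
    {ψ : T} (hψ : ψ.Ok (some k)) : Agree (belowOr k ψ.get G) (θ.enter k ψ.hat) (enterE k e) := by
  cases θ with
  | single n c hh N α φ =>
    refine ⟨trivial, fun l i β χ hG => ?_⟩
    rcases Nat.lt_or_ge l k with hlk | hlk
    · have : l ≠ n := fun h => by subst h; exact absurd hk (by simp only [Sb.Enters]; omega)
      exact ⟨.ren l i, .unknown, by simp only [Sb.enter, Sb.img, if_neg this],
        by rw [enterE, belowOr_lt hlk]; rfl, fun _ _ _ h => by cases h⟩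
    · rw [belowOr_ge hlk] at hG
      obtain ⟨F, t, h1, h2, h3⟩ := h.2 l i β χ hG
      exact ⟨F, t, h1, by rw [enterE, belowOr_ge hlk, h2], h3⟩
  | simul n σ φ =>
    have := h.enter_simul (Nat.le_of_lt hk) hψ (CApx.hat_ofHat ψ.hat)
    rwa [CApx.hat_ofHat] at this

/-- Inside of a closure of too high a level the substitution has no effect. -/
theorem Agree.skip {G : SCtx} {θ : Sb} {e : Env} (h : Agree G θ e) {k : ℕ} (hk : ¬ θ.Enters k)
    {l i : ℕ} {d : T × T} (hl : k ≤ l) (hG : G l i = some d) : e l i = .ren l i := by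
  obtain ⟨F, t, h1, h2, -⟩ := h.2 l i d.1 d.2 hG
  rw [h2]
  cases θ with
  | single n c hh N α φ =>
    simp only [Sb.Enters] at hk
    simp only [Sb.img] at h1
    rw [if_neg (by omega)] at h1; cases h1; rfl
  | simul n σ φ =>
    simp only [Sb.Enters] at hk
    simp only [Sb.img] at h1
    rw [if_neg (by omega)] at h1; cases h1; rfl

theorem Has.len {G : SCtx} {φ : T} : ∀ {σ : Sbn}, Has s G σ.toX (.sbn φ) → σ.Len φ.toCApx := by
  induction φ with
  | snoc φ k α ψ ih _ _ =>
    intro σ h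
    cases σ with
    | nil => cases h
    | snoc σ F =>
      rcases h.sbn_inv with ⟨e, -⟩ | ⟨_, _, _, _, _, _, e1, e2, h1, _⟩
      · cases e
      · cases e1; cases e2; exact ih h1
  | nil =>
    intro σ h
    cases σ with
    | nil => trivial
    | snoc =>
      rcases h.sbn_inv with ⟨e, -⟩ | ⟨_, _, _, _, _, _, -, e, _⟩ <;> cases e
  | _ => intro σ h; generalize σ.toX = M at h; cases h

theorem Has.lookup_inst {G : SCtx} {n : ℕ} {φ : T} : ∀ {σ : Sbn} {l i : ℕ} {α ψ : T},
    Has s G σ.toX (.sbn φ) → φ.get l i = some (α, ψ) →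
    ∃ F, σ.lookup l i φ.toCApx = some (F, .known α.toApx ψ.toCApx) ∧
      inst n φ.hat σ.toX l i = F.toX := by
  induction φ with
  | snoc φ k α ψ ih _ _ =>
    intro σ l i β χ h hl
    cases σ with
    | nil => cases h
    | snoc σ F =>
      rcases h.sbn_inv with ⟨e, -⟩ | ⟨_, _, _, _, _, _, e1, e2, h1, _⟩
      · cases e
      · cases e1; cases e2
        rw [T.toCApx, Sbn.lookup_snoc, T.hat, inst]
        rw [T.get] at hl
        rcases index_cases k l i with ⟨rfl, rfl⟩ | ⟨j, rfl⟩
        · rw [cons_zero] at hl; cases hl; rw [cons_zero, cons_zero]; exact ⟨F, rfl, rfl⟩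
        · rw [cons_shift] at hl; rw [cons_shift, cons_shift]; exact ih h1 hl
  | _ => intro σ l i β χ h hl; cases hl

/-- A simultaneous substitution acts as the environment of its entries. -/
theorem Agree.inst {G : SCtx} {n : ℕ} {φ : T} {σ : Sbn} (hφ : φ.Ok (some n))
    (hσ : Has s G σ.toX (.sbn φ)) :
    Agree (belowOr n φ.get G) (.simul n σ φ.toCApx) (inst n φ.hat σ.toX) := by
  refine ⟨hσ.len, fun l i α ψ hl => ?_⟩
  rcases Nat.lt_or_ge l n with hln | hln
  · rw [belowOr_lt hln] at hl
    obtain ⟨F, h1, h2⟩ := hσ.lookup_inst (n := n) hl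
    exact ⟨F, _, by rw [Sb.img, if_pos hln, h1], h2, fun _ _ _ _ => rfl⟩
  · exact ⟨.ren l i, .unknown, by rw [Sb.img, if_neg (by omega)], inst_ge hφ.lt hln,
      fun _ _ _ h => by cases h⟩

/-- A single substitution acts as the environment with one closure. -/
theorem Agree.single (G : SCtx) (n : ℕ) (h : List ℕ) (N : Tm) (α φ : T) :
    Agree (cons n (some (α, φ)) G) (.single n 0 h N α.toApx φ.toCApx) (single n h N.toX) := by
  refine ⟨trivial, fun l i β ψ hl => ?_⟩
  rcases index_cases n l i with ⟨rfl, rfl⟩ | ⟨j, rfl⟩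
  · rw [cons_zero] at hl; cases hl
    exact ⟨.clo l h N, _, by simp [Sb.img], single_zero _ _ _, fun _ _ _ _ => rfl⟩
  · refine ⟨.ren l j, .unknown, ?_, single_shift _ _ _ _ _, fun _ _ _ h => by cases h⟩
    by_cases hln : l = n <;> simp [Sb.img, shift, hln]

/-! ### Bounds on redices -/

mutual
/-- The codomain of a function type that occurs in `δ` occurs in `δ` as well, so that the results of
reductions stay within the bound on redices. -/
theorem Apx.Occ.codom {α δ β : Apx} {φ : CApx} : ∀ {γ : Apx}, γ.Occ δ → γ = .arrow α φ β →
    Apx.Occ β δ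
  | _, .refl _, e => by subst e; exact .cod (.refl _)
  | _, .dom h, e => .dom (h.codom e)
  | _, .ctx h, e => .ctx (h.codom e)
  | _, .cod h, e => .cod (h.codom e)
theorem CApx.Occ.codom {α β : Apx} {φ ψ : CApx} : ∀ {γ : Apx}, CApx.Occ γ ψ → γ = .arrow α φ β →
    CApx.Occ β ψ
  | _, .here h, e => .here (h.codom e)
  | _, .there h, e => .there (h.codom e)
end

theorem Sb.Bounds.codom {α β : Apx} {φ : CApx} {θ : Sb} (h : θ.Bounds (.arrow α φ β)) :
    θ.Bounds β := by
  cases θ with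
  | single => exact h.imp (·.codom rfl) (·.codom rfl)
  | simul => exact CApx.Occ.codom h rfl

theorem Sbn.lookup_occ {α : Apx} {ψ : CApx} {F : Ent} {k : ℕ} : ∀ {σ : Sbn} {φ : CApx} {i : ℕ},
    σ.lookup k i φ = some (F, .known α ψ) → CApx.Occ α φ
  | .nil, φ, i, h => by rw [Sbn.lookup_nil] at h; cases h
  | .snoc σ F, .nil, i, h => by cases h
  | .snoc σ F, .snoc φ n t, i, h => by
    rw [Sbn.lookup_snoc] at h
    rcases index_cases n k i with ⟨rfl, rfl⟩ | ⟨j, rfl⟩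
    · rw [cons_zero] at h; cases h; exact .here (.refl _)
    · rw [cons_shift] at h; exact .there (Sbn.lookup_occ h)

/-- The approximate types of the domain are within the bound on redices. -/
theorem Sb.img_bounds {θ : Sb} {k i : ℕ} {F : Ent} {α : Apx} {φ : CApx}
    (h : θ.img k i = some (F, .known α φ)) : θ.Bounds α := by
  cases θ with
  | single n c hh N β ψ =>
    simp only [Sb.img] at h
    split_ifs at h <;> cases h
    exact .inl (.refl _)
  | simul n σ ψ =>
    simp only [Sb.img] at h
    split_ifs at h
    · exact Sbn.lookup_occ h
    · cases h

/-! ### The graphs of hereditary substitution -/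

mutual
/-- Hereditary substitution on expressions is single-valued, in every syntactic category. -/
theorem HATy.det : ∀ {θ : Sb} {P P₁ P₂ : ATy}, HATy θ P P₁ → HATy θ P P₂ → P₁ = P₂
  | _, _, _, _, .sort _, .sort _ => rfl
  | _, _, _, _, .con _, .con _ => rfl
  | _, _, _, _, .app h1 h2, .app h3 h4 => by rw [h1.det h3, h2.det h4]
termination_by structural _ _ _ _ h => h
theorem HTy.det : ∀ {θ : Sb} {A A₁ A₂ : Ty}, HTy θ A A₁ → HTy θ A A₂ → A₁ = A₂
  | _, _, _, _, .atom h1, .atom h2 => by rw [h1.det h2]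
  | _, _, _, _, .pi h1 h2 h3, .pi h4 h5 h6 => by rw [h1.det h4, h2.det h5, h3.det h6]
termination_by structural _ _ _ _ h => h
theorem HCloTy.det : ∀ {θ : Sb} {k : ℕ} {h : List ℕ} {A A₁ A₂ : Ty},
    HCloTy θ k h A A₁ → HCloTy θ k h A A₂ → A₁ = A₂
  | _, _, _, _, _, _, .act _ h1, .act _ h2 => h1.det h2
  | _, _, _, _, _, _, .act h _, .skip h' => absurd h h'
  | _, _, _, _, _, _, .skip h, .act h' _ => absurd h' h
  | _, _, _, _, _, _, .skip _, .skip _ => rfl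
termination_by structural _ _ _ _ _ _ h => h
theorem HNe.det : ∀ {θ : Sb} {R : Ne} {r₁ r₂ : NeRes}, HNe θ R r₁ → HNe θ R r₂ → r₁ = r₂
  | _, _, _, _, .con _, .con _ => rfl
  | _, _, _, _, .ren h1 h2, .ren h3 h4 => by
    rw [h1] at h3; cases h3; rw [h2.det h4]
  | _, _, _, _, .ren h1 _, .clo h3 _ _ => by rw [h1] at h3; cases h3
  | _, _, _, _, .clo h1 _ _, .ren h3 _ => by rw [h1] at h3; cases h3
  | _, _, _, _, .clo h1 h2 h3, .clo h4 h5 h6 => by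
    rw [h1] at h4; cases h4; cases h2.det h5; rw [h3.det h6]
  | _, _, _, _, .app h1 h2, .app h3 h4 => by cases h1.det h3; rw [h2.det h4]
  | _, _, _, _, .app h1 _, .beta h3 _ _ _ => by cases h1.det h3
  | _, _, _, _, .beta h1 _ _ _, .app h3 _ => by cases h1.det h3
  | _, _, _, _, .beta h1 _ h2 h3, .beta h4 _ h5 h6 => by
    cases h1.det h4; cases h2.det h5; rw [h3.det h6]
termination_by structural _ _ _ _ h => h
theorem HTm.det : ∀ {θ : Sb} {M M₁ M₂ : Tm}, HTm θ M M₁ → HTm θ M M₂ → M₁ = M₂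
  | _, _, _, _, .ne h1, .ne h2 => by cases h1.det h2; rfl
  | _, _, _, _, .ne h1, .nm h2 => by cases h1.det h2
  | _, _, _, _, .nm h1, .ne h2 => by cases h1.det h2
  | _, _, _, _, .nm h1, .nm h2 => by cases h1.det h2; rfl
  | _, _, _, _, .lam h1, .lam h2 => by rw [h1.det h2]
termination_by structural _ _ _ _ h => h
theorem HClo.det : ∀ {θ : Sb} {k : ℕ} {h : List ℕ} {M M₁ M₂ : Tm},
    HClo θ k h M M₁ → HClo θ k h M M₂ → M₁ = M₂
  | _, _, _, _, _, _, .act _ h1, .act _ h2 => h1.det h2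
  | _, _, _, _, _, _, .act h _, .skip h' => absurd h h'
  | _, _, _, _, _, _, .skip h, .act h' _ => absurd h' h
  | _, _, _, _, _, _, .skip _, .skip _ => rfl
termination_by structural _ _ _ _ _ _ h => h
theorem HEnt.det : ∀ {θ : Sb} {F F₁ F₂ : Ent}, HEnt θ F F₁ → HEnt θ F F₂ → F₁ = F₂
  | _, _, _, _, .ren h1, .ren h2 => by rw [h1] at h2; cases h2; rfl
  | _, _, _, _, .clo h1, .clo h2 => by rw [h1.det h2]
termination_by structural _ _ _ _ h => h
theorem HSbn.det : ∀ {θ : Sb} {σ σ₁ σ₂ : Sbn}, HSbn θ σ σ₁ → HSbn θ σ σ₂ → σ₁ = σ₂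
  | _, _, _, _, .nil, .nil => rfl
  | _, _, _, _, .snoc h1 h2, .snoc h3 h4 => by rw [h1.det h3, h2.det h4]
termination_by structural _ _ _ _ h => h
theorem HCtx.det : ∀ {θ : Sb} {m : ℕ} {Γ Γ₁ Γ₂ : Ctx}, HCtx θ m Γ Γ₁ → HCtx θ m Γ Γ₂ → Γ₁ = Γ₂
  | _, _, _, _, _, .skip _, .skip _ => rfl
  | _, _, _, _, _, .skip h, .nil h' => absurd h' h
  | _, _, _, _, _, .skip h, .snoc h' _ _ _ => absurd h' h
  | _, _, _, _, _, .nil h, .skip h' => absurd h h'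
  | _, _, _, _, _, .nil _, .nil _ => rfl
  | _, _, _, _, _, .snoc h _ _ _, .skip h' => absurd h h'
  | _, _, _, _, _, .snoc _ h1 h2 h3, .snoc _ h4 h5 h6 => by
    rw [h1.det h4, h2.det h5, h3.det h6]
termination_by structural _ _ _ _ _ h => h
end

theorem IsValue.of_det {Y : Type} {p : Y → Prop} {x : Y} (h : p x)
    (det : ∀ {y z}, p y → p z → y = z) : IsValue p x :=
  fun _ => ⟨fun hy => det hy h, fun e => e ▸ h⟩

/-- A context `Γᵐ` depends only on the variables of levels `≥ m`. -/
theorem Has.ctx_sub_id {G : SCtx} {Γ : X} {j : J} (h : Has s G Γ j) : ∀ {m : ℕ} {φ : T} {e : Env},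
    j = .ctx m φ → (∀ l i d, m ≤ l → G l i = some d → e l i = .ren l i) → Sub e Γ Γ := by
  induction h with
  | cnil => intro m φ e _ _; exact .leaf _
  | csnoc _ _ h ih _ =>
    intro m φ e ej he
    cases ej
    refine .pair (ih rfl he) (.clo (h.sub_id fun l i d hl => ?_))
    rcases Nat.lt_or_ge l _ with hlm | hlm
    · exact belowOr_lt hlm _ _ _
    · rw [belowOr_ge hlm] at hl; rw [enterE, belowOr_ge hlm]; exact he l i d hlm hl
  | _ => intro m φ e ej; cases ej

theorem Has.clo_sub_id {G : SCtx} {M Y : X} {k : ℕ} {f : SCtx} {e : Env} {j : J}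
    (h : Has s (belowOr k f G) M j) (he : ∀ l i d, k ≤ l → G l i = some d → e l i = .ren l i)
    (hY : Sub (enterE k e) M Y) : Y = M := by
  refine hY.det (h.sub_id fun l i d hl => ?_)
  rcases Nat.lt_or_ge l k with hlk | hlk
  · exact belowOr_lt hlk _ _ _
  · rw [belowOr_ge hlk] at hl; rw [enterE, belowOr_ge hlk]; exact he l i d hlk hl

/-- The graph of the substitution `θ` relates `M` to `Y`; both are trees of expressions. -/
def Graph (s : SSig) (G' : SCtx) (θ : Sb) (M Y : X) : J → Prop
  | .syn α => ∃ R : Ne, M = R.toX ∧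
      ((∃ R' : Ne, Y = R'.toX ∧ HNe θ R (.ne R') ∧ Has s G' Y (.syn α)) ∨
        ∃ N : Tm, Y = N.toX ∧ HNe θ R (.nm N α.toApx) ∧ Has s G' Y (.chk α) ∧ θ.Bounds α.toApx)
  | .chk _ => ∃ N N' : Tm, M = N.toX ∧ Y = N'.toX ∧ HTm θ N N'
  | .ent true _ _ _ => ∃ F F' : Ent, M = F.toX ∧ Y = F'.toX ∧ HEnt θ F F'
  | .ent false k _ φ => ∃ N N' : Tm, M = .clo false k φ.hat N.toX ∧ Y = .clo false k φ.hat N'.toX ∧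
      HClo θ k φ.hat N N'
  | .sbn _ => ∃ σ σ' : Sbn, M = σ.toX ∧ Y = σ'.toX ∧ HSbn θ σ σ'
  | .asyn _ _ => ∃ P P' : ATy, M = P.toX ∧ Y = P'.toX ∧ HATy θ P P'
  | .ty _ => ∃ A A' : Ty, M = A.toX ∧ Y = A'.toX ∧ HTy θ A A'
  | .ctx m φ => ∃ Γ Γ' : Ctx, M = Γ.toX m ∧ Y = Γ'.toX m ∧ Γ.hat = φ.hat ∧ Γ'.hat = φ.hat ∧
      HCtx θ m Γ Γ'
  | .decl k _ φ => ∃ (A A' : Ty) (Γ Γ' : Ctx), M = declX k A Γ ∧ Y = declX k A' Γ' ∧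
      Γ.hat = φ.hat ∧ Γ'.hat = φ.hat ∧ HCloTy θ k φ.hat A A' ∧ HCtx θ k Γ Γ'

/-- On simply typed trees, hereditary substitution by an environment gives the values of hereditary
substitution on expressions.  The bound on the approximate types of redices is always satisfied. -/
theorem Sub.graph (b : ℕ) : ∀ {G : SCtx} {M : X} {j : J}, Has s G M j →
    ∀ {G' : SCtx} {e : Env} {θ : Sb}, HasEnv s G' e G → Bd b G e → Agree G θ e →
    ∀ {Y : X}, Sub e M Y → Graph s G' θ M Y j := by
  induction b using Nat.strong_induction_on with
  | _ b IH =>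
  intro G M j h
  induction h with
  | @con _ c _ h1 h2 =>
    intro G' e θ hE hB hA Y hY
    cases hY
    exact ⟨.con c, rfl, .inl ⟨.con c, rfl, .con c, .con h1 h2⟩⟩
  | @var G k i σ α φ g1 g2 g3 hσ ih =>
    intro G' e θ hE hB hA Y hY
    obtain ⟨F, t, a1, a2, a3⟩ := hA.2 k i α φ g1
    have hF := hE k i α φ g1 g2 g3
    cases hY with
    | @vren _ _ _ i' _ σ' e1 h1 =>
      obtain ⟨σ, σ', rfl, rfl, h2⟩ := ih hE hB hA h1
      have hσ' : Has s G' σ'.toX (.sbn φ) := by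
        obtain ⟨_, h3, h4⟩ := Sub.total b hσ hE hB
        rw [h1.det h3]; exact h4
      rw [e1] at a2 hF
      obtain rfl : F = .ren k i' := Ent.toX_inj a2.symm
      exact ⟨.var k i σ, rfl, .inl ⟨.var k i' σ', rfl, .ren a1 h2, .var hF.ren_inv g2 g3 hσ'⟩⟩
    | @vclo _ _ _ h _ σ' N _ e1 _ h1 h2 =>
      obtain ⟨σ, σ', rfl, rfl, h3⟩ := ih hE hB hA h1
      have hσ' : Has s G' σ'.toX (.sbn φ) := by
        obtain ⟨_, h3, h4⟩ := Sub.total b hσ hE hB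
        rw [h1.det h3]; exact h4
      rw [e1] at a2 hF
      obtain ⟨-, -, rfl, -, hN⟩ := hF.clo_inv
      cases F with
      | ren => cases a2
      | clo k' h' N' =>
        have ht := a3 _ _ _ rfl
        subst ht
        cases a2
        have hb : φ.size < b := by
          rcases hB k i α φ g1 with ⟨i', e2⟩ | hb
          · rw [e1] at e2; cases e2
          · omega
        obtain ⟨N, N', q1, rfl, h5⟩ := IH φ.size hb hN (HasEnv.inst g3 hσ') (Bd.inst g3)
          (Agree.inst g3 hσ') h2
        cases Tm.toX_inj q1
        obtain ⟨_, h6, h7⟩ := Sub.total φ.size hN (HasEnv.inst g3 hσ') (Bd.inst g3)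
        cases h2.det h6
        exact ⟨.var k i σ, rfl, .inr ⟨N', rfl, .clo a1 h3 h5, h7, Sb.img_bounds a1⟩⟩
  | @app G R F k α φ β h1 h2 ih1 ih2 =>
    intro G' e θ hE hB hA Y hY
    cases hY with
    | app s1 s2 s3 =>
      obtain ⟨R, rfl, q⟩ := ih1 hE hB hA s1
      obtain ⟨N, N', rfl, rfl, q2⟩ := ih2 hE hB hA s3
      obtain ⟨_, s4, t4⟩ := Sub.total b h2 hE hB
      cases s3.det s4
      refine ⟨.app R k φ.hat N, rfl, .inl ?_⟩
      rcases q with ⟨R', rfl, q1, t1⟩ | ⟨N1, rfl, q1, t1, -⟩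
      · exact ⟨.app R' k φ.hat N', rfl, .app q1 q2, .app t1 t4⟩
      · cases N1 with
        | ne R' =>
          have := R'.toX_isLam
          replace t1 : Has s G' R'.toX _ := t1
          generalize R'.toX = Z at t1 this
          cases t1; cases this
        | lam => cases s2
    | beta s1 s2 s3 =>
      obtain ⟨R, rfl, q⟩ := ih1 hE hB hA s1
      obtain ⟨N, N', rfl, q0, q2⟩ := ih2 hE hB hA s2
      cases q0
      obtain ⟨_, s4, t4⟩ := Sub.total b h2 hE hB
      cases s2.det s4
      replace t4 : Has s G' (.clo false k φ.hat N'.toX) (.ent false k α φ) := t4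
      refine ⟨.app R k φ.hat N, rfl, .inr ?_⟩
      rcases q with ⟨R', q0, q1, t1⟩ | ⟨N1, q0, q1, t1, hb⟩
      · rw [q0] at t1
        have := R'.toX_isLam
        rw [← q0] at this; cases this
      · cases N1 with
        | ne R' => have := R'.toX_isLam; rw [← Tm.toX, ← q0] at this; cases this
        | lam k' B =>
          cases q0
          cases t1 with
          | lam o1 o2 t1 =>
          have hs : α.size + φ.size + 1 < b := by
            obtain ⟨_, s5, t5⟩ := Sub.total b h1 hE hB
            cases s1.det s5
            rcases t5 with t5 | ⟨-, t5⟩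
            · cases t5
            · simp only [T.size] at t5; omega
          obtain ⟨B1, B', q3, rfl, q4⟩ := IH _ hs t1 (HasEnv.single t4) Bd.single
            (Agree.single _ _ _ _ _ _) s3
          cases Tm.toX_inj q3
          obtain ⟨_, s6, t6⟩ := Sub.total _ t1 (HasEnv.single t4) Bd.single
          cases s3.det s6
          exact ⟨B', rfl, .beta q1 hb q2 q4, t6, hb.codom⟩
  | ne _ ih =>
    intro G' e θ hE hB hA Y hY
    obtain ⟨R, rfl, ⟨R', rfl, q, -⟩ | ⟨N, rfl, q, -⟩⟩ := ih hE hB hA hY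
    · exact ⟨.ne R, .ne R', rfl, rfl, .ne q⟩
    · exact ⟨.ne R, N, rfl, rfl, .nm q⟩
  | @lam _ k _ _ _ _ _ _ _ ih =>
    intro G' e θ hE hB hA Y hY
    cases hY with
    | lam hY =>
      obtain ⟨N, N', rfl, rfl, q⟩ := ih (hE.under _ _) (hB.under _ _) (hA.under _ _) hY
      exact ⟨.lam k N, .lam k N', rfl, rfl, .lam q⟩
  | @ren G k i α φ g1 g2 g3 =>
    intro G' e θ hE hB hA Y hY
    cases hY with
    | ren e1 _ =>
      obtain ⟨F, t, a1, a2, a3⟩ := hA.2 k i α φ g1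
      exact ⟨.ren k i, F, rfl, e1.symm.trans a2, .ren a1⟩
  | @clo G ee k M α φ o hM ih =>
    intro G' e θ hE hB hA Y hY
    cases hY with
    | @clo _ _ _ _ _ M' hY =>
      have : ∃ N N' : Tm, M = N.toX ∧ M' = N'.toX ∧ HClo θ k φ.hat N N' := by
        by_cases hk : θ.Enters k
        · obtain ⟨N, N', rfl, rfl, q⟩ := ih (hE.enter _ _) (hB.enter _ _) (hA.enter hk o) hY
          exact ⟨N, N', rfl, rfl, .act hk q⟩
        · obtain ⟨N, rfl⟩ := hM.img
          exact ⟨N, N, rfl, hM.clo_sub_id (fun l i d => hA.skip hk) hY, .skip hk⟩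
      obtain ⟨N, N', rfl, rfl, q⟩ := this
      cases ee with
      | false => exact ⟨N, N', rfl, rfl, q⟩
      | true => exact ⟨.clo k φ.hat N, .clo k φ.hat N', rfl, rfl, .clo q⟩
  | nil => intro G' e θ hE hB hA Y hY; cases hY; exact ⟨.nil, .nil, rfl, rfl, .nil⟩
  | snoc _ _ ih1 ih2 =>
    intro G' e θ hE hB hA Y hY
    cases hY with
    | pair s1 s2 =>
      obtain ⟨σ, σ', rfl, rfl, q1⟩ := ih1 hE hB hA s1
      obtain ⟨F, F', rfl, rfl, q2⟩ := ih2 hE hB hA s2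
      exact ⟨.snoc σ F, .snoc σ' F', rfl, rfl, .snoc q1 q2⟩
  | @acon _ a =>
    intro G' e θ hE hB hA Y hY; cases hY; exact ⟨.con a, .con a, rfl, rfl, .con a⟩
  | @aapp _ _ _ k _ φ _ _ _ _ ih1 ih2 =>
    intro G' e θ hE hB hA Y hY
    cases hY with
    | pair s1 s2 =>
      obtain ⟨P, P', rfl, rfl, q1⟩ := ih1 hE hB hA s1
      obtain ⟨N, N', rfl, rfl, q2⟩ := ih2 hE hB hA s2
      exact ⟨.app P k φ.hat N, .app P' k φ.hat N', rfl, rfl, .app q1 q2⟩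
  | sort t =>
    intro G' e θ hE hB hA Y hY; cases hY
    exact ⟨.atom (.sort t), .atom (.sort t), rfl, rfl, .atom (.sort t)⟩
  | atom _ ih =>
    intro G' e θ hE hB hA Y hY
    obtain ⟨P, P', rfl, rfl, q⟩ := ih hE hB hA hY
    exact ⟨.atom P, .atom P', rfl, rfl, .atom q⟩
  | @pi _ _ _ k _ φ _ _ _ ih1 ih2 =>
    intro G' e θ hE hB hA Y hY
    cases hY with
    | pair s1 s2 =>
      cases s2 with
      | lam s2 =>
        obtain ⟨A, A', Γ, Γ', rfl, rfl, l1, l2, q1, q2⟩ := ih1 hE hB hA s1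
        obtain ⟨B, B', rfl, rfl, q3⟩ := ih2 (hE.under _ _) (hB.under _ _) (hA.under _ _) s2
        exact ⟨.pi k A Γ B, .pi k A' Γ' B', rfl, rfl, .pi (l1 ▸ q1) q2 q3⟩
  | @decl G M0 _ k α φ hM hΓ ih1 ih2 =>
    intro G' e θ hE hB hA Y hY
    cases hY with
    | pair s1 s2 =>
      cases s1 with
      | @clo _ _ _ _ _ M' s1 =>
      obtain ⟨Γ, Γ', rfl, rfl, l1, l2, q2⟩ := ih2 hE hB hA s2
      have : ∃ N N' : Ty, M0 = N.toX ∧ M' = N'.toX ∧ HCloTy θ k φ.hat N N' := by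
        by_cases hk : θ.Enters k
        · obtain ⟨N, N', rfl, rfl, q⟩ :=
            ih1 (hE.enter _ _) (hB.enter _ _) (hA.enter hk hΓ.ok) s1
          exact ⟨N, N', rfl, rfl, .act hk q⟩
        · obtain ⟨N, rfl, -⟩ := hM.img
          exact ⟨N, N, rfl, hM.clo_sub_id (fun l i d => hA.skip hk) s1, .skip hk⟩
      obtain ⟨A, A', rfl, rfl, q⟩ := this
      exact ⟨A, A', Γ, Γ', by rw [declX, l1], by rw [declX, l2], l1, l2, q, q2⟩
  | @cnil G m =>
    intro G' e θ hE hB hA Y hY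
    cases hY
    refine ⟨.nil, .nil, rfl, rfl, rfl, rfl, ?_⟩
    by_cases hk : θ.Enters m
    · exact .nil hk
    · exact .skip hk
  | @csnoc G _ _ m k α φ ψ hΓ hk hD ih1 ih2 =>
    intro G' e θ hE hB hA Y hY
    by_cases hm : θ.Enters m
    · cases hY with
      | pair s1 s2 =>
        cases s2 with
        | clo s2 =>
          obtain ⟨Γ, Γ', rfl, rfl, l1, l2, q1⟩ := ih1 hE hB hA s1
          obtain ⟨A, A', Φ, Φ', rfl, rfl, l3, l4, q3, q4⟩ :=
            ih2 (hE.enter _ _) (hB.enter _ _) (hA.enter hm hΓ.ok) s2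
          refine ⟨.snoc Γ k A Φ, .snoc Γ' k A' Φ', by rw [Ctx.toX, l1]; rfl, by rw [Ctx.toX, l2]; rfl,
            by rw [Ctx.hat, T.hat, l1], by rw [Ctx.hat, T.hat, l2], ?_⟩
          rw [← l1] at q3 q4
          rw [← l3] at q3
          exact .snoc hm q1 q3 q4
    · have h' : Has s G _ (.ctx m (.snoc φ k α ψ)) := .csnoc hΓ hk hD
      obtain ⟨Γ, e1, e2⟩ := h'.img
      have := hY.det (h'.ctx_sub_id rfl fun l i d hl => hA.skip hm hl)
      subst this
      refine ⟨Γ, Γ, e1, e1, ?_, ?_, .skip hm⟩ <;> rw [← e2, Ctx.hat_er]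

/-! ### Equality of types and contractions of trees -/

mutual
/-- A tree is the tree of an expression as soon as some renaming of it is. -/
theorem Ne.of_rename : ∀ (R : Ne) {M : X} {ρ : ℕ → ℕ → ℕ}, M.rename ρ = R.toX →
    ∃ R' : Ne, M = R'.toX
  | .var k i σ, M, ρ, h => by
    cases M <;> simp only [X.rename, Ne.toX, X.var.injEq, reduceCtorEq] at h
    obtain ⟨-, -, h⟩ := h
    obtain ⟨σ', rfl⟩ := Sbn.of_rename σ h
    exact ⟨.var _ _ σ', rfl⟩
  | .con c, M, ρ, h => by
    cases M <;> simp only [X.rename, Ne.toX, X.leaf.injEq, reduceCtorEq] at h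
    subst h; exact ⟨.con c, rfl⟩
  | .app R k h' N, M, ρ, h => by
    cases M <;> simp only [X.rename, Ne.toX, X.app.injEq, reduceCtorEq] at h
    next A B =>
    obtain ⟨h1, h2⟩ := h
    cases B <;> simp only [X.rename, X.clo.injEq, reduceCtorEq] at h2
    obtain ⟨rfl, rfl, rfl, h2⟩ := h2
    obtain ⟨R', rfl⟩ := Ne.of_rename R h1
    obtain ⟨N', rfl⟩ := Tm.of_rename N h2
    exact ⟨.app R' _ _ N', rfl⟩
theorem Tm.of_rename : ∀ (N : Tm) {M : X} {ρ : ℕ → ℕ → ℕ}, M.rename ρ = N.toX →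
    ∃ N' : Tm, M = N'.toX
  | .ne R, M, ρ, h => by
    obtain ⟨R', rfl⟩ := Ne.of_rename R h
    exact ⟨.ne R', rfl⟩
  | .lam k N, M, ρ, h => by
    cases M <;> simp only [X.rename, Tm.toX, X.lam.injEq, reduceCtorEq] at h
    obtain ⟨rfl, h⟩ := h
    obtain ⟨N', rfl⟩ := Tm.of_rename N h
    exact ⟨.lam _ N', rfl⟩
theorem Ent.of_rename : ∀ (F : Ent) {M : X} {ρ : ℕ → ℕ → ℕ}, M.rename ρ = F.toX →
    ∃ F' : Ent, M = F'.toX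
  | .ren k i, M, ρ, h => by
    cases M <;> simp only [X.rename, Ent.toX, X.ren.injEq, reduceCtorEq] at h
    exact ⟨.ren _ _, rfl⟩
  | .clo k h' N, M, ρ, h => by
    cases M <;> simp only [X.rename, Ent.toX, X.clo.injEq, reduceCtorEq] at h
    obtain ⟨rfl, rfl, rfl, h⟩ := h
    obtain ⟨N', rfl⟩ := Tm.of_rename N h
    exact ⟨.clo _ _ N', rfl⟩
theorem Sbn.of_rename : ∀ (σ : Sbn) {M : X} {ρ : ℕ → ℕ → ℕ}, M.rename ρ = σ.toX →
    ∃ σ' : Sbn, M = σ'.toX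
  | .nil, M, ρ, h => by
    cases M <;> simp only [X.rename, Sbn.toX, X.leaf.injEq, reduceCtorEq] at h
    subst h; exact ⟨.nil, rfl⟩
  | .snoc σ F, M, ρ, h => by
    cases M <;> simp only [X.rename, Sbn.toX, X.pair.injEq, reduceCtorEq] at h
    obtain ⟨σ', rfl⟩ := Sbn.of_rename σ h.1
    obtain ⟨F', rfl⟩ := Ent.of_rename F h.2
    exact ⟨.snoc σ' F', rfl⟩
end

theorem Eta.toX {R : Ne} {N : Tm} (h : Eta R N) : EtaX R.toX N.toX := by
  induction h with
  | ne R => exact .ne R.toX_isNeut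
  | lam _ _ ih1 ih2 =>
    rw [Ne.toX, idSbn_toX] at ih1
    rw [Ne.toX, Ne.toX_weak] at ih2
    exact .lam ih1 ih2

/-- An `η`-expansion of trees comes from an `η`-expansion of expressions as soon as its result is
the tree of an expression. -/
theorem EtaX.of_toX {R₀ N₀ : X} (h : EtaX R₀ N₀) : ∀ {N : Tm}, N₀ = N.toX →
    ∃ R : Ne, R₀ = R.toX ∧ Eta R N := by
  induction h with
  | ne hn =>
    rintro N rfl
    cases N with
    | ne R' => exact ⟨R', rfl, .ne R'⟩
    | lam => cases hn
  | @lam R₁ N₁ _ k hh _ _ ih1 ih2 =>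
    rintro N e
    cases N with
    | ne R' => have := R'.toX_isLam; rw [← Tm.toX, ← e] at this; cases this
    | lam k' M =>
      cases e
      obtain ⟨R, h1, h2⟩ := ih2 rfl
      cases R with
      | var => cases h1
      | con => cases h1
      | app R k' h' N₂ =>
        simp only [Ne.toX, X.app.injEq, X.clo.injEq, true_and] at h1
        obtain ⟨h1, rfl, rfl, rfl⟩ := h1
        obtain ⟨R', rfl⟩ := Ne.of_rename R h1
        obtain ⟨R₂, h3, h4⟩ := ih1 rfl
        rw [← idSbn_toX, ← Ne.toX] at h3
        cases Ne.toX_inj h3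
        rw [← Ne.toX_weak] at h1
        cases Ne.toX_inj h1
        exact ⟨R', rfl, .lam h4 h2⟩

mutual
/-- The contraction of an entry does not change the normal form of the tree. -/
theorem EATy.nf : ∀ {P P₁ : ATy}, EATy P P₁ → P.toX.nf = P₁.toX.nf
  | _, _, .fn h => by simp only [ATy.toX, X.nf, h.nf]
  | _, _, .arg h => by simp only [ATy.toX, X.nf, h.nf]
theorem ETy.nf : ∀ {A A₁ : Ty}, ETy A A₁ → A.toX.nf = A₁.toX.nf
  | _, _, .atom h => h.nf
  | _, _, .dom h => by simp only [Ty.toX, X.nf, h.nf]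
  | _, _, .ctx h => by simp only [Ty.toX, X.nf, h.nf, h.hat]
  | _, _, .cod h => by simp only [Ty.toX, X.nf, h.nf]
theorem ENe.nf : ∀ {R R₁ : Ne}, ENe R R₁ → R.toX.nf = R₁.toX.nf
  | _, _, .var h => by simp only [Ne.toX, X.nf, h.nf]
  | _, _, .fn h => by simp only [Ne.toX, X.nf, h.nf]
  | _, _, .arg h => by simp only [Ne.toX, X.nf, h.nf]
theorem ETm.nf : ∀ {M M₁ : Tm}, ETm M M₁ → M.toX.nf = M₁.toX.nf
  | _, _, .ne h => h.nf
  | _, _, .lam h => by simp only [Tm.toX, X.nf, h.nf]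
theorem EEnt.nf : ∀ {F F₁ : Ent}, EEnt F F₁ → F.toX.nf = F₁.toX.nf
  | _, _, @EEnt.contract k i h N hN => by
    have e := hN.toX
    rw [Ne.toX, idSbn_toX] at e
    rw [Ent.toX, Ent.toX, X.nf, X.nf, (e.plain (idX_plain h)).nf, contract_eq e]
  | _, _, .clo h => X.nf_clo_congr h.nf
theorem ESbn.nf : ∀ {σ σ₁ : Sbn}, ESbn σ σ₁ → σ.toX.nf = σ₁.toX.nf
  | _, _, .init h => by simp only [Sbn.toX, X.nf, h.nf]
  | _, _, .last h => by simp only [Sbn.toX, X.nf, h.nf]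
theorem ECtx.hat : ∀ {Γ Γ₁ : Ctx}, ECtx Γ Γ₁ → Γ.hat = Γ₁.hat
  | _, _, .init h => by rw [Ctx.hat, Ctx.hat, h.hat]
  | _, _, .type _ => rfl
  | _, _, .ctx _ => rfl
theorem ECtx.nf : ∀ {Γ Γ₁ : Ctx}, ECtx Γ Γ₁ → ∀ {m : ℕ}, (Γ.toX m).nf = (Γ₁.toX m).nf
  | _, _, .init h, m => by simp only [Ctx.toX, X.nf, h.nf, h.hat]
  | _, _, .type h, m => by simp only [Ctx.toX, X.nf, h.nf]
  | _, _, .ctx h, m => by simp only [Ctx.toX, X.nf, h.nf, h.hat]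
end

theorem rtc_lift {α β : Type} {r : α → α → Prop} {p : β → β → Prop} (f : α → β)
    (hf : ∀ {a b}, r a b → p (f a) (f b)) {a b : α} (h : Relation.ReflTransGen r a b) :
    Relation.ReflTransGen p (f a) (f b) := by
  induction h with
  | refl => exact .refl
  | tail _ h ih => exact ih.tail (hf h)

theorem eqvGen_of_rtc {α : Type} {r : α → α → Prop} {a b : α} (h : Relation.ReflTransGen r a b) :
    Relation.EqvGen r a b := by
  induction h with
  | refl => exact .refl _
  | tail _ h ih => exact .trans _ _ _ ih (.rel _ _ h)

mutual
/-- Every expression can be contracted to one whose tree is the normal form. -/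
theorem ATy.reduce : ∀ P : ATy, ∃ P' : ATy, Relation.ReflTransGen EATy P P' ∧ P'.toX = P.toX.nf
  | .sort t => ⟨_, .refl, rfl⟩
  | .con a => ⟨_, .refl, rfl⟩
  | .app P k h N => by
    obtain ⟨P', h1, h2⟩ := ATy.reduce P
    obtain ⟨N', h3, h4⟩ := Tm.reduce N
    refine ⟨.app P' k h N', (rtc_lift (fun P => ATy.app P k h N) EATy.fn h1).trans
      (rtc_lift (fun N => ATy.app P' k h N) EATy.arg h3), ?_⟩
    rw [ATy.toX, ATy.toX, X.nf, X.nf, h2, h4]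
theorem Ty.reduce : ∀ A : Ty, ∃ A' : Ty, Relation.ReflTransGen ETy A A' ∧ A'.toX = A.toX.nf
  | .atom P => by
    obtain ⟨P', h1, h2⟩ := ATy.reduce P
    exact ⟨.atom P', rtc_lift Ty.atom ETy.atom h1, h2⟩
  | .pi k A Γ B => by
    obtain ⟨A', h1, h2⟩ := Ty.reduce A
    obtain ⟨Γ', h3, h4, h5⟩ := Ctx.reduce Γ
    obtain ⟨B', h6, h7⟩ := Ty.reduce B
    refine ⟨.pi k A' Γ' B', (rtc_lift (fun A => Ty.pi k A Γ B) ETy.dom h1).trans <|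
      (rtc_lift (fun Γ => Ty.pi k A' Γ B) ETy.ctx h3).trans
        (rtc_lift (fun B => Ty.pi k A' Γ' B) ETy.cod h6), ?_⟩
    simp only [Ty.toX, X.nf, h2, h4, h5, h7]
theorem Ne.reduce : ∀ R : Ne, ∃ R' : Ne, Relation.ReflTransGen ENe R R' ∧ R'.toX = R.toX.nf
  | .var k i σ => by
    obtain ⟨σ', h1, h2⟩ := Sbn.reduce σ
    exact ⟨.var k i σ', rtc_lift (Ne.var k i) ENe.var h1, by rw [Ne.toX, Ne.toX, X.nf, h2]⟩
  | .con c => ⟨_, .refl, rfl⟩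
  | .app R k h N => by
    obtain ⟨R', h1, h2⟩ := Ne.reduce R
    obtain ⟨N', h3, h4⟩ := Tm.reduce N
    refine ⟨.app R' k h N', (rtc_lift (fun R => Ne.app R k h N) ENe.fn h1).trans
      (rtc_lift (fun N => Ne.app R' k h N) ENe.arg h3), ?_⟩
    rw [Ne.toX, Ne.toX, X.nf, X.nf, h2, h4]
theorem Tm.reduce : ∀ M : Tm, ∃ M' : Tm, Relation.ReflTransGen ETm M M' ∧ M'.toX = M.toX.nf
  | .ne R => by
    obtain ⟨R', h1, h2⟩ := Ne.reduce R
    exact ⟨.ne R', rtc_lift Tm.ne ETm.ne h1, h2⟩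
  | .lam k M => by
    obtain ⟨M', h1, h2⟩ := Tm.reduce M
    exact ⟨.lam k M', rtc_lift (Tm.lam k) ETm.lam h1, by rw [Tm.toX, Tm.toX, X.nf, h2]⟩
theorem Ent.reduce : ∀ F : Ent, ∃ F' : Ent, Relation.ReflTransGen EEnt F F' ∧ F'.toX = F.toX.nf
  | .ren k i => ⟨_, .refl, rfl⟩
  | .clo k h N => by
    obtain ⟨N', h1, h2⟩ := Tm.reduce N
    have h3 := rtc_lift (Ent.clo k h) EEnt.clo h1
    rw [Ent.toX, X.nf, ← h2]
    rcases contract_cases k h N'.toX with ⟨i, h4, h5⟩ | ⟨_, h5⟩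
    · obtain ⟨R, e1, e2⟩ := h4.of_toX rfl
      rw [← idSbn_toX, ← Ne.toX] at e1
      cases Ne.toX_inj e1
      exact ⟨.ren k i, h3.tail (.contract e2), h5.symm⟩
    · exact ⟨.clo k h N', h3, h5.symm⟩
theorem Sbn.reduce : ∀ σ : Sbn, ∃ σ' : Sbn, Relation.ReflTransGen ESbn σ σ' ∧ σ'.toX = σ.toX.nf
  | .nil => ⟨_, .refl, rfl⟩
  | .snoc σ F => by
    obtain ⟨σ', h1, h2⟩ := Sbn.reduce σ
    obtain ⟨F', h3, h4⟩ := Ent.reduce F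
    refine ⟨.snoc σ' F', (rtc_lift (fun σ => Sbn.snoc σ F) ESbn.init h1).trans
      (rtc_lift (fun F => Sbn.snoc σ' F) ESbn.last h3), ?_⟩
    rw [Sbn.toX, Sbn.toX, X.nf, h2, h4]
theorem Ctx.reduce : ∀ Γ : Ctx, ∃ Γ' : Ctx, Relation.ReflTransGen ECtx Γ Γ' ∧ Γ'.hat = Γ.hat ∧
    ∀ m, Γ'.toX m = (Γ.toX m).nf
  | .nil => ⟨_, .refl, rfl, fun _ => rfl⟩
  | .snoc Ψ k A Γ => by
    obtain ⟨Ψ', h1, h2, h3⟩ := Ctx.reduce Ψ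
    obtain ⟨A', h4, h5⟩ := Ty.reduce A
    obtain ⟨Γ', h6, h7, h8⟩ := Ctx.reduce Γ
    refine ⟨.snoc Ψ' k A' Γ', (rtc_lift (fun Ψ => Ctx.snoc Ψ k A Γ) ECtx.init h1).trans <|
      (rtc_lift (fun A => Ctx.snoc Ψ' k A Γ) ECtx.type h4).trans
        (rtc_lift (fun Γ => Ctx.snoc Ψ' k A' Γ) ECtx.ctx h6), by rw [Ctx.hat, Ctx.hat, h2], ?_⟩
    intro m
    simp only [Ctx.toX, X.nf, h2, h3, h5, h7, h8]
end

/-- Two types are equal if and only if their trees have the same normal form. -/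
theorem Ty.eqv_iff {A B : Ty} : Ty.Eqv A B ↔ A.toX.nf = B.toX.nf := by
  constructor
  · intro h
    induction h with
    | rel _ _ h => exact h.nf
    | refl => rfl
    | symm _ _ _ ih => exact ih.symm
    | trans _ _ _ _ _ ih1 ih2 => exact ih1.trans ih2
  · intro h
    obtain ⟨A', h1, h2⟩ := A.reduce
    obtain ⟨B', h3, h4⟩ := B.reduce
    cases Ty.toX_inj ((h2.trans h).trans h4.symm)
    exact .trans _ _ _ (eqvGen_of_rtc h1) (.symm _ _ (eqvGen_of_rtc h3))

theorem Ctx.eqv_iff {Γ Δ : Ctx} (m : ℕ) : Ctx.Eqv Γ Δ ↔ (Γ.toX m).nf = (Δ.toX m).nf := by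
  constructor
  · intro h
    induction h with
    | rel _ _ h => exact h.nf
    | refl => rfl
    | symm _ _ _ ih => exact ih.symm
    | trans _ _ _ _ _ ih1 ih2 => exact ih1.trans ih2
  · intro h
    obtain ⟨A', h1, -, h2⟩ := Γ.reduce
    obtain ⟨B', h3, -, h4⟩ := Δ.reduce
    cases Ctx.toX_inj (((h2 m).trans h).trans (h4 m).symm)
    exact .trans _ _ _ (eqvGen_of_rtc h1) (.symm _ _ (eqvGen_of_rtc h3))

theorem Ctx.Eqv.hat {Γ Δ : Ctx} (h : Ctx.Eqv Γ Δ) : Γ.hat = Δ.hat := by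
  induction h with
  | rel _ _ h => exact h.hat
  | refl => rfl
  | symm _ _ _ ih => exact ih.symm
  | trans _ _ _ _ _ ih1 ih2 => exact ih1.trans ih2

/-- Two declarations are equal if and only if their trees have the same normal form. -/
theorem declX_nf_iff {A B : Ty} {Γ Δ : Ctx} {k : ℕ} :
    (declX k A Γ).nf = (declX k B Δ).nf ↔ Ty.Eqv A B ∧ Ctx.Eqv Γ Δ := by
  rw [Ty.eqv_iff, Ctx.eqv_iff k]
  simp only [declX, X.nf, X.pair.injEq, X.clo.injEq, true_and]
  exact ⟨fun h => ⟨h.1.2, h.2⟩, fun h => ⟨⟨((Ctx.eqv_iff k).2 h.2).hat, h.1⟩, h.2⟩⟩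

/-! ### Lookup in contexts -/

/-- A sorted context all of whose declarations have well-formed erasures. -/
def Ctx.Good : Ctx → Prop
  | .nil => True
  | .snoc Ψ k A Γ => Ψ.Good ∧ (∀ l ∈ Ψ.hat, k ≤ l) ∧ A.er.Ok none ∧ Γ.er.Ok (some k)

/-- The simple types of the variables of a context. -/
def Ctx.sctx (Ψ : Ctx) : SCtx := fun k i => (Ψ.lookup k i).map fun D => (D.1.er, D.2.er)

/-- The declarations of the variables of a context, as trees. -/
def Ctx.look (Ψ : Ctx) : ℕ → ℕ → Option X := fun k i =>
  (Ψ.lookup k i).map fun D => declX k D.1 D.2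

/-- Extension of the declarations of variables by a most recent variable of level `k`. -/
def push (k : ℕ) (D : X) (f : ℕ → ℕ → Option X) : ℕ → ℕ → Option X :=
  cons k (some (D.weak k)) fun l i => (f l i).map (X.weak k)

theorem Ctx.lookup_mem {l : ℕ} : ∀ {Ψ : Ctx} {i : ℕ} {D : Ty × Ctx}, Ψ.lookup l i = some D →
    l ∈ Ψ.hat
  | .nil, _, _, h => by cases h
  | .snoc Ψ k A Γ, i, D, h => by
    rw [Ctx.lookup.eq_def] at h
    rw [Ctx.hat, List.mem_cons]
    dsimp only at h
    split_ifs at h with hk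
    · exact .inl hk.symm
    · exact .inr (Ctx.lookup_mem h)

theorem Ctx.lookup_of_not_mem {l i : ℕ} {Ψ : Ctx} (h : l ∉ Ψ.hat) : Ψ.lookup l i = none := by
  cases e : Ψ.lookup l i with
  | none => rfl
  | some D => exact absurd (Ctx.lookup_mem e) h

theorem Ctx.sctx_snoc (Ψ : Ctx) (k : ℕ) (A : Ty) (Γ : Ctx) :
    (Ctx.snoc Ψ k A Γ).sctx = cons k (some (A.er, Γ.er)) Ψ.sctx := by
  funext l i
  unfold Ctx.sctx
  by_cases hk : k = l
  · subst hk
    cases i with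
    | zero => simp [Ctx.lookup, Ty.er_wk, Ctx.er_wk]
    | succ j => simp [Ctx.lookup, cons, Ty.er_wk, Ctx.er_wk, Function.comp_def]
  · rw [cons_ne (fun h => hk h.symm)]; simp [Ctx.lookup, hk]

theorem Ctx.Good.lookup_ok : ∀ {Ψ : Ctx} (_ : Ψ.Good) {k i : ℕ} {D : Ty × Ctx},
    Ψ.lookup k i = some D → D.1.er.Ok none ∧ D.2.er.Ok (some k)
  | .nil, _, _, _, _, h => by cases h
  | .snoc Ψ k A Γ, g, l, i, D, h => by
    by_cases hk : k = l
    · subst hk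
      cases i with
      | zero => simp [Ctx.lookup] at h; subst h; simpa [Ty.er_wk, Ctx.er_wk] using g.2.2
      | succ j =>
        simp [Ctx.lookup] at h
        obtain ⟨A', Γ', h1, h2⟩ := h
        subst h2
        simpa [Ty.er_wk, Ctx.er_wk] using Ctx.Good.lookup_ok g.1 h1
    · simp [Ctx.lookup, hk] at h; exact Ctx.Good.lookup_ok g.1 h

theorem declX_weak_of_lt {A : Ty} {Γ : Ctx} {k l : ℕ} (h : k < l) :
    (declX l A Γ).weak k = declX l A Γ := by
  have := declX_rename_congr (ρ := shift k) (ρ' := fun _ i => i) (k := l)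
    (fun m i hm => shift_ne (by omega) i) A Γ
  rwa [X.rename_id] at this

/-- In a sorted context, the variables of levels other than that of the last declaration have
higher levels, so that their declarations are not affected by weakening. -/
theorem Ctx.Good.look_snoc {Ψ : Ctx} {k : ℕ} {A : Ty} {Γ : Ctx} (g : (Ctx.snoc Ψ k A Γ).Good) :
    (Ctx.snoc Ψ k A Γ).look = push k (declX k A Γ) Ψ.look := by
  funext l i
  unfold Ctx.look push
  by_cases hk : k = l
  · subst hk
    cases i with
    | zero => simp [Ctx.lookup, declX_weak g.2.2.1 g.2.2.2 le_rfl]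
    | succ j =>
      simp only [Ctx.lookup, cons, if_true, Option.map_map]
      cases e : Ψ.lookup k j with
      | none => rfl
      | some D =>
        have := g.1.lookup_ok e
        simp [declX_weak this.1 this.2 le_rfl]
  · rw [cons_ne (fun h => hk h.symm)]
    simp only [Ctx.lookup, if_neg hk, Option.map_map]
    cases e : Ψ.lookup l i with
    | none => rfl
    | some D =>
      have := g.2.1 l (Ctx.lookup_mem e)
      simp [declX_weak_of_lt (show k < l by omega)]

theorem Ctx.mem_hat_ins {l n : ℕ} {A : Ty} {Γ : Ctx} : ∀ {Ψ : Ctx},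
    l ∈ (Ψ.ins n A Γ).hat ↔ l = n ∨ l ∈ Ψ.hat
  | .nil => by simp [Ctx.ins, Ctx.hat]
  | .snoc Ψ k B Γ₁ => by
    rw [Ctx.ins]
    split
    · simp only [Ctx.hat, List.mem_cons, Ctx.mem_hat_ins (Ψ := Ψ)]; tauto
    · simp only [Ctx.hat, List.mem_cons]

theorem Ctx.Good.ins {n : ℕ} {A : Ty} {Γ : Ctx} (hA : A.er.Ok none) (hΓ : Γ.er.Ok (some n)) :
    ∀ {Ψ : Ctx}, Ψ.Good → (Ψ.ins n A Γ).Good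
  | .nil, _ => ⟨trivial, fun _ h => absurd h List.not_mem_nil, hA, hΓ⟩
  | .snoc Ψ k B Γ₁, g => by
    rw [Ctx.ins]
    split
    · next hk =>
      refine ⟨Ctx.Good.ins hA hΓ g.1, fun l hl => ?_, by rw [Ty.er_wk]; exact g.2.2.1,
        by rw [Ctx.er_wk]; exact g.2.2.2⟩
      rcases Ctx.mem_hat_ins.1 hl with rfl | hl
      · omega
      · exact g.2.1 l hl
    · refine ⟨g, fun l hl => ?_, hA, hΓ⟩
      rw [Ctx.hat, List.mem_cons] at hl
      rcases hl with rfl | hl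
      · omega
      · have := g.2.1 l hl; omega

theorem Ctx.sctx_ins (n : ℕ) (A : Ty) (Γ : Ctx) : ∀ Ψ : Ctx,
    (Ψ.ins n A Γ).sctx = cons n (some (A.er, Γ.er)) Ψ.sctx
  | .nil => by rw [Ctx.ins, Ctx.sctx_snoc]
  | .snoc Ψ k B Γ₁ => by
    rw [Ctx.ins]
    split
    · next hk =>
      rw [Ctx.sctx_snoc, Ctx.sctx_snoc, Ctx.sctx_ins n A Γ Ψ, Ty.er_wk, Ctx.er_wk,
        cons_comm (Nat.ne_of_lt hk)]
    · rw [Ctx.sctx_snoc]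

theorem X.weak_comm {k l : ℕ} (h : k ≠ l) (M : X) : (M.weak k).weak l = (M.weak l).weak k := by
  rw [X.weak, X.weak, X.weak, X.weak, X.rename_rename, X.rename_rename]
  congr 1
  funext m i
  simp only [shift]
  split_ifs <;> simp_all

theorem push_comm {k n : ℕ} (h : k < n) {D E : X} (hD : D.weak k = D) (f : ℕ → ℕ → Option X) :
    push k (E.weak n) (push n D f) = push n D (push k E f) := by
  unfold push
  have e : ∀ (m : ℕ) (a : Option X) (g : ℕ → ℕ → Option X) (r : ℕ),
      (fun l i => (cons m a g l i).map (X.weak r))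
        = cons m (a.map (X.weak r)) fun l i => (g l i).map (X.weak r) := by
    intro m a g r
    refine index_ext m ?_ ?_
    · simp
    · intro l i; simp
  rw [e, e, cons_comm (Nat.ne_of_lt h)]
  simp only [Option.map_some, Option.map_map, Function.comp_def]
  rw [X.weak_comm (Nat.ne_of_lt h) E, ← X.weak_comm (Nat.ne_of_lt h) D, hD]
  simp only [X.weak_comm (Nat.ne_of_lt h)]

/-- Insertion into a sorted context adds one most recent variable, wherever the declaration is
placed. -/
theorem Ctx.Good.look_ins {n : ℕ} {A : Ty} {Γ : Ctx} (hA : A.er.Ok none) (hΓ : Γ.er.Ok (some n)) :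
    ∀ {Ψ : Ctx}, Ψ.Good → (Ψ.ins n A Γ).look = push n (declX n A Γ) Ψ.look
  | .nil, g => Ctx.Good.look_snoc (g.ins hA hΓ)
  | .snoc Ψ k B Γ₁, g => by
    have g' := g.ins hA hΓ
    rw [Ctx.ins] at g' ⊢
    split
    · next hk =>
      rw [if_pos hk] at g'
      rw [g'.look_snoc, g.look_snoc, Ctx.Good.look_ins hA hΓ g.1,
        declX_weak g.2.2.1 g.2.2.2 (Nat.le_of_lt hk), push_comm hk (declX_weak_of_lt hk)]
    · next hk =>
      rw [if_neg hk] at g'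
      exact g'.look_snoc

theorem Ctx.Good.chop (n : ℕ) : ∀ {Ψ : Ctx}, Ψ.Good → (Ψ.chop n).Good
  | .nil, g => g
  | .snoc Ψ k A Γ, g => by
    rw [Ctx.chop]
    split
    · exact Ctx.Good.chop n g.1
    · exact g

theorem Ctx.Good.chop_ge {n : ℕ} : ∀ {Ψ : Ctx}, Ψ.Good → ∀ l ∈ (Ψ.chop n).hat, n ≤ l
  | .nil, _, _, h => by cases h
  | .snoc Ψ k A Γ, g, l, h => by
    rw [Ctx.chop] at h
    split at h
    · exact Ctx.Good.chop_ge g.1 l h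
    · rw [Ctx.hat, List.mem_cons] at h
      rcases h with rfl | h
      · omega
      · have := g.2.1 l h; omega

theorem Ctx.lookup_chop {n l : ℕ} (h : n ≤ l) (i : ℕ) : ∀ Ψ : Ctx,
    (Ψ.chop n).lookup l i = Ψ.lookup l i
  | .nil => rfl
  | .snoc Ψ k A Γ => by
    rw [Ctx.chop]
    split
    · next hk =>
      rw [Ctx.lookup_chop h i Ψ]
      simp [Ctx.lookup, show k ≠ l by omega]
    · rfl

theorem Ctx.Good.lookup_chop_lt {n l : ℕ} {Ψ : Ctx} (g : Ψ.Good) (h : l < n) (i : ℕ) :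
    (Ψ.chop n).lookup l i = none :=
  Ctx.lookup_of_not_mem fun hl => absurd (g.chop_ge l hl) (by omega)

theorem Ctx.Good.sctx_chop {Ψ : Ctx} (g : Ψ.Good) (n : ℕ) :
    (Ψ.chop n).sctx = belowOr n (fun _ _ => none) Ψ.sctx := by
  funext l i
  rcases Nat.lt_or_ge l n with h | h
  · rw [belowOr_lt h, Ctx.sctx, g.lookup_chop_lt h]; rfl
  · rw [belowOr_ge h, Ctx.sctx, Ctx.lookup_chop h]; rfl

theorem Ctx.mem_hat_merge {l : ℕ} {Ψ : Ctx} : ∀ {Φ : Ctx},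
    l ∈ (Ψ.merge Φ).hat ↔ l ∈ Φ.hat ∨ l ∈ Ψ.hat
  | .nil => by simp [Ctx.merge, Ctx.hat]
  | .snoc Φ k A Γ => by
    rw [Ctx.merge, Ctx.mem_hat_ins, Ctx.mem_hat_merge (Φ := Φ), Ctx.hat, List.mem_cons]; tauto

theorem belowOr_cons {α : Type*} {k n : ℕ} (h : k < n) (a : α) (f g : ℕ → ℕ → α) :
    belowOr n (cons k a f) g = cons k a (belowOr n f g) := by
  funext l i
  rcases Nat.lt_or_ge l n with hl | hl
  · rw [belowOr_lt hl]
    rcases index_cases k l i with ⟨rfl, rfl⟩ | ⟨j, rfl⟩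
    · simp
    · rw [cons_shift, cons_shift, belowOr_lt hl]
  · rw [belowOr_ge hl, cons_ne (by omega), belowOr_ge hl]

theorem Ctx.Good.sctx_merge {Ψ : Ctx} (g : Ψ.Good) {n : ℕ} : ∀ {Φ : Ctx}, Φ.er.Ok (some n) →
    ((Ψ.chop n).merge Φ).sctx = belowOr n Φ.er.get Ψ.sctx
  | .nil, _ => g.sctx_chop n
  | .snoc Φ k A Γ, o => by
    rw [Ctx.merge, Ctx.sctx_ins, Ctx.Good.sctx_merge g (Φ := Φ) o.1, Ctx.er, T.get,
      belowOr_cons o.2.1]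

/-! ### Identities between contexts -/

theorem Ctx.chop_of_ge {n : ℕ} : ∀ {Ψ : Ctx}, (∀ l ∈ Ψ.hat, n ≤ l) → Ψ.chop n = Ψ
  | .nil, _ => rfl
  | .snoc Ψ k A Γ, h => by
    rw [Ctx.chop, if_neg (Nat.not_lt.2 (h k (by simp [Ctx.hat])))]

theorem Ctx.chop_chop {n l : ℕ} (h : n ≤ l) : ∀ Ψ : Ctx, (Ψ.chop n).chop l = Ψ.chop l
  | .nil => rfl
  | .snoc Ψ k A Γ => by
    rw [Ctx.chop]
    split
    · rw [Ctx.chop_chop h Ψ, Ctx.chop, if_pos (by omega)]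
    · rfl

theorem Ctx.chop_ins {n l : ℕ} (h : n < l) (A : Ty) (Γ : Ctx) : ∀ Ψ : Ctx,
    (Ψ.ins n A Γ).chop l = Ψ.chop l
  | .nil => by simp [Ctx.ins, Ctx.chop, h]
  | .snoc Ψ k B Γ₁ => by
    rw [Ctx.ins]
    split
    · rw [Ctx.chop, if_pos (by omega), Ctx.chop_ins h A Γ Ψ, Ctx.chop, if_pos (by omega)]
    · rw [Ctx.chop, if_pos h]

theorem Ctx.chop_merge {n l : ℕ} (h : n ≤ l) (Ψ : Ctx) : ∀ {Φ : Ctx}, (∀ m ∈ Φ.hat, m < n) →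
    ((Ψ.chop n).merge Φ).chop l = Ψ.chop l
  | .nil, _ => Ctx.chop_chop h Ψ
  | .snoc Φ k A Γ, hΦ => by
    have hk := hΦ k (by simp [Ctx.hat])
    rw [Ctx.merge, Ctx.chop_ins (by omega),
      Ctx.chop_merge h Ψ fun m hm => hΦ m (List.mem_cons_of_mem _ hm)]

theorem Ctx.ins_of_ge {n : ℕ} (A : Ty) (Γ : Ctx) {Ψ : Ctx} (h : ∀ l ∈ Ψ.hat, n ≤ l) :
    Ψ.ins n A Γ = .snoc Ψ n A Γ := by
  cases Ψ with
  | nil => rfl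
  | snoc Ψ k B Γ₁ => rw [Ctx.ins, if_neg (Nat.not_lt.2 (h k (by simp [Ctx.hat])))]

/-! ### Declarations and the variables they depend on -/

theorem Has.ctx_congr {G G' : SCtx} {Γ : X} {j : J} (h : Has s G Γ j) : ∀ {m : ℕ} {φ : T},
    j = .ctx m φ → (∀ l i, m ≤ l → G l i = G' l i) → Has s G' Γ j := by
  induction h with
  | cnil => intro m φ _ _; exact .cnil
  | csnoc _ hk h ih _ =>
    intro m φ ej he
    cases ej
    exact .csnoc (ih rfl he) hk (by rwa [← belowOr_congr he])
  | _ => intro m φ ej; cases ej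

theorem Has.decl_congr {G G' : SCtx} {D : X} {k : ℕ} {α φ : T} (h : Has s G D (.decl k α φ))
    (he : ∀ l i, k ≤ l → G l i = G' l i) : Has s G' D (.decl k α φ) := by
  cases h with
  | decl h1 h2 => exact .decl (by rwa [← belowOr_congr he]) (h2.ctx_congr rfl he)

theorem Sub.ctx_congr {e e' : Env} {m : ℕ} (he : ∀ l i, m ≤ l → e l i = e' l i) : ∀ {Γ : Ctx} {Y : X},
    Sub e (Γ.toX m) Y → Sub e' (Γ.toX m) Y
  | .nil, _, h => by cases h; exact .leaf _
  | .snoc Ψ k A Γ, _, h => by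
    cases h with
    | pair h1 h2 =>
      cases h2 with
      | clo h2 =>
        refine .pair (Sub.ctx_congr he h1) (.clo ?_)
        rwa [enterE, ← belowOr_congr he]

theorem Sub.declX_congr {e e' : Env} {k : ℕ} (he : ∀ l i, k ≤ l → e l i = e' l i) {A : Ty} {Γ : Ctx}
    {Y : X} (h : Sub e (declX k A Γ) Y) : Sub e' (declX k A Γ) Y := by
  cases h with
  | pair h1 h2 =>
    cases h1 with
    | clo h1 => exact .pair (.clo (by rwa [enterE, ← belowOr_congr he])) (h2.ctx_congr he)

/-- The environment matters only on the variables which have a simple type. -/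
theorem Sub.congr_dom {b : ℕ} {G G' : SCtx} {M Y : X} {j : J} {e e' : Env} (hM : Has s G M j)
    (hE : HasEnv s G' e G) (hB : Bd b G e) (he : ∀ l i d, G l i = some d → e l i = e' l i)
    (h : Sub e M Y) : Sub e' M Y := by
  -- On the domain of `G`, the environment `e'` is the composition of the identity with `e`.
  refine Sub.comp (s := s) (0 + b) le_rfl hM (G1 := G) (τ := idE) ?_ hE ?_ hB ?_
    (hM.sub_id fun _ _ _ _ => rfl) h
  · intro k i α φ h1 h2 h3; exact .ren h1 h2 h3
  · intro k i α φ _; exact .inl ⟨i, rfl⟩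
  · intro k i α φ h1 h2 h3
    exact .ren (he k i _ h1) (by rw [← he k i _ h1]; exact (hE k i α φ h1 h2 h3).lv)

/-- A context in which all declarations are simply typed. -/
structure Ctx.SWf (s : SSig) (Ψ : Ctx) : Prop where
  good : Ψ.Good
  has : ∀ {k i : ℕ} {A : Ty} {Γ : Ctx}, Ψ.lookup k i = some (A, Γ) →
    Has s Ψ.sctx (declX k A Γ) (.decl k A.er Γ.er)

theorem Ctx.sctx_of_lookup {Ψ : Ctx} {k i : ℕ} {A : Ty} {Γ : Ctx} (h : Ψ.lookup k i = some (A, Γ)) :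
    Ψ.sctx k i = some (A.er, Γ.er) := by
  rw [Ctx.sctx, h]; rfl

theorem Ctx.look_of_lookup {Ψ : Ctx} {k i : ℕ} {A : Ty} {Γ : Ctx} (h : Ψ.lookup k i = some (A, Γ)) :
    Ψ.look k i = some (declX k A Γ) := by
  rw [Ctx.look, h]; rfl

theorem Ctx.lookup_of_look {Ψ : Ctx} {k i : ℕ} {D : X} (h : Ψ.look k i = some D) :
    ∃ A Γ, Ψ.lookup k i = some (A, Γ) ∧ D = declX k A Γ := by
  unfold Ctx.look at h
  cases e : Ψ.lookup k i with
  | none => rw [e] at h; cases h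
  | some p => rw [e] at h; cases h; exact ⟨p.1, p.2, rfl, rfl⟩

theorem Ctx.lookup_of_sctx {Ψ : Ctx} {k i : ℕ} {d : T × T} (h : Ψ.sctx k i = some d) :
    ∃ A Γ, Ψ.lookup k i = some (A, Γ) ∧ d = (A.er, Γ.er) := by
  unfold Ctx.sctx at h
  cases e : Ψ.lookup k i with
  | none => rw [e] at h; cases h
  | some p => rw [e] at h; cases h; exact ⟨p.1, p.2, rfl, rfl⟩

theorem Ctx.SWf.nil : Ctx.SWf s .nil := ⟨trivial, fun h => by cases h⟩

theorem Ctx.SWf.ins {Ψ : Ctx} (h : Ψ.SWf s) {n : ℕ} {A : Ty} {Γ : Ctx}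
    (hD : Has s Ψ.sctx (declX n A Γ) (.decl n A.er Γ.er)) : (Ψ.ins n A Γ).SWf s := by
  refine ⟨h.good.ins hD.ok.1 hD.ok.2, fun {k i B Δ} hl => ?_⟩
  have h1 := Ctx.look_of_lookup hl
  have h2 := Ctx.sctx_of_lookup hl
  rw [h.good.look_ins hD.ok.1 hD.ok.2, push] at h1
  rw [Ctx.sctx_ins] at h2 ⊢
  rcases index_cases n k i with ⟨rfl, rfl⟩ | ⟨j, rfl⟩
  · rw [cons_zero, Option.some.injEq] at h1 h2
    rw [Prod.mk.injEq] at h2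
    rw [← h1, ← h2.1, ← h2.2]
    exact hD.weak _ _
  · rw [cons_shift] at h1 h2
    obtain ⟨B', Δ', h3, h4⟩ := Ctx.lookup_of_sctx h2
    rw [Ctx.look_of_lookup h3, Option.map_some, Option.some.injEq] at h1
    rw [Prod.mk.injEq] at h4
    rw [← h1, h4.1, h4.2]
    exact (h.has h3).weak _ _

theorem Ctx.SWf.chop {Ψ : Ctx} (h : Ψ.SWf s) (n : ℕ) : (Ψ.chop n).SWf s := by
  refine ⟨h.good.chop n, fun {k i A Γ} hl => ?_⟩
  have hk := h.good.chop_ge k (Ctx.lookup_mem hl)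
  rw [Ctx.lookup_chop hk] at hl
  refine (h.has hl).decl_congr fun l j hj => ?_
  rw [h.good.sctx_chop, belowOr_ge (hk.trans hj)]

theorem Has.ctx_snoc_inv {G : SCtx} {Φ Γ : Ctx} {A : Ty} {n k : ℕ} {χ : T}
    (h : Has s G ((Ctx.snoc Φ k A Γ).toX n) (.ctx n χ)) :
    Has s G (Φ.toX n) (.ctx n Φ.er) ∧ k < n ∧
      Has s (belowOr n Φ.er.get G) (MLCTT.declX k A Γ) (.decl k A.er Γ.er) := by
  have e := h.ctx_er
  subst e
  generalize eM : (Ctx.snoc Φ k A Γ).toX n = M at h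
  generalize eχ : (Ctx.snoc Φ k A Γ).er = χ at h
  cases h with
  | cnil => cases eM
  | csnoc h1 h2 h3 =>
    rw [Ctx.er, T.snoc.injEq] at eχ
    obtain ⟨rfl, rfl, rfl, rfl⟩ := eχ
    rw [Ctx.toX, X.pair.injEq, X.clo.injEq] at eM
    obtain ⟨rfl, -, -, -, rfl⟩ := eM
    exact ⟨h1, h2, h3⟩

theorem Ctx.SWf.merge {Ψ : Ctx} (h : Ψ.SWf s) {n : ℕ} : ∀ {Φ : Ctx},
    Has s Ψ.sctx (Φ.toX n) (.ctx n Φ.er) → ((Ψ.chop n).merge Φ).SWf s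
  | .nil, _ => h.chop n
  | .snoc Φ k A Γ, hΦ => by
    obtain ⟨h1, h2, h3⟩ := hΦ.ctx_snoc_inv
    refine (Ctx.SWf.merge h (Φ := Φ) h1).ins ?_
    rwa [h.good.sctx_merge h1.ok]

/-! ### Values of hereditary substitution -/

theorem Has.exists_ty {G : SCtx} {A : Ty} {α : T} (h : Has s G A.toX (.ty α)) {b : ℕ} {G' : SCtx}
    {e : Env} (hE : HasEnv s G' e G) (hB : Bd b G e) :
    ∃ A' : Ty, Sub e A.toX A'.toX ∧ Has s G' A'.toX (.ty α) ∧ A'.er = α := by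
  obtain ⟨Y, h1, h2⟩ := Sub.total b h hE hB
  obtain ⟨A', rfl, h3⟩ := Has.img h2
  exact ⟨A', h1, h2, h3⟩

theorem Has.exists_decl {G : SCtx} {D : X} {k : ℕ} {α φ : T} (h : Has s G D (.decl k α φ)) {b : ℕ}
    {G' : SCtx} {e : Env} (hE : HasEnv s G' e G) (hB : Bd b G e) :
    ∃ (A' : Ty) (Γ' : Ctx), Sub e D (MLCTT.declX k A' Γ') ∧
      Has s G' (MLCTT.declX k A' Γ') (.decl k α φ) ∧ A'.er = α ∧ Γ'.er = φ := by
  obtain ⟨Y, h1, h2⟩ := Sub.total b h hE hB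
  obtain ⟨A', Γ', rfl, h3, h4⟩ := Has.img h2
  exact ⟨A', Γ', h1, h2, h3, h4⟩

theorem Has.exists_ctx {G : SCtx} {Γ : Ctx} {m : ℕ} {φ : T} (h : Has s G (Γ.toX m) (.ctx m φ))
    {b : ℕ} {G' : SCtx} {e : Env} (hE : HasEnv s G' e G) (hB : Bd b G e) :
    ∃ Γ' : Ctx, Sub e (Γ.toX m) (Γ'.toX m) ∧ Has s G' (Γ'.toX m) (.ctx m φ) ∧ Γ'.er = φ := by
  obtain ⟨Y, h1, h2⟩ := Sub.total b h hE hB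
  obtain ⟨Γ', rfl, h3⟩ := Has.img h2
  exact ⟨Γ', h1, h2, h3⟩

/-- On simply typed types, substitution on expressions and substitution on trees have the same
values. -/
theorem Has.hty_iff {G : SCtx} {A A₁ : Ty} {α : T} (h : Has s G A.toX (.ty α)) {b : ℕ} {G' : SCtx}
    {e : Env} {θ : Sb} (hE : HasEnv s G' e G) (hB : Bd b G e) (hA : Agree G θ e) :
    HTy θ A A₁ ↔ Sub e A.toX A₁.toX := by
  obtain ⟨Y, h1, -⟩ := Sub.total b h hE hB
  obtain ⟨B, B', e1, rfl, h2⟩ := Sub.graph b h hE hB hA h1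
  cases Ty.toX_inj e1
  exact ⟨fun h3 => by rw [h3.det h2]; exact h1, fun h3 => by rw [Ty.toX_inj (h3.det h1)]; exact h2⟩

/-- The analogue of `Has.hty_iff` for contexts. -/
theorem Has.hctx_iff {G : SCtx} {Γ Γ₁ : Ctx} {m : ℕ} {φ : T} (h : Has s G (Γ.toX m) (.ctx m φ))
    {b : ℕ} {G' : SCtx} {e : Env} {θ : Sb} (hE : HasEnv s G' e G) (hB : Bd b G e)
    (hA : Agree G θ e) : HCtx θ m Γ Γ₁ ↔ Sub e (Γ.toX m) (Γ₁.toX m) := by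
  obtain ⟨Y, h1, -⟩ := Sub.total b h hE hB
  obtain ⟨B, B', e1, rfl, -, -, h2⟩ := Sub.graph b h hE hB hA h1
  cases Ctx.toX_inj e1
  exact ⟨fun h3 => by rw [h3.det h2]; exact h1, fun h3 => by rw [Ctx.toX_inj (h3.det h1)]; exact h2⟩

/-- The types of applications, by substitution on expressions and on trees. -/
theorem Has.hty_single_iff {G : SCtx} {A B B₁ : Ty} {Φ : Ctx} {N : Tm} {n : ℕ} {β : T}
    (hB : Has s (cons n (some (A.er, Φ.er)) G) B.toX (.ty β))
    (hN : Has s G (.clo false n Φ.hat N.toX) (.ent false n A.er Φ.er)) :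
    HTy (.single n 0 Φ.hat N A.erase Φ.erase) B B₁ ↔
      Sub (MLCTT.single n Φ.hat N.toX) B.toX B₁.toX := by
  rw [← Ty.er_toApx, ← Ctx.er_toCApx]
  exact hB.hty_iff (HasEnv.single hN) Bd.single (Agree.single _ _ _ _ _ _)

/-- The types of variables, by substitution on expressions and on trees. -/
theorem Has.hty_inst_iff {G : SCtx} {A A₁ : Ty} {Φ : Ctx} {σ : Sbn} {n : ℕ} {α : T}
    (hA : Has s (belowOr n Φ.er.get G) A.toX (.ty α)) (hΦ : Φ.er.Ok (some n))
    (hσ : Has s G σ.toX (.sbn Φ.er)) :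
    HTy (.simul n σ Φ.erase) A A₁ ↔ Sub (MLCTT.inst n Φ.hat σ.toX) A.toX A₁.toX := by
  rw [← Ctx.er_toCApx, ← Ctx.hat_er]
  exact hA.hty_iff (HasEnv.inst hΦ hσ) (Bd.inst hΦ) (Agree.inst hΦ hσ)

theorem CApx.hat_erase (Γ : Ctx) : Γ.erase.hat = Γ.hat := by
  rw [← Ctx.er_toCApx, T.hat_toCApx, Ctx.hat_er]

/-- The declarations against which the entries of a substitution are checked, by substitution on
expressions and on trees. -/
theorem Has.hdecl_inst_iff {G : SCtx} {A A₁ : Ty} {Φ Γ Γ₁ : Ctx} {σ : Sbn} {n k : ℕ}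
    (hD : Has s (belowOr n Φ.er.get G) (MLCTT.declX k A Γ) (.decl k A.er Γ.er)) (hk : k < n)
    (hΦ : Φ.er.Ok (some n)) (hσ : Has s G σ.toX (.sbn Φ.er)) :
    HCtx (.simul n σ Φ.erase) k Γ Γ₁ ∧
      HTy (.simul n ((σ.chop k Φ.erase).merge (Φ.erase.chop k) (idSbn Γ.hat) Γ.erase)
        ((Φ.erase.chop k).merge Γ.erase)) A A₁ ↔
      Sub (MLCTT.inst n Φ.hat σ.toX) (MLCTT.declX k A Γ) (MLCTT.declX k A₁ Γ₁) := by
  obtain ⟨-, -, h1, h2⟩ := hD.decl_inv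
  have hE := HasEnv.inst hΦ hσ
  have hB : Bd _ (belowOr n Φ.er.get G) (MLCTT.inst n Φ.er.hat σ.toX) := Bd.inst hΦ
  have hA := Agree.inst hΦ hσ
  have hA' := hA.enter_simul (k := k) (by omega) hD.ok.2 (ω := Γ.erase)
    (by rw [CApx.hat_erase, Ctx.hat_er])
  rw [CApx.hat_erase, Ctx.er_toCApx] at hA'
  rw [Ctx.er_toCApx] at hA
  have i1 := h2.hctx_iff (Γ₁ := Γ₁) hE hB hA
  have i2 := h1.hty_iff (A₁ := A₁) (hE.enter k _) (hB.enter k _) hA'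
  rw [i1, i2, ← Ctx.hat_er Φ]
  constructor
  · rintro ⟨h3, h4⟩
    have : Γ₁.hat = Γ.hat := by
      obtain ⟨Γ₂, h5, -, h6⟩ := h2.exists_ctx hE hB
      rw [Ctx.toX_inj (h3.det h5), ← Ctx.hat_er, h6, Ctx.hat_er]
    rw [MLCTT.declX, MLCTT.declX, this]
    exact .pair (.clo h4) h3
  · intro h
    generalize e : MLCTT.declX k A₁ Γ₁ = D at h
    cases h with
    | pair h3 h4 =>
      cases h3 with
      | clo h3 =>
        rw [MLCTT.declX, X.pair.injEq, X.clo.injEq] at e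
        obtain ⟨⟨-, -, -, rfl⟩, rfl⟩ := e
        exact ⟨h4, h3⟩

/-- Equal types have the same erasure. -/
theorem Has.ty_unique {G G' : SCtx} {M M' : X} {α α' : T} (h : Has s G M (.ty α))
    (h' : Has s G' M' (.ty α')) (e : M.nf = M'.nf) : α = α' := by
  obtain ⟨A, h1, rfl⟩ := h.nf.img
  obtain ⟨A', h2, rfl⟩ := h'.nf.img
  rw [Ty.toX_inj (h1.symm.trans (e.trans h2))]

theorem Has.decl_unique {G G' : SCtx} {M M' : X} {k : ℕ} {α α' φ φ' : T}
    (h : Has s G M (.decl k α φ)) (h' : Has s G' M' (.decl k α' φ')) (e : M.nf = M'.nf) :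
    α = α' ∧ φ = φ' := by
  obtain ⟨A, Γ, h1, rfl, rfl⟩ := h.nf.img
  obtain ⟨A', Γ', h2, rfl, rfl⟩ := h'.nf.img
  obtain ⟨rfl, rfl⟩ := declX_inj (h1.symm.trans (e.trans h2))
  exact ⟨rfl, rfl⟩

theorem Has.closed_sub {M : X} {j : J} (h : Has s (fun _ _ => none) M j) (θ : Env) : Sub θ M M :=
  h.sub_id fun _ _ _ h => by cases h

theorem Has.ty_of_closed {M : X} {α : T} (h : Has s (fun _ _ => none) M (.ty α)) (G : SCtx) :
    Has s G M (.ty α) := by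
  obtain ⟨Y, h1, h2⟩ := Sub.total 0 h (G' := G) (θ := idE) (fun _ _ _ _ h => by cases h)
    fun _ _ _ _ h => by cases h
  rw [(h.closed_sub idE).det h1]
  exact h2

/-! ### Dependent typing refines simple typing -/

/-- The erasure of a signature. -/
def Sig.er (S : Sig) : SSig := ⟨fun a => (S.lookupTy a).map Ty.er, fun c => (S.lookupTm c).map Ty.er⟩

/-- The kinds and types which are declared in a signature are simply typed. -/
structure Sig.Typed (S : Sig) : Prop where
  ty : ∀ {a : ℕ} {K : Ty}, S.lookupTy a = some K → Has S.er (fun _ _ => none) K.toX (.ty K.er)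
  tm : ∀ {c : ℕ} {A : Ty}, S.lookupTm c = some A → Has S.er (fun _ _ => none) A.toX (.ty A.er)

theorem Has.pi_inv {G : SCtx} {k : ℕ} {A B : Ty} {Γ : Ctx} {α : T}
    (h : Has s G (Ty.pi k A Γ B).toX (.ty α)) : α = .arrow k A.er Γ.er B.er ∧
      Has s G (MLCTT.declX k A Γ) (.decl k A.er Γ.er) ∧
      Has s (cons k (some (A.er, Γ.er)) G) B.toX (.ty B.er) := by
  have e := h.ty_er
  subst e
  refine ⟨rfl, ?_⟩
  generalize eM : (Ty.pi k A Γ B).toX = M at h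
  generalize eα : (Ty.pi k A Γ B).er = α at h
  cases h with
  | pi h1 h2 =>
    rw [Ty.er, T.arrow.injEq] at eα
    obtain ⟨rfl, rfl, rfl, rfl⟩ := eα
    rw [Ty.toX, X.pair.injEq, X.lam.injEq] at eM
    obtain ⟨rfl, -, rfl⟩ := eM
    exact ⟨h1, h2⟩
  | sort => cases eM
  | atom h =>
    exfalso
    obtain ⟨P, e, -⟩ := h.img
    exact P.toX_ne_pi _ _ _ (e.symm.trans eM.symm)

theorem Has.clo_intro {G : SCtx} {e : Bool} {k : ℕ} {M : X} {α : T} {Φ : Ctx}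
    (o : Φ.er.Ok (some k)) (h : Has s (belowOr k Φ.er.get G) M (.chk α)) :
    Has s G (.clo e k Φ.hat M) (.ent e k α Φ.er) := by
  rw [← Ctx.hat_er]; exact .clo o h

mutual
/-- Typed expressions are simply typed over the erased context, and so are the kinds and types which
they synthesize.  A type or context against which an expression is checked has to be simply typed
beforehand. -/
theorem ATySyn.has {S : Sig} (hS : S.Typed) : ∀ {Ψ : Ctx} {P : ATy} {K : Ty}, ATySyn S Ψ P K →
    Ψ.SWf S.er → Has S.er Ψ.sctx P.toX (.asyn K.er P.hd) ∧ Has S.er Ψ.sctx K.toX (.ty K.er)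
  | Ψ, _, _, .con h, _ =>
    ⟨.acon (by simp only [Sig.er, h, Option.map_some]) (hS.ty h).ok, (hS.ty h).ty_of_closed _⟩
  | Ψ, _, _, @ATySyn.app _ _ P n A Φ K K₁ N hP hN hK, hΨ => by
    obtain ⟨h1, h2⟩ := ATySyn.has hS hP hΨ
    obtain ⟨-, h3, h4⟩ := h2.pi_inv
    obtain ⟨-, -, h5, h6⟩ := h3.decl_inv
    have h7 := TmChk.has hS hN (hΨ.merge h6) (by rwa [hΨ.good.sctx_merge h3.ok.2])
    rw [hΨ.good.sctx_merge h3.ok.2] at h7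
    have h8 := Has.clo_intro (e := false) h3.ok.2 h7
    rw [h4.hty_single_iff h8] at hK
    obtain ⟨K', h9, h10, h11⟩ := h4.exists_ty (HasEnv.single h8) Bd.single
    cases Ty.toX_inj (h9.det hK)
    rw [h11]
    exact ⟨.aapp h1 h8, h10⟩
termination_by structural _ _ _ h => h
theorem TyChk.has {S : Sig} (hS : S.Typed) : ∀ {Ψ : Ctx} {A : Ty} {t : Srt}, TyChk S Ψ A t →
    Ψ.SWf S.er → Has S.er Ψ.sctx A.toX (.ty A.er)
  | _, _, _, .star, _ => .sort _
  | _, _, _, .atom h, hΨ => .atom (ATySyn.has hS h hΨ).1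
  | _, _, _, .pi h1 h2 h3, hΨ => by
    have h4 := CtxWf.has hS h2 hΨ
    have h5 := TyChk.has hS h1 (hΨ.merge h4)
    rw [hΨ.good.sctx_merge h4.ok] at h5
    have h6 := Has.declX h5 h4
    have h7 := TyChk.has hS h3 (hΨ.ins h6)
    rw [Ctx.sctx_ins] at h7
    exact .pi h6 h7
termination_by structural _ _ _ h => h
theorem NeSyn.has {S : Sig} (hS : S.Typed) : ∀ {Ψ : Ctx} {R : Ne} {A : Ty}, NeSyn S Ψ R A →
    Ψ.SWf S.er → Has S.er Ψ.sctx R.toX (.syn A.er) ∧ Has S.er Ψ.sctx A.toX (.ty A.er)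
  | _, _, _, .var hl hσ hA, hΨ => by
    obtain ⟨-, -, h1, h2⟩ := (hΨ.has hl).decl_inv
    have h3 := SbnChk.has hS hσ hΨ h2
    rw [h1.hty_inst_iff h2.ok h3] at hA
    obtain ⟨A', h4, h5, h6⟩ := h1.exists_ty (HasEnv.inst h2.ok h3) (Bd.inst h2.ok)
    rw [Ctx.hat_er] at h4
    cases Ty.toX_inj (h4.det hA)
    rw [h6]
    exact ⟨.var (Ctx.sctx_of_lookup hl) h1.ok h2.ok h3, h5⟩
  | _, _, _, .con h, _ =>
    ⟨.con (by simp only [Sig.er, h, Option.map_some]) (hS.tm h).ok, (hS.tm h).ty_of_closed _⟩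
  | Ψ, _, _, @NeSyn.app _ _ R n A Φ B B₁ N hR hN hB, hΨ => by
    obtain ⟨h1, h2⟩ := NeSyn.has hS hR hΨ
    obtain ⟨-, h3, h4⟩ := h2.pi_inv
    obtain ⟨-, -, h5, h6⟩ := h3.decl_inv
    have h7 := TmChk.has hS hN (hΨ.merge h6) (by rwa [hΨ.good.sctx_merge h3.ok.2])
    rw [hΨ.good.sctx_merge h3.ok.2] at h7
    have h8 := Has.clo_intro (e := false) h3.ok.2 h7
    rw [h4.hty_single_iff h8] at hB
    obtain ⟨K', h9, h10, h11⟩ := h4.exists_ty (HasEnv.single h8) Bd.single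
    cases Ty.toX_inj (h9.det hB)
    rw [h11]
    exact ⟨.app h1 h8, h10⟩
termination_by structural _ _ _ h => h
theorem TmChk.has {S : Sig} (hS : S.Typed) : ∀ {Ψ : Ctx} {M : Tm} {A : Ty}, TmChk S Ψ M A →
    Ψ.SWf S.er → Has S.er Ψ.sctx A.toX (.ty A.er) → Has S.er Ψ.sctx M.toX (.chk A.er)
  | _, _, _, .ne hR e, hΨ, hA => by
    obtain ⟨h1, h2⟩ := NeSyn.has hS hR hΨ
    rw [h2.ty_unique hA (Ty.eqv_iff.1 e)] at h1
    exact .ne h1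
  | _, _, _, .lam hM, hΨ, hA => by
    obtain ⟨-, h3, h4⟩ := hA.pi_inv
    have h5 := TmChk.has hS hM (hΨ.ins h3) (by rwa [Ctx.sctx_ins])
    rw [Ctx.sctx_ins] at h5
    exact .lam h3.ok.1 h3.ok.2 h5
termination_by structural _ _ _ h => h
theorem SbnChk.has {S : Sig} (hS : S.Typed) : ∀ {Ψ : Ctx} {σ : Sbn} {n : ℕ} {Φ : Ctx},
    SbnChk S Ψ σ n Φ → Ψ.SWf S.er → Has S.er Ψ.sctx (Φ.toX n) (.ctx n Φ.er) →
    Has S.er Ψ.sctx σ.toX (.sbn Φ.er)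
  | _, _, _, _, .nil, _, _ => .nil
  | Ψ, _, _, _, @SbnChk.clo _ _ σ n k Φ Γ Γ₁ A A₁ M hσ hΓ hA hM, hΨ, hΦ => by
    have ih := TmChk.has hS hM
    obtain ⟨h1, h2, h3⟩ := hΦ.ctx_snoc_inv
    have h4 := SbnChk.has hS hσ hΨ h1
    have h5 := (h3.hdecl_inst_iff h2 h1.ok h4).1 ⟨hΓ, hA⟩
    obtain ⟨A', Γ', h6, h7, h8, h9⟩ := h3.exists_decl (HasEnv.inst h1.ok h4) (Bd.inst h1.ok)
    rw [Ctx.hat_er] at h6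
    obtain ⟨rfl, rfl⟩ := declX_inj (h6.det h5)
    rw [← h8, ← h9] at h7
    obtain ⟨-, -, h10, h11⟩ := h7.decl_inv
    have h12 := ih (hΨ.merge h11) (by rwa [hΨ.good.sctx_merge h7.ok.2])
    rw [hΨ.good.sctx_merge h7.ok.2] at h12
    have h13 := Has.clo_intro (e := true) h7.ok.2 h12
    rw [h8, h9, ← Ctx.hat_er, h9, Ctx.hat_er] at h13
    exact .snoc h4 h13
  | Ψ, _, _, _, @SbnChk.ren _ _ σ n k i Φ Γ Γ₁ Γ₀ A A₁ A₀ hσ hΓ hA hl e1 e2, hΨ, hΦ => by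
    obtain ⟨h1, h2, h3⟩ := hΦ.ctx_snoc_inv
    have h4 := SbnChk.has hS hσ hΨ h1
    have h5 := (h3.hdecl_inst_iff h2 h1.ok h4).1 ⟨hΓ, hA⟩
    obtain ⟨A', Γ', h6, h7, h8, h9⟩ := h3.exists_decl (HasEnv.inst h1.ok h4) (Bd.inst h1.ok)
    rw [Ctx.hat_er] at h6
    obtain ⟨rfl, rfl⟩ := declX_inj (h6.det h5)
    obtain ⟨h10, h11⟩ := (hΨ.has hl).decl_unique h7 (declX_nf_iff.2 ⟨e1, e2⟩)
    exact .snoc h4 (.ren (by rw [Ctx.sctx_of_lookup hl, h10, h11]) h3.ok.1 h3.ok.2)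
termination_by structural _ _ _ _ h => h
theorem CtxWf.has {S : Sig} (hS : S.Typed) : ∀ {Ψ : Ctx} {n : ℕ} {Φ : Ctx}, CtxWf S Ψ n Φ →
    Ψ.SWf S.er → Has S.er Ψ.sctx (Φ.toX n) (.ctx n Φ.er)
  | _, _, _, .nil, _ => .cnil
  | Ψ, _, _, @CtxWf.snoc _ _ n k Φ Γ A hΦ hk hl hA hΓ, hΨ => by
    have h1 := CtxWf.has hS hΦ hΨ
    have ih1 := TyChk.has hS hA
    have ih2 := CtxWf.has hS hΓ
    rw [Ctx.chop_of_ge hl] at ih1 ih2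
    have h2 := hΨ.merge h1
    have h3 := ih2 h2
    have e : ((Ψ.chop n).merge Φ).chop k = (Ψ.chop n).merge Φ := Ctx.chop_of_ge fun m hm => by
      rcases Ctx.mem_hat_merge.1 hm with hm | hm
      · exact hl m hm
      · have := hΨ.good.chop_ge m hm; omega
    have h4 := h2.merge h3
    rw [e] at h4
    have h5 := ih1 h4
    have e2 := h2.good.sctx_merge h3.ok
    rw [e] at e2
    rw [e2] at h5
    have h6 := Has.declX h5 h3
    rw [hΨ.good.sctx_merge h1.ok] at h6
    have h7 := Has.csnoc h1 hk h6
    rw [Ctx.hat_er] at h7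
    exact h7
termination_by structural _ _ _ h => h
end

theorem Has.sig_mono {s s' : SSig} {G : SCtx} {M : X} {j : J}
    (h1 : ∀ a κ, s.ty a = some κ → s'.ty a = some κ) (h2 : ∀ c α, s.tm c = some α → s'.tm c = some α)
    (h : Has s G M j) : Has s' G M j := by
  induction h with
  | con h3 h4 => exact .con (h2 _ _ h3) h4
  | acon h3 h4 => exact .acon (h1 _ _ h3) h4
  | _ => constructor <;> assumption

/-- Every declaration of a well-typed signature is simply typed over the preceding ones, hence over
the whole signature. -/
theorem Sig.Wf.typed {S : Sig} (h : S.Wf) : S.Typed := by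
  induction h with
  | nil => exact ⟨fun {a K} h => (nomatch h), fun {c A} h => (nomatch h)⟩
  | @ty S a K hS h0 hK ih =>
    have m : ∀ {M : X} {j : J}, Has S.er (fun _ _ => none) M j →
        Has (Sig.er (.ty a K :: S)) (fun _ _ => none) M j := fun {M j} h => by
      refine Has.sig_mono (s := S.er) (fun a' κ e => ?_) (fun c α e => e) h
      simp only [Sig.er, Sig.lookupTy] at e ⊢
      split
      · next e1 => subst e1; rw [h0] at e; cases e
      · exact e
    refine ⟨fun {a' K'} e => ?_, fun {c A} e => m (ih.tm e)⟩
    rw [Sig.lookupTy] at e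
    split at e
    · cases e; exact m (hK.has ih .nil)
    · exact m (ih.ty e)
  | @tm S a K hS h0 hK ih =>
    have m : ∀ {M : X} {j : J}, Has S.er (fun _ _ => none) M j →
        Has (Sig.er (.tm a K :: S)) (fun _ _ => none) M j := fun {M j} h => by
      refine Has.sig_mono (s := S.er) (fun c α e => e) (fun a' κ e => ?_) h
      simp only [Sig.er, Sig.lookupTm] at e ⊢
      split
      · next e1 => subst e1; rw [h0] at e; cases e
      · exact e
    refine ⟨fun {c A} e => m (ih.ty e), fun {a' K'} e => ?_⟩
    rw [Sig.lookupTm] at e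
    split at e
    · cases e; exact m (hK.has ih .nil)
    · exact m (ih.tm e)

/-! ### Commutation of substitutions up to equality -/

/-- The type of an application commutes with substitution, up to equality. -/
theorem Sub.single_conv {G G' : SCtx} {θ : Env} {b n : ℕ} (hE : HasEnv s G' θ G) (hB : Bd b G θ)
    {h : List ℕ} {N N' B B' B₁ B₂ Z Z₂ : X} {α φ β : T}
    (hN : Has s G (.clo false n h N) (.ent false n α φ))
    (hM : Has s (cons n (some (α, φ)) G) B (.ty β))
    (h1 : Sub θ (.clo false n h N) (.clo false n h N')) (h2 : Sub (MLCTT.single n h N) B B₁)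
    (h3 : Sub θ B₁ Z) (h4 : Sub (MLCTT.under n θ) B B')
    (hB₂ : Has s (cons n (some (α, φ)) G') B₂ (.ty β)) (e : B₂.nf = B'.nf)
    (h5 : Sub (MLCTT.single n h N') B₂ Z₂) : Z₂.nf = Z.nf := by
  obtain ⟨Y, h6, hB'⟩ := Sub.total b hM (hE.under n _) (hB.under n _)
  cases h6.det h4
  obtain ⟨F, h7, hN'⟩ := Sub.total b hN hE hB
  cases h7.det h1
  have h8 := CompAt.single (Sub.comp _) le_rfl hE hB hN hM hB' h1 h2 h3 h4
  exact RespAt.full (Sub.resp _) hB₂ hB' e (HasEnv.single hN') (HasEnv.single hN') Bd.single Bd.single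
    (EqE.refl _ _) h5 h8

/-- The instance of a type, or of a declaration, by a simultaneous substitution commutes with
substitution, up to equality. -/
theorem Sub.inst_conv {G G' : SCtx} {θ : Env} {b n : ℕ} (hE : HasEnv s G' θ G) (hB : Bd b G θ)
    {φ : T} {σ σ' A A' A₁ A₂ Z Z₂ : X} {j : J} (hφ : φ.Ok (some n)) (hσ : Has s G σ (.sbn φ))
    (hA : Has s (belowOr n φ.get G) A j) (hj : ∀ Y, Res s b (belowOr n φ.get G') Y j →
      Has s (belowOr n φ.get G') Y j)
    (h1 : Sub θ σ σ') (h2 : Sub (MLCTT.inst n φ.hat σ) A A₁)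
    (h3 : Sub θ A₁ Z) (h4 : Sub (enterE n θ) A A')
    (hA₂ : Has s (belowOr n φ.get G') A₂ j) (e : A₂.nf = A'.nf)
    (h5 : Sub (MLCTT.inst n φ.hat σ') A₂ Z₂) : Rl Z₂ Z j := by
  obtain ⟨Y, h6, hA'⟩ := Sub.total b hA (hE.enter n _) (hB.enter n _)
  cases h6.det h4
  obtain ⟨F, h7, hσ'⟩ := Sub.total b hσ hE hB
  cases h7.det h1
  have h8 := CompAt.inst (Sub.comp _) hφ le_rfl hE hB hσ hA (hj _ hA') h1 h2 h3 h4
  exact RespAt.full (Sub.resp _) hA₂ (hj _ hA') e (HasEnv.inst hφ hσ') (HasEnv.inst hφ hσ') (Bd.inst hφ)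
    (Bd.inst hφ) (EqE.refl _ _) h5 h8

theorem Ty.er_arrow {C : Ty} {k : ℕ} {α φ β : T} (h : C.er = .arrow k α φ β) :
    ∃ A Γ B, C = .pi k A Γ B ∧ A.er = α ∧ Γ.er = φ ∧ B.er = β := by
  cases C with
  | atom P => cases h
  | pi k A Γ B => rw [Ty.er, T.arrow.injEq] at h; obtain ⟨rfl, h⟩ := h; exact ⟨A, Γ, B, rfl, h⟩

theorem Ty.er_base {C : Ty} {l : Lbl} (h : C.er = .base l) : ∃ P, C = .atom P := by
  cases C with
  | atom P => exact ⟨P, rfl⟩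
  | pi => cases h

theorem Ctx.er_snoc {Ψ : Ctx} {k : ℕ} {φ α ψ : T} (h : Ψ.er = .snoc φ k α ψ) :
    ∃ Φ A Γ, Ψ = .snoc Φ k A Γ ∧ Φ.er = φ ∧ A.er = α ∧ Γ.er = ψ := by
  cases Ψ with
  | nil => cases h
  | snoc Φ k A Γ => rw [Ctx.er, T.snoc.injEq] at h; obtain ⟨h1, rfl, h⟩ := h; exact ⟨Φ, A, Γ, rfl, h1, h⟩

theorem Ty.pi_nf_iff {k : ℕ} {A A' B B' : Ty} {Γ Γ' : Ctx} :
    (Ty.pi k A Γ B).toX.nf = (Ty.pi k A' Γ' B').toX.nf ↔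
      (declX k A Γ).nf = (declX k A' Γ').nf ∧ B.toX.nf = B'.toX.nf := by
  simp [Ty.toX, declX, X.nf]

/-- The result of a substitution into a function type. -/
theorem Has.sub_pi {G G' : SCtx} {n : ℕ} {A B C : Ty} {Φ : Ctx} {α : T} {θ : Env} {b : ℕ}
    (h : Has s G (Ty.pi n A Φ B).toX (.ty α)) (hE : HasEnv s G' θ G) (hB : Bd b G θ)
    (h' : Sub θ (Ty.pi n A Φ B).toX C.toX) : ∃ A₁ Φ₁ B₁, C = .pi n A₁ Φ₁ B₁ ∧
      Sub θ (MLCTT.declX n A Φ) (MLCTT.declX n A₁ Φ₁) ∧ Sub (MLCTT.under n θ) B.toX B₁.toX ∧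
      Has s G' (MLCTT.declX n A₁ Φ₁) (.decl n A.er Φ.er) ∧ A₁.er = A.er ∧ Φ₁.er = Φ.er ∧
      Has s (cons n (some (A.er, Φ.er)) G') B₁.toX (.ty B.er) ∧ B₁.er = B.er := by
  obtain ⟨-, h1, h2⟩ := h.pi_inv
  obtain ⟨A₁, Φ₁, h3, h4, h5, h6⟩ := h1.exists_decl hE hB
  obtain ⟨B₁, h7, h8, h9⟩ := h2.exists_ty (hE.under n _) (hB.under n _)
  refine ⟨A₁, Φ₁, B₁, ?_, h3, h7, h4, h5, h6, h8, h9⟩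
  exact Ty.toX_inj (h'.det (.pair h3 (.lam h7)))

theorem Sub.declX_inv {θ : Env} {n : ℕ} {A A' : Ty} {Φ Φ' : Ctx}
    (h : Sub θ (declX n A Φ) (declX n A' Φ')) :
    Φ.hat = Φ'.hat ∧ Sub (enterE n θ) A.toX A'.toX ∧ Sub θ (Φ.toX n) (Φ'.toX n) := by
  generalize e : declX n A' Φ' = D at h
  cases h with
  | pair h1 h2 =>
    cases h1 with
    | clo h1 =>
      rw [declX, X.pair.injEq, X.clo.injEq] at e
      obtain ⟨⟨-, -, h3, rfl⟩, rfl⟩ := e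
      exact ⟨h3.symm, h1, h2⟩

theorem declX_nf_iff' {A B : Ty} {Γ Δ : Ctx} {k : ℕ} :
    (declX k A Γ).nf = (declX k B Δ).nf ↔ A.toX.nf = B.toX.nf ∧ (Γ.toX k).nf = (Δ.toX k).nf := by
  rw [declX_nf_iff, Ty.eqv_iff, Ctx.eqv_iff k]

/-! ### Morphisms of contexts -/

/-- An environment which takes the variables of `Ψ` to entries that are well-typed over `Ψ'`, and
which renames all variables whose declarations have a size above `b`. -/
structure Mor (S : Sig) (b : ℕ) (Ψ' : Ctx) (θ : Env) (Ψ : Ctx) : Prop where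
  src : Ψ.SWf S.er
  tgt : Ψ'.SWf S.er
  env : HasEnv S.er Ψ'.sctx θ Ψ.sctx
  bd : Bd b Ψ.sctx θ
  img : ∀ {k i : ℕ} {D : X}, Ψ.look k i = some D → ∃ A Γ, Sub θ D (declX k A Γ) ∧
    ((∃ i' D', θ k i = .ren k i' ∧ Ψ'.look k i' = some D' ∧ D'.nf = (declX k A Γ).nf) ∨
      ∃ N : Tm, θ k i = .clo true k Γ.hat N.toX ∧ TmChk S ((Ψ'.chop k).merge Γ) N A)

variable {S : Sig} {b n : ℕ} {Ψ Ψ' : Ctx} {θ : Env}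

theorem Ctx.look_has (hΨ : Ψ.SWf s) {k i : ℕ} {D : X} (h : Ψ.look k i = some D) :
    ∃ d, Ψ.sctx k i = some d ∧ Has s Ψ.sctx D (.decl k d.1 d.2) := by
  obtain ⟨A, Γ, h1, rfl⟩ := Ctx.lookup_of_look h
  exact ⟨_, Ctx.sctx_of_lookup h1, hΨ.has h1⟩

/-- Environments that agree on the variables of the source are the same morphism. -/
theorem Mor.congr (M : Mor S b Ψ' θ Ψ) {θ' : Env}
    (he : ∀ l i d, Ψ.sctx l i = some d → θ l i = θ' l i) : Mor S b Ψ' θ' Ψ where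
  src := M.src
  tgt := M.tgt
  env := fun k i α φ h => by rw [← he k i _ h]; exact M.env k i α φ h
  bd := fun k i α φ h => by rw [← he k i _ h]; exact M.bd k i α φ h
  img := fun {k i D} h => by
    obtain ⟨d, h1, h2⟩ := Ctx.look_has M.src h
    obtain ⟨A, Γ, h3, h4⟩ := M.img h
    rw [← he k i _ h1]
    exact ⟨A, Γ, Sub.congr_dom h2 M.env M.bd he h3, h4⟩

theorem Mor.id (h : Ψ.SWf S.er) : Mor S 0 Ψ idE Ψ where
  src := h
  tgt := h
  env := fun k i α φ h1 h2 h3 => .ren h1 h2 h3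
  bd := fun k i α φ _ => .inl ⟨i, rfl⟩
  img := fun {k i D} hD => by
    obtain ⟨A, Γ, h1, rfl⟩ := Ctx.lookup_of_look hD
    exact ⟨A, Γ, (h.has h1).sub_id fun _ _ _ _ => rfl, .inl ⟨i, _, rfl, hD, rfl⟩⟩

/-- Extension of a morphism by an entry. -/
theorem Mor.cons (M : Mor S b Ψ' θ Ψ) {A A' : Ty} {Φ Φ' : Ctx} {F : X}
    (hD : Has S.er Ψ.sctx (declX n A Φ) (.decl n A.er Φ.er))
    (hF : Has S.er Ψ'.sctx F (.ent true n A.er Φ.er))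
    (hb : (∃ i', F = .ren n i') ∨ A.er.size + Φ.er.size + 1 ≤ b)
    (h1 : Sub θ (declX n A Φ) (declX n A' Φ'))
    (h2 : (∃ i' D', F = .ren n i' ∧ Ψ'.look n i' = some D' ∧ D'.nf = (declX n A' Φ').nf) ∨
      ∃ N : Tm, F = .clo true n Φ'.hat N.toX ∧ TmChk S ((Ψ'.chop n).merge Φ') N A') :
    Mor S b Ψ' (MLCTT.cons n F θ) (Ψ.ins n A Φ) := by
  have hw : ∀ {D D' : X}, Sub θ D D' → Sub (MLCTT.cons n F θ) (D.weak n) D' := by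
    intro D D' h
    have := h.rename (ρ := shift n) (ρ' := fun _ i => i) (θ' := MLCTT.cons n F θ)
      fun l i _ => by rw [cons_shift, X.rename_id]
    rwa [X.rename_id] at this
  refine ⟨M.src.ins hD, M.tgt, ?_, ?_, ?_⟩
  · intro l i α φ hl o1 o2
    rw [Ctx.sctx_ins] at hl
    rcases index_cases n l i with ⟨rfl, rfl⟩ | ⟨j, rfl⟩
    · rw [cons_zero] at hl ⊢; cases hl; exact hF
    · rw [cons_shift] at hl ⊢; exact M.env l j α φ hl o1 o2
  · intro l i α φ hl
    rw [Ctx.sctx_ins] at hl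
    rcases index_cases n l i with ⟨rfl, rfl⟩ | ⟨j, rfl⟩
    · rw [cons_zero] at hl ⊢; cases hl; exact hb
    · rw [cons_shift] at hl ⊢; exact M.bd l j α φ hl
  · intro l i D hl
    rw [M.src.good.look_ins hD.ok.1 hD.ok.2, push] at hl
    rcases index_cases n l i with ⟨rfl, rfl⟩ | ⟨j, rfl⟩
    · rw [cons_zero] at hl ⊢; cases hl
      exact ⟨A', Φ', hw h1, h2⟩
    · rw [cons_shift] at hl ⊢
      cases e : Ψ.look l j with
      | none => rw [e] at hl; cases hl
      | some D₀ =>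
        rw [e] at hl; cases hl
        obtain ⟨A₁, Γ₁, h3, h4⟩ := M.img e
        exact ⟨A₁, Γ₁, hw h3, h4⟩

/-- Weakening of typed terms, inside of closures. -/
def Weakens (S : Sig) : Prop :=
  ∀ {Ψ : Ctx} {n k : ℕ} {A B : Ty} {Φ Γ : Ctx} {N : Tm}, Ψ.SWf S.er →
    Has S.er Ψ.sctx (declX n A Φ) (.decl n A.er Φ.er) →
    Has S.er Ψ.sctx (declX k B Γ) (.decl k B.er Γ.er) → TmChk S ((Ψ.chop k).merge Γ) N B →
    ∃ (N' : Tm) (B' : Ty) (Γ' : Ctx), declX k B' Γ' = (declX k B Γ).weak n ∧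
      N'.toX = N.toX.rename (enterR k (shift n)) ∧
      TmChk S (((Ψ.ins n A Φ).chop k).merge Γ') N' B'

theorem Ctx.Good.look_ins_shift (g : Ψ.Good) {A : Ty} {Γ : Ctx} (hA : A.er.Ok none)
    (hΓ : Γ.er.Ok (some n)) {l i : ℕ} {D : X} (h : Ψ.look l i = some D) :
    (Ψ.ins n A Γ).look l (shift n l i) = some (D.weak n) := by
  rw [g.look_ins hA hΓ, push, cons_shift, h]; rfl

/-- Weakening of the target of a morphism. -/
theorem Mor.weaken (hW : 0 < b → Weakens S) (M : Mor S b Ψ' θ Ψ) {A : Ty} {Φ : Ctx}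
    (hD : Has S.er Ψ'.sctx (declX n A Φ) (.decl n A.er Φ.er)) :
    Mor S b (Ψ'.ins n A Φ) (fun l i => (θ l i).weak n) Ψ where
  src := M.src
  tgt := M.tgt.ins hD
  env := fun k i α φ h1 h2 h3 => by
    rw [Ctx.sctx_ins]; exact (M.env k i α φ h1 h2 h3).weak _ _
  bd := fun k i α φ h => (M.bd k i α φ h).imp_left fun ⟨i', e⟩ => ⟨shift n k i', by simp only [e]; rfl⟩
  img := fun {k i D} h => by
    obtain ⟨d, h1, h2⟩ := Ctx.look_has M.src h
    obtain ⟨A', Γ', h3, h4⟩ := M.img h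
    obtain ⟨A₁, Γ₁, h5, h6, h7, h8⟩ := h2.exists_decl M.env M.bd
    obtain ⟨rfl, rfl⟩ := declX_inj (h5.det h3)
    have hs : Sub (fun l i => (θ l i).weak n) D ((declX k A₁ Γ₁).weak n) := by
      have := h3.rename (ρ := fun _ i => i) (ρ' := shift n) (θ' := fun l i => (θ l i).weak n)
        fun l i _ => rfl
      rwa [X.rename_id] at this
    rcases h4 with ⟨i', D', h9, h10, h11⟩ | ⟨N, h9, h10⟩
    · have h12 := M.tgt.good.look_ins_shift hD.ok.1 hD.ok.2 h10
      obtain ⟨A₂, Γ₂, h13, h14⟩ := (h6.weak n (some (A.er, Φ.er))).img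
      refine ⟨A₂, Γ₂, (show _ = declX k A₂ Γ₂ from h13) ▸ hs, .inl ⟨_, _, by rw [h9]; rfl, h12, ?_⟩⟩
      obtain ⟨d', -, h15⟩ := Ctx.look_has M.tgt h10
      rw [← show _ = declX k A₂ Γ₂ from h13, h15.nf_weak, h11, h6.nf_weak]
    -- Only for closures a typing derivation has to be weakened; a morphism of bound `0` has none.
    · have hb : 0 < b := by
        rcases M.bd k i d.1 d.2 h1 with ⟨i', e⟩ | h
        · rw [e] at h9; cases h9
        · omega
      rw [← h7, ← h8] at h6
      obtain ⟨N', B', Γ', h11, h12, h13⟩ := hW hb M.tgt hD h6 h10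
      refine ⟨B', Γ', h11 ▸ hs, .inr ⟨N', ?_, h13⟩⟩
      rw [h9, h12]
      have : Γ'.hat = Γ₁.hat := by
        simp only [declX, X.weak, X.rename, X.pair.injEq, X.clo.injEq] at h11; exact h11.1.2.2.1
      rw [this]; rfl

/-- Morphisms under one more variable.  Its declaration in the target only has to be equal to the
result of the substitution. -/
theorem Mor.ins (hW : 0 < b → Weakens S) (M : Mor S b Ψ' θ Ψ) {A A₁ A₂ : Ty} {Φ Φ₁ Φ₂ : Ctx}
    (hD : Has S.er Ψ.sctx (declX n A Φ) (.decl n A.er Φ.er))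
    (hD₂ : Has S.er Ψ'.sctx (declX n A₂ Φ₂) (.decl n A.er Φ.er))
    (h : Sub θ (declX n A Φ) (declX n A₁ Φ₁)) (e : (declX n A₂ Φ₂).nf = (declX n A₁ Φ₁).nf) :
    Mor S b (Ψ'.ins n A₂ Φ₂) (under n θ) (Ψ.ins n A Φ) := by
  obtain ⟨e1, e2, -, -⟩ := hD₂.decl_inv
  have hD₂' := hD₂
  rw [← e1, ← e2] at hD₂
  have M' := M.weaken hW hD₂
  have hs : Sub (fun l i => (θ l i).weak n) (declX n A Φ) ((declX n A₁ Φ₁).weak n) := by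
    have := h.rename (ρ := fun _ i => i) (ρ' := shift n) (θ' := fun l i => (θ l i).weak n)
      fun l i _ => rfl
    rwa [X.rename_id] at this
  obtain ⟨B, Γ, h1, h2, h3, h4⟩ := hD.exists_decl M'.env M'.bd
  obtain ⟨Y, h5, h6⟩ := Sub.total b hD M.env M.bd
  cases h5.det h
  refine M'.cons hD ?_ (.inl ⟨0, rfl⟩) h1 (.inl ⟨0, (declX n A₂ Φ₂).weak n, rfl, ?_, ?_⟩)
  · exact .ren (by rw [Ctx.sctx_ins, cons_zero, e1, e2]) hD.ok.1 hD.ok.2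
  · rw [M.tgt.good.look_ins hD₂.ok.1 hD₂.ok.2, push, cons_zero]
  · rw [h1.det hs, hD₂.nf_weak, e, Has.nf_weak (s := S.er) (j := .decl n A.er Φ.er) h6]

/-- The restriction of a morphism to the variables of levels `≥ n`. -/
theorem Mor.chop (M : Mor S b Ψ' θ Ψ) (n : ℕ) :
    Mor S b (Ψ'.chop n) (enterE n θ) (Ψ.chop n) where
  src := M.src.chop n
  tgt := M.tgt.chop n
  env := by
    rw [M.src.good.sctx_chop, M.tgt.good.sctx_chop]; exact M.env.enter n _
  bd := by
    rw [M.src.good.sctx_chop]; exact M.bd.enter n _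
  img := fun {k i D} h => by
    obtain ⟨A, Γ, h1, rfl⟩ := Ctx.lookup_of_look h
    have hk := M.src.good.chop_ge k (Ctx.lookup_mem h1)
    rw [Ctx.lookup_chop hk] at h1
    obtain ⟨A', Γ', h2, h3⟩ := M.img (Ctx.look_of_lookup h1)
    have he : ∀ l i, k ≤ l → θ l i = enterE n θ l i := fun l i hl =>
      (belowOr_ge (hk.trans hl) _ _ _).symm
    refine ⟨A', Γ', h2.declX_congr he, ?_⟩
    rw [← he k i le_rfl, Ctx.chop_chop hk]
    simpa only [Ctx.look, Ctx.lookup_chop hk] using h3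

/-- Morphisms inside of closures. -/
theorem Mor.enter (hW : 0 < b → Weakens S) (M : Mor S b Ψ' θ Ψ) (n : ℕ) : ∀ {Φ Φ₁ Φ₂ : Ctx},
    Has S.er Ψ.sctx (Φ.toX n) (.ctx n Φ.er) → Has S.er Ψ'.sctx (Φ₂.toX n) (.ctx n Φ.er) →
    Sub θ (Φ.toX n) (Φ₁.toX n) → (Φ₂.toX n).nf = (Φ₁.toX n).nf →
    Mor S b ((Ψ'.chop n).merge Φ₂) (enterE n θ) ((Ψ.chop n).merge Φ)
  | .nil, Φ₁, Φ₂, _, h2, _, _ => by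
    have := h2.ctx_er
    cases Φ₂ with
    | nil => exact M.chop n
    | snoc => cases this
  | .snoc Φ k A Γ, Φ₁, Φ₂, h1, h2, h3, e => by
    obtain ⟨g1, g2, g3⟩ := h1.ctx_snoc_inv
    obtain ⟨Φ₂, A₂, Γ₂, rfl, e1, e2, e3⟩ := Ctx.er_snoc h2.ctx_er
    rw [Ctx.er, ← e1, ← e2, ← e3] at h2
    obtain ⟨g4, -, g5⟩ := h2.ctx_snoc_inv
    cases Φ₁ with
    | nil => simp [Ctx.toX, X.nf] at e
    | snoc Φ₁ k₁ A₁ Γ₁ =>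
      simp only [Ctx.toX, X.nf, X.pair.injEq, X.clo.injEq, true_and] at e
      generalize eY : (Ctx.snoc Φ₁ k₁ A₁ Γ₁).toX n = Y at h3
      cases h3 with
      | pair h3 h4 =>
        cases h4 with
        | clo h4 =>
          simp only [Ctx.toX, X.pair.injEq, X.clo.injEq, true_and] at eY
          obtain ⟨rfl, -, rfl⟩ := eY
          obtain ⟨e4, -, ⟨e5, -, e7⟩, e8⟩ := e
          have M' := M.enter hW n g1 (e1 ▸ g4) h3 e4
          subst e5
          rw [← M.src.good.sctx_merge g1.ok] at g3
          rw [← M.tgt.good.sctx_merge g4.ok, e2, e3] at g5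
          refine (M'.ins hW (A₁ := A₁) (Φ₁ := Γ₁) (A₂ := A₂) (Φ₂ := Γ₂) g3 g5 h4
            (declX_nf_iff'.2 ⟨e7, e8⟩)).congr ?_
          -- On the domain, `enterE n θ` under one more variable of level `k < n` is `enterE n θ`
          -- itself, since images of variables of levels `≥ n` do not depend on variables of level
          -- `k`.
          intro l i d hd
          rcases index_cases k l i with ⟨rfl, rfl⟩ | ⟨j, rfl⟩
          · rw [under_zero, enterE, belowOr_lt g2]; rfl
          · rw [Ctx.sctx_ins, cons_shift] at hd
            rw [under_shift]
            rcases Nat.lt_or_ge l n with hl | hl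
            · rw [enterE, belowOr_lt hl, belowOr_lt hl]; rfl
            · rw [shift_ne (by omega)]
              have o := Ctx.lookup_of_sctx hd
              obtain ⟨B, Δ, hB, rfl⟩ := o
              have o := (M'.src.has hB).ok
              have hL := (M'.env l j _ _ hd o.1 o.2).lv
              have := hL.rename_congr (ρ := shift k) (ρ' := fun _ i => i) fun m i hm =>
                shift_ne (by omega) i
              rwa [X.rename_id] at this

/-- The inclusion of a chopped context. -/
theorem Mor.chop_id (h : Ψ.SWf S.er) (n : ℕ) : Mor S 0 Ψ idE (Ψ.chop n) where
  src := h.chop n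
  tgt := h
  env := fun k i α φ h1 h2 h3 => by
    rw [h.good.sctx_chop] at h1
    rcases Nat.lt_or_ge k n with hk | hk
    · rw [belowOr_lt hk] at h1; cases h1
    · rw [belowOr_ge hk] at h1; exact .ren h1 h2 h3
  bd := fun k i α φ _ => .inl ⟨i, rfl⟩
  img := fun {k i D} hD => by
    obtain ⟨A, Γ, h1, rfl⟩ := Ctx.lookup_of_look hD
    have hk := h.good.chop_ge k (Ctx.lookup_mem h1)
    rw [Ctx.lookup_chop hk] at h1
    exact ⟨A, Γ, (h.has h1).sub_id fun _ _ _ _ => rfl, .inl ⟨i, _, rfl, Ctx.look_of_lookup h1, rfl⟩⟩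

theorem Mor.mono (M : Mor S b Ψ' θ Ψ) {b' : ℕ} (h : b ≤ b') : Mor S b' Ψ' θ Ψ :=
  ⟨M.src, M.tgt, M.env, M.bd.mono h, M.img⟩

/-- A single substitution is a morphism. -/
theorem Mor.single (hS : S.Typed) (h : Ψ.SWf S.er) {A : Ty} {Φ : Ctx} {N : Tm}
    (hD : Has S.er Ψ.sctx (declX n A Φ) (.decl n A.er Φ.er))
    (hN : TmChk S ((Ψ.chop n).merge Φ) N A) :
    Mor S (A.er.size + Φ.er.size + 1) Ψ (MLCTT.single n Φ.hat N.toX) (Ψ.ins n A Φ) := by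
  obtain ⟨-, -, h1, h2⟩ := hD.decl_inv
  have e := h.good.sctx_merge hD.ok.2
  have h3 := hN.has hS (h.merge h2) (by rwa [e])
  rw [e] at h3
  exact ((Mor.id h).mono (Nat.zero_le _)).cons hD (.clo_intro hD.ok.2 h3) (.inr le_rfl)
    (hD.sub_id fun _ _ _ _ => rfl) (.inr ⟨N, rfl, hN⟩)

/-- The simple type of a closure with a well-typed body. -/
theorem TmChk.has_entry (hS : S.Typed) (h : Ψ.SWf S.er) {A : Ty} {Φ : Ctx} {N : Tm}
    (hD : Has S.er Ψ.sctx (declX n A Φ) (.decl n A.er Φ.er))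
    (hN : TmChk S ((Ψ.chop n).merge Φ) N A) (e : Bool) :
    Has S.er Ψ.sctx (.clo e n Φ.hat N.toX) (.ent e n A.er Φ.er) := by
  obtain ⟨-, -, h1, h2⟩ := hD.decl_inv
  have e := h.good.sctx_merge hD.ok.2
  have h3 := hN.has hS (h.merge h2) (by rwa [e])
  rw [e] at h3
  exact .clo_intro hD.ok.2 h3

/-- A simultaneous substitution is a morphism. -/
theorem Mor.inst (hS : S.Typed) (h : Ψ.SWf S.er) : ∀ {Φ : Ctx} {σ : Sbn}, SbnChk S Ψ σ n Φ →
    Has S.er Ψ.sctx (Φ.toX n) (.ctx n Φ.er) →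
    Mor S Φ.er.size Ψ (MLCTT.inst n Φ.hat σ.toX) ((Ψ.chop n).merge Φ)
  | .nil, σ, _, _ => by
    refine (Mor.chop_id h n).congr fun l i d hl => ?_
    rw [h.good.sctx_chop] at hl
    rw [Ctx.hat, MLCTT.inst]
    rcases Nat.lt_or_ge l n with hln | hln
    · rw [belowOr_lt hln] at hl; cases hl
    · rw [belowOr_ge hln]
  | .snoc Φ k A Γ, σ, hσ, hΦ => by
    obtain ⟨h1, h2, h3⟩ := hΦ.ctx_snoc_inv
    cases hσ with
    | @clo _ σ _ _ _ _ Γ₁ _ A₁ N hσ hΓ hA hN =>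
      have h4 := hσ.has hS h h1
      have M := (Mor.inst hS h hσ h1).mono (b' := (Ctx.snoc Φ k A Γ).er.size)
        (by simp only [Ctx.er, T.size]; omega)
      have h5 := (h3.hdecl_inst_iff h2 h1.ok h4).1 ⟨hΓ, hA⟩
      have h6 := h3
      rw [← h.good.sctx_merge h1.ok] at h6
      obtain ⟨A', Γ', h7, h8, h9, h10⟩ := h6.exists_decl M.env M.bd
      obtain ⟨rfl, rfl⟩ := declX_inj (h7.det h5)
      obtain ⟨e, -, -⟩ := h5.declX_inv
      rw [← h9, ← h10] at h8
      have h11 := hN.has_entry hS h h8 true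
      rw [h9, h10, ← e] at h11
      exact M.cons h6 h11 (.inr (by simp only [Ctx.er, T.size]; omega)) h5
        (.inr ⟨N, by rw [← e]; rfl, hN⟩)
    | @ren _ σ _ _ i _ _ Γ₁ Γ₀ _ A₁ A₀ hσ hΓ hA hl e1 e2 =>
      have h4 := hσ.has hS h h1
      have M := (Mor.inst hS h hσ h1).mono (b' := (Ctx.snoc Φ k A Γ).er.size)
        (by simp only [Ctx.er, T.size]; omega)
      have h5 := (h3.hdecl_inst_iff h2 h1.ok h4).1 ⟨hΓ, hA⟩
      have h6 := h3
      rw [← h.good.sctx_merge h1.ok] at h6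
      obtain ⟨A', Γ', h7, h8, h9, h10⟩ := h6.exists_decl M.env M.bd
      obtain ⟨rfl, rfl⟩ := declX_inj (h7.det h5)
      have e3 := (declX_nf_iff (k := k)).2 ⟨e1, e2⟩
      obtain ⟨e4, e5⟩ := (h.has hl).decl_unique h8 e3
      exact M.cons h6 (.ren (by rw [Ctx.sctx_of_lookup hl, e4, e5]) h6.ok.1 h6.ok.2)
        (.inl ⟨i, rfl⟩) h5 (.inl ⟨i, _, rfl, Ctx.look_of_lookup hl, e3⟩)

/-- Morphisms of bound `b` preserve the typing of normal terms, also if the type is replaced by an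
equal one. -/
def TmPres (S : Sig) (b : ℕ) : Prop :=
  ∀ {Ψ : Ctx} {M : Tm} {C : Ty}, TmChk S Ψ M C → Has S.er Ψ.sctx C.toX (.ty C.er) →
    ∀ {Ψ' : Ctx} {θ : Env}, Mor S b Ψ' θ Ψ → ∀ {C' C₂ : Ty}, Sub θ C.toX C'.toX →
      C₂.toX.nf = C'.toX.nf → Has S.er Ψ'.sctx C₂.toX (.ty C.er) →
      ∃ M' : Tm, Sub θ M.toX M'.toX ∧ TmChk S Ψ' M' C₂

/-- Weakening is the preservation of typing by a renaming, hence by a morphism of bound `0`. -/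
theorem TmPres.weakens (hS : S.Typed) (H : TmPres S 0) : Weakens S := by
  intro Ψ n k A B Φ Γ N hΨ hD hE hN
  have hW : 0 < 0 → Weakens S := fun h => absurd h (lt_irrefl _)
  have M := (Mor.id hΨ).weaken hW hD
  have hs : ∀ {m l i : ℕ} {d : T × T}, belowOr m Γ.er.get Ψ.sctx l i = some d →
      enterE m (fun l i => (idE l i).weak n) l i = .ren l (enterR m (shift n) l i) := by
    intro m l i d _
    rcases Nat.lt_or_ge l m with h | h
    · simp [enterE, enterR, belowOr_lt h, idE]
    · simp [enterE, enterR, belowOr_ge h, idE, X.rename]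
  obtain ⟨-, -, h1, h2⟩ := hE.decl_inv
  obtain ⟨B', Γ', h3, h4, h5, h6⟩ := hE.exists_decl M.env M.bd
  obtain ⟨-, h8, h9⟩ := h3.declX_inv
  obtain ⟨-, -, h10, h11⟩ := h4.decl_inv
  have M' := M.enter hW k h2 h11 h9 rfl
  have e := hΨ.good.sctx_merge hE.ok.2
  obtain ⟨N', h12, h13⟩ := H hN (by rwa [e]) M' h8 rfl
    (by rw [M.tgt.good.sctx_merge (by rw [h6]; exact hE.ok.2), h6]; exact h10)
  refine ⟨N', B', Γ', h3.det (hE.sub_rename fun l i d _ => rfl), ?_, h13⟩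
  have h14 := hN.has hS (hΨ.merge h2) (by rwa [e])
  rw [e] at h14
  exact h12.det (h14.sub_rename fun l i d h => hs h)

theorem Has.sub_star {θ : Env} {K : Ty} (h : Sub θ Ty.star.toX K.toX) : K = .star :=
  Ty.toX_inj (h.det (.leaf _))

theorem Ty.star_of_nf {K : Ty} (h : K.toX.nf = Ty.star.toX.nf) : K = .star := by
  cases K with
  | atom P =>
    cases P with
    | sort t => simp [Ty.toX, ATy.toX, X.nf] at h; rw [h]
    | _ => simp [Ty.toX, ATy.toX, X.nf] at h
  | pi => simp [Ty.toX, ATy.toX, X.nf] at h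

/-- Chopping at `k` has no effect if no variable has a level below `k`. -/
theorem CtxWf.snoc_env (g : Ψ.Good) {k : ℕ} {Φ : Ctx} (h : k < n) (hl : ∀ l ∈ Φ.hat, k ≤ l) :
    ((Ψ.chop n).merge Φ).chop k = (Ψ.chop n).merge Φ :=
  Ctx.chop_of_ge fun m hm => by
    rcases Ctx.mem_hat_merge.1 hm with hm | hm
    · exact hl m hm
    · have := g.chop_ge m hm; omega

/-- Substitution into the argument and into the type of an application. -/
theorem Mor.app_conv (hS : S.Typed) (hW : 0 < b → Weakens S) (M : Mor S b Ψ' θ Ψ) {A B B₁ C' C₂ : Ty}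
    {Φ : Ctx} {N : Tm} {α : T} (hC : Has S.er Ψ.sctx (Ty.pi n A Φ B).toX (.ty α))
    (hN : TmChk S ((Ψ.chop n).merge Φ) N A)
    (hB : HTy (.single n 0 Φ.hat N A.erase Φ.erase) B B₁)
    (ih : Has S.er ((Ψ.chop n).merge Φ).sctx A.toX (.ty A.er) → ∀ {Ψ' : Ctx} {θ : Env},
      Mor S b Ψ' θ ((Ψ.chop n).merge Φ) → ∀ {C' C₂ : Ty},
      Sub θ A.toX C'.toX → C₂.toX.nf = C'.toX.nf → Has S.er Ψ'.sctx C₂.toX (.ty A.er) →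
      ∃ N' : Tm, Sub θ N.toX N'.toX ∧ TmChk S Ψ' N' C₂)
    (h1 : Sub θ (Ty.pi n A Φ B).toX C'.toX) (e : C₂.toX.nf = C'.toX.nf)
    (hC₂ : Has S.er Ψ'.sctx C₂.toX (.ty C₂.er)) :
    ∃ (A₂ : Ty) (Φ₂ : Ctx) (B₂ : Ty) (N' : Tm) (Z Z₂ : Ty), C₂ = .pi n A₂ Φ₂ B₂ ∧ Φ₂.hat = Φ.hat ∧
      Sub θ (.clo false n Φ.hat N.toX) (.clo false n Φ.hat N'.toX) ∧
      TmChk S ((Ψ'.chop n).merge Φ₂) N' A₂ ∧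
      Has S.er Ψ'.sctx (declX n A₂ Φ₂) (.decl n A₂.er Φ₂.er) ∧ A₂.er = A.er ∧ Φ₂.er = Φ.er ∧
      Has S.er (MLCTT.cons n (some (A₂.er, Φ₂.er)) Ψ'.sctx) B₂.toX (.ty B₂.er) ∧
      Sub θ B₁.toX Z.toX ∧ Sub (MLCTT.single n Φ₂.hat N'.toX) B₂.toX Z₂.toX ∧
      HTy (.single n 0 Φ₂.hat N' A₂.erase Φ₂.erase) B₂ Z₂ ∧ Z₂.toX.nf = Z.toX.nf ∧
      Has S.er Ψ'.sctx Z₂.toX (.ty B.er) ∧ Has S.er Ψ'.sctx Z.toX (.ty B.er) ∧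
      B₁.er = B.er := by
  obtain ⟨-, h3, h4⟩ := hC.pi_inv
  obtain ⟨-, -, h5, h6⟩ := h3.decl_inv
  obtain ⟨A₁, Φ₁, B', rfl, h7, h8, h9, h10, h11, h12, h13⟩ := hC.sub_pi M.env M.bd h1
  have hC' := Has.pi h9 h12
  have e1 : C₂.er = _ := hC₂.ty_unique hC' e
  obtain ⟨A₂, Φ₂, B₂, rfl, e2, e3, e4⟩ := Ty.er_arrow e1
  obtain ⟨-, h14, h15⟩ := hC₂.pi_inv
  obtain ⟨-, -, h16, h17⟩ := h14.decl_inv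
  obtain ⟨e5, e6⟩ := Ty.pi_nf_iff.1 e
  obtain ⟨e7, e8⟩ := declX_nf_iff'.1 e5
  obtain ⟨e9, h18, h19⟩ := h7.declX_inv
  have M' := M.enter hW n h6 (e3 ▸ h17) h19 e8
  have eΨ := M.src.good.sctx_merge h3.ok.2
  have eΨ' := M.tgt.good.sctx_merge h14.ok.2
  obtain ⟨N', h20, h21⟩ := ih (by rwa [eΨ]) M' h18 e7 (by rw [eΨ', ← e2]; exact h16)
  have eh : Φ₂.hat = Φ.hat := by rw [← Ctx.hat_er, e3, Ctx.hat_er]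
  have h22 := hN.has_entry hS M.src h3 false
  have h23 := h21.has_entry hS M.tgt h14 false
  obtain ⟨Z₂, h24, h25, h26⟩ := h15.exists_ty (HasEnv.single h23) Bd.single
  rw [h4.hty_single_iff h22] at hB
  obtain ⟨B₁', h27, h28, h29⟩ := h4.exists_ty (HasEnv.single h22) Bd.single
  cases Ty.toX_inj (h27.det hB)
  obtain ⟨Z, h30, h31, h32⟩ := h28.exists_ty M.env M.bd
  refine ⟨A₂, Φ₂, B₂, N', Z, Z₂, rfl, eh, .clo h20, h21, h14, e2, e3, h15, h30, h24,
    (h15.hty_single_iff h23).2 h24, ?_, e4 ▸ h25, h31, h29⟩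
  rw [e2, e3, e4] at h15
  exact Sub.single_conv M.env M.bd h22 h4 (.clo h20) hB h30 h8 h15 e6 (eh ▸ h24)

/-- Substitution into the declaration against which the last entry of a substitution is checked. -/
theorem Mor.entry_conv (M : Mor S b Ψ' θ Ψ) {Φ Γ Γ₁ Φ₁ Φ₂ : Ctx} {A A₁ : Ty}
    {k : ℕ} {σ : Sbn} (hΦ : Has S.er Ψ.sctx ((Ctx.snoc Φ k A Γ).toX n) (.ctx n (Ctx.snoc Φ k A Γ).er))
    (hσ : Has S.er Ψ.sctx σ.toX (.sbn Φ.er))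
    (h : Sub (MLCTT.inst n Φ.hat σ.toX) (declX k A Γ) (declX k A₁ Γ₁))
    (h1 : Sub θ ((Ctx.snoc Φ k A Γ).toX n) (Φ₁.toX n)) (e : (Φ₂.toX n).nf = (Φ₁.toX n).nf)
    (hΦ₂ : Has S.er Ψ'.sctx (Φ₂.toX n) (.ctx n (Ctx.snoc Φ k A Γ).er)) :
    ∃ (Φ₁' Φ₂' : Ctx) (A₂ : Ty) (Γ₂ : Ctx), Φ₂ = .snoc Φ₂' k A₂ Γ₂ ∧ Γ₂.hat = Γ.hat ∧
      Sub θ (Φ.toX n) (Φ₁'.toX n) ∧ (Φ₂'.toX n).nf = (Φ₁'.toX n).nf ∧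
      Has S.er Ψ'.sctx (Φ₂'.toX n) (.ctx n Φ.er) ∧
      ∀ {σ' : Sbn}, Sub θ σ.toX σ'.toX → ∃ (A' A₃ : Ty) (Γ' Γ₃ : Ctx),
        Sub θ (declX k A₁ Γ₁) (declX k A' Γ') ∧ (declX k A₃ Γ₃).nf = (declX k A' Γ').nf ∧
        Has S.er Ψ'.sctx (declX k A₃ Γ₃) (.decl k A.er Γ.er) ∧
        (HCtx (.simul n σ' Φ₂'.erase) k Γ₂ Γ₃ ∧
          HTy (.simul n ((σ'.chop k Φ₂'.erase).merge (Φ₂'.erase.chop k) (idSbn Γ₂.hat) Γ₂.erase)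
            ((Φ₂'.erase.chop k).merge Γ₂.erase)) A₂ A₃) := by
  obtain ⟨g1, g2, g3⟩ := hΦ.ctx_snoc_inv
  obtain ⟨Φ₂', A₂, Γ₂, rfl, e1, e2, e3⟩ := Ctx.er_snoc hΦ₂.ctx_er
  rw [Ctx.er, ← e1, ← e2, ← e3] at hΦ₂
  obtain ⟨g4, -, g5⟩ := hΦ₂.ctx_snoc_inv
  cases Φ₁ with
  | nil => simp [Ctx.toX, X.nf] at e
  | snoc Φ₁' k₁ A₁' Γ₁' =>
    simp only [Ctx.toX, X.nf, X.pair.injEq, X.clo.injEq, true_and] at e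
    generalize eY : (Ctx.snoc Φ₁' k₁ A₁' Γ₁').toX n = Y at h1
    cases h1 with
    | pair h3 h4 =>
      cases h4 with
      | clo h4 =>
        simp only [Ctx.toX, X.pair.injEq, X.clo.injEq, true_and] at eY
        obtain ⟨rfl, -, rfl⟩ := eY
        obtain ⟨e4, -, ⟨e5, -, e7⟩, e8⟩ := e
        subst e5
        refine ⟨Φ₁', Φ₂', A₂, Γ₂, rfl, by rw [← Ctx.hat_er, e3, Ctx.hat_er], h3, e4, e1 ▸ g4, ?_⟩
        intro σ' hs
        obtain ⟨Y, h5, hσ'⟩ := Sub.total b hσ M.env M.bd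
        cases h5.det hs
        replace hσ' : Has S.er Ψ'.sctx σ'.toX (.sbn Φ.er) := hσ'
        obtain ⟨A₀, Γ₀, h6, h7, -, -⟩ := g3.exists_decl (HasEnv.inst g1.ok hσ) (Bd.inst g1.ok)
        rw [Ctx.hat_er] at h6
        obtain ⟨rfl, rfl⟩ := declX_inj (h6.det h)
        obtain ⟨A', Γ', h8, -, -, -⟩ := h7.exists_decl M.env M.bd
        rw [← e1] at hσ'
        obtain ⟨A₃, Γ₃, h9, h10, -, -⟩ := g5.exists_decl (HasEnv.inst g4.ok hσ') (Bd.inst g4.ok)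
        rw [Ctx.hat_er] at h9
        refine ⟨A', A₃, Γ', Γ₃, h8, ?_, e2 ▸ e3 ▸ h10, (g5.hdecl_inst_iff g2 g4.ok hσ').2 h9⟩
        rw [← Ctx.hat_er, e1] at h9
        rw [← Ctx.hat_er] at h
        rw [e2, e3, e1] at g5
        exact Sub.inst_conv M.env M.bd g1.ok hσ g3 (fun _ h => h) hs h h8 h4 g5
          (declX_nf_iff'.2 ⟨e7, e8⟩) h9

/-! ### Preservation of typing by morphisms -/

mutual
/-- Morphisms preserve the synthesis of kinds, up to equality.  The hypothesis `IH`, here and for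
the other judgments, is preservation by morphisms of smaller bounds. -/
theorem ATySyn.sub (hS : S.Typed) (IH : ∀ b' < b, TmPres S b') :
    ∀ {Ψ : Ctx} {P : ATy} {K : Ty}, ATySyn S Ψ P K → ∀ {Ψ' : Ctx} {θ : Env}, Mor S b Ψ' θ Ψ →
      ∃ (P' : ATy) (K' K'' : Ty), Sub θ P.toX P'.toX ∧ Sub θ K.toX K'.toX ∧ ATySyn S Ψ' P' K'' ∧
        K''.toX.nf = K'.toX.nf
  | _, _, _, .con h, _, θ, _ => ⟨_, _, _, .leaf _, (hS.ty h).closed_sub θ, .con h, rfl⟩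
  | Ψ, _, _, @ATySyn.app _ _ P n A Φ K K₁ N hP hN hK, Ψ', θ, M => by
    have ih := @TmChk.sub hS IH _ _ _ hN
    obtain ⟨P', K', K'', h1, h2, h3, e⟩ := ATySyn.sub hS IH hP M
    obtain ⟨A₂, Φ₂, B₂, N', Z, Z₂, rfl, e1, h4, h5, -, -, -, -, h6, -, h7, e2, -, -, -⟩ :=
      M.app_conv hS (fun h => TmPres.weakens hS (IH 0 h)) (hP.has hS M.src).2 hN hK ih h2 e
        (h3.has hS M.tgt).2
    have h8 := ATySyn.app h3 h5 h7
    rw [e1] at h8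
    exact ⟨.app P' n Φ.hat N', Z, Z₂, .pair h1 h4, h6, h8, e2⟩
termination_by structural _ _ _ h => h
/-- Morphisms preserve well-formed types and kinds. -/
theorem TyChk.sub (hS : S.Typed) (IH : ∀ b' < b, TmPres S b') :
    ∀ {Ψ : Ctx} {A : Ty} {t : Srt}, TyChk S Ψ A t → ∀ {Ψ' : Ctx} {θ : Env}, Mor S b Ψ' θ Ψ →
      ∃ A' : Ty, Sub θ A.toX A'.toX ∧ TyChk S Ψ' A' t
  | _, _, _, .star, _, _, _ => ⟨_, .leaf _, .star⟩
  | _, _, _, .atom h, _, _, M => by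
    obtain ⟨P', K', K'', h1, h2, h3, e⟩ := ATySyn.sub hS IH h M
    cases Has.sub_star h2
    cases Ty.star_of_nf e
    exact ⟨.atom P', h1, .atom h3⟩
  | Ψ, _, _, @TyChk.pi _ _ n A Φ B t h1 h2 h3, Ψ', θ, M => by
    have ih1 := @TyChk.sub hS IH _ _ _ h1
    have ih3 := @TyChk.sub hS IH _ _ _ h3
    have hW : 0 < b → Weakens S := fun h => TmPres.weakens hS (IH 0 h)
    obtain ⟨Φ', h4, h5⟩ := CtxWf.sub hS IH h2 M
    have g1 := h2.has hS M.src
    obtain ⟨Φ₁, h6, h7, e1⟩ := g1.exists_ctx M.env M.bd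
    cases Ctx.toX_inj (h6.det h4)
    have M' := M.enter hW n g1 h7 h4 rfl
    obtain ⟨A', h8, h9⟩ := ih1 M'
    have g2 := h1.has hS M'.src
    rw [M.src.good.sctx_merge g1.ok] at g2
    have g3 := Has.declX g2 g1
    have h10 : Sub θ (declX n A Φ) (declX n A' Φ') := by
      rw [declX, declX, ← Ctx.hat_er Φ', e1, Ctx.hat_er]; exact .pair (.clo h8) h4
    obtain ⟨A₁, Φ₁, h11, h12, -, -⟩ := g3.exists_decl M.env M.bd
    obtain ⟨rfl, rfl⟩ := declX_inj (h11.det h10)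
    obtain ⟨B', h13, h14⟩ := ih3 (M.ins hW g3 h12 h10 rfl)
    exact ⟨.pi n A₁ Φ₁ B', .pair h10 (.lam h13), .pi h9 h5 h14⟩
termination_by structural _ _ _ h => h
/-- Morphisms preserve the typing of neutral terms.  Either the result is neutral and synthesizes
the result for the type, up to equality, or it is a normal term which checks against every type
equal to the result for the type. -/
theorem NeSyn.sub (hS : S.Typed) (IH : ∀ b' < b, TmPres S b') :
    ∀ {Ψ : Ctx} {R : Ne} {C : Ty}, NeSyn S Ψ R C → ∀ {Ψ' : Ctx} {θ : Env}, Mor S b Ψ' θ Ψ →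
      ∃ C' : Ty, Sub θ C.toX C'.toX ∧
        ((∃ (R' : Ne) (C'' : Ty), Sub θ R.toX R'.toX ∧ NeSyn S Ψ' R' C'' ∧ C''.toX.nf = C'.toX.nf) ∨
          ∃ N : Tm, Sub θ R.toX N.toX ∧ ∀ C₂ : Ty, C₂.toX.nf = C'.toX.nf →
            Has S.er Ψ'.sctx C₂.toX (.ty C.er) → TmChk S Ψ' N C₂)
  | Ψ, _, _, @NeSyn.var _ _ n i σ A A₁ Φ hl hσ hA, Ψ', θ, M => by
    have ih := fun h => @SbnChk.sub hS IH _ _ _ _ hσ h _ _ M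
    have h1 := M.src.has hl
    obtain ⟨-, -, h2, h3⟩ := h1.decl_inv
    have h4 := hσ.has hS M.src h3
    rw [h2.hty_inst_iff h3.ok h4] at hA
    obtain ⟨A₀, h5, h6, h7⟩ := h2.exists_ty (HasEnv.inst h3.ok h4) (Bd.inst h3.ok)
    rw [Ctx.hat_er] at h5
    cases Ty.toX_inj (h5.det hA)
    obtain ⟨C', h8, h9, -⟩ := h6.exists_ty M.env M.bd
    refine ⟨C', h8, ?_⟩
    obtain ⟨A', Γ', h10, h11⟩ := M.img (Ctx.look_of_lookup hl)
    obtain ⟨e1, h12, h13⟩ := h10.declX_inv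
    obtain ⟨A'', Γ'', h14, h15, e2, e3⟩ := h1.exists_decl M.env M.bd
    obtain ⟨rfl, rfl⟩ := declX_inj (h14.det h10)
    obtain ⟨-, -, h16, h17⟩ := h15.decl_inv
    rcases h11 with ⟨i', D', h18, h19, h20⟩ | ⟨N, h18, h19⟩
    · left
      obtain ⟨A₂, Φ₂, h21, rfl⟩ := Ctx.lookup_of_look h19
      have h22 := M.tgt.has h21
      obtain ⟨e4, e5⟩ := h22.decl_unique h15 h20
      obtain ⟨-, -, h23, h24⟩ := h22.decl_inv
      obtain ⟨e6, e7⟩ := declX_nf_iff'.1 h20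
      obtain ⟨σ', h25, h26⟩ := ih h3 h13 e7 (e5 ▸ h24)
      have h27 := h26.has hS M.tgt h24
      obtain ⟨C'', h28, h29, -⟩ := h23.exists_ty (HasEnv.inst h24.ok h27) (Bd.inst h24.ok)
      have h28' := h28
      rw [Ctx.hat_er] at h28
      refine ⟨.var n i' σ', C'', .vren h18 h25, .var h21 h26 ((h23.hty_inst_iff h24.ok h27).2 h28), ?_⟩
      rw [e4, e5] at h23
      rw [e5] at h28'
      rw [← Ctx.hat_er] at hA
      exact Sub.inst_conv M.env M.bd h3.ok h4 h2 (fun _ h => h) h25 hA h8 h12 h23 e6 h28'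
    -- The image is a closure; its body is instantiated by the result for `σ`, a morphism of
    -- smaller bound.
    · right
      obtain ⟨σ', h25, h26⟩ := ih h3 h13 rfl h17
      have hb : Φ.er.size < b := by
        rcases M.bd n i _ _ (Ctx.sctx_of_lookup hl) with ⟨i', e⟩ | h
        · rw [e] at h18; cases h18
        · omega
      rw [← e3] at h17
      have h27 := h26.has hS M.tgt h17
      have M' := Mor.inst hS M.tgt h26 h17
      rw [e3] at M'
      have e8 := M.tgt.good.sctx_merge h17.ok
      have h28 : Has S.er ((Ψ'.chop n).merge Γ'').sctx A''.toX (.ty A''.er) := by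
        rw [e8, e3, e2]; exact h16
      obtain ⟨Z, h29, h30, -⟩ := h28.exists_ty M'.env M'.bd
      have e9 : Z.toX.nf = C'.toX.nf := by
        rw [← Ctx.hat_er] at hA h29
        rw [e3] at h29
        exact Sub.inst_conv M.env M.bd h3.ok h4 h2 (fun _ h => h) h25 hA h8 h12 h16 rfl h29
      have key := fun {C₂ : Ty} (e : C₂.toX.nf = C'.toX.nf)
        (h : Has S.er Ψ'.sctx C₂.toX (.ty A₁.er)) =>
          IH _ hb h19 h28 M' h29 (e.trans e9.symm) (by rw [e2, ← h7]; exact h)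
      obtain ⟨N', h31, -⟩ := key rfl (by rw [h7]; exact h9)
      refine ⟨N', .vclo h18 (by rw [← Ctx.hat_er]; exact h17.ok.lt) h25 h31, fun C₂ e h => ?_⟩
      obtain ⟨N'', h32, h33⟩ := key e h
      rwa [Tm.toX_inj (h31.det h32)]
  | _, _, _, .con h, _, θ, _ =>
    ⟨_, (hS.tm h).closed_sub θ, .inl ⟨_, _, .leaf _, .con h, rfl⟩⟩
  | Ψ, _, _, @NeSyn.app _ _ R n A Φ B B₁ N hR hN hB, Ψ', θ, M => by
    have ih := @TmChk.sub hS IH _ _ _ hN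
    have hW : 0 < b → Weakens S := fun h => TmPres.weakens hS (IH 0 h)
    obtain ⟨g1, g2⟩ := hR.has hS M.src
    obtain ⟨C', h1, ⟨R', C'', h2, h3, e⟩ | ⟨N₀, h2, h3⟩⟩ := NeSyn.sub hS IH hR M
    · obtain ⟨A₂, Φ₂, B₂, N', Z, Z₂, rfl, e1, h4, h5, -, -, -, -, h6, -, h7, e2, -, -, -⟩ :=
        M.app_conv hS hW g2 hN hB ih h1 e (h3.has hS M.tgt).2
      have h8 := NeSyn.app h3 h5 h7
      rw [e1] at h8
      exact ⟨Z, h6, .inl ⟨.app R' n Φ.hat N', Z₂, .app h2 R'.toX_isLam h4, h8, e2⟩⟩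
    · obtain ⟨C₀, h4, h5, e0⟩ := g2.exists_ty M.env M.bd
      cases Ty.toX_inj (h4.det h1)
      obtain ⟨A₂, Φ₂, B₂, N', Z, Z₂, rfl, e1, h6, h7, h8, e2, e3, h9, h10, h11, h12, e4, h13, h14, e6⟩ :=
        M.app_conv hS hW g2 hN hB ih h1 rfl (e0 ▸ h5)
      have h15 := h3 _ rfl h5
      cases h15 with
      | @lam _ _ M₀ _ _ _ h15 =>
        refine ⟨Z, h10, .inr ?_⟩
        -- The head has become an abstraction, so that its type comes from a variable which is
        -- replaced by a closure, and the declaration of the argument is smaller than `b`.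
        have hb : A₂.er.size + Φ₂.er.size + 1 < b := by
          obtain ⟨Y, h16, h17⟩ := Sub.total b g1 M.env M.bd
          cases h16.det h2
          rcases h17 with h17 | ⟨-, h17⟩
          · cases h17
          · rw [e2, e3]; simp only [Ty.er, T.size] at h17; omega
        have M' := Mor.single hS M.tgt h8 h7
        have h9' := h9
        rw [← Ctx.sctx_ins] at h9'
        have e5 : B₂.er = B₁.er := by
          rw [Ty.er, Ty.er, T.arrow.injEq] at e0
          rw [e0.2.2.2, e6]
        have key := fun {C₂ : Ty} (e : C₂.toX.nf = Z.toX.nf)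
          (h : Has S.er Ψ'.sctx C₂.toX (.ty B₁.er)) =>
            IH _ hb h15 h9' M' h11 (e.trans e4.symm) (e5 ▸ h)
        obtain ⟨M₁, h18, -⟩ := key rfl (e6 ▸ h14)
        refine ⟨M₁, .beta h2 h6 (e1 ▸ h18), fun C₂ e h => ?_⟩
        obtain ⟨M₂, h19, h20⟩ := key e h
        rwa [Tm.toX_inj (h18.det h19)]
termination_by structural _ _ _ h => h
/-- Morphisms preserve the typing of normal terms.  The target type `C₂` may be any type equal to
the result `C'`, so that the statement includes conversion. -/
theorem TmChk.sub (hS : S.Typed) (IH : ∀ b' < b, TmPres S b') :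
    ∀ {Ψ : Ctx} {M : Tm} {C : Ty}, TmChk S Ψ M C → Has S.er Ψ.sctx C.toX (.ty C.er) →
      ∀ {Ψ' : Ctx} {θ : Env}, Mor S b Ψ' θ Ψ → ∀ {C' C₂ : Ty}, Sub θ C.toX C'.toX →
      C₂.toX.nf = C'.toX.nf → Has S.er Ψ'.sctx C₂.toX (.ty C.er) →
      ∃ M' : Tm, Sub θ M.toX M'.toX ∧ TmChk S Ψ' M' C₂
  | Ψ, _, _, @TmChk.ne _ _ R P Q hR e, hC, Ψ', θ, M, C', C₂, h1, e1, h2 => by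
    obtain ⟨C₁, h3, h4⟩ := NeSyn.sub hS IH hR M
    have g := (hR.has hS M.src).2
    have e2 := g.ty_unique hC (Ty.eqv_iff.1 e)
    rw [e2] at g
    -- Substitution takes equal types to equal types.
    have e3 : C₁.toX.nf = C'.toX.nf :=
      RespAt.full (Sub.resp _) g hC (Ty.eqv_iff.1 e) M.env M.env M.bd M.bd (EqE.refl _ _) h3 h1
    rw [e2] at h4
    rcases h4 with ⟨R', C'', h5, h6, e4⟩ | ⟨N, h5, h6⟩
    · obtain ⟨Q', rfl⟩ := Ty.er_base h2.ty_er
      have e5 := (h6.has hS M.tgt).2.ty_unique h2 (e4.trans (e3.trans e1.symm))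
      obtain ⟨P', rfl⟩ := Ty.er_base e5
      exact ⟨.ne R', h5, .ne h6 (Ty.eqv_iff.2 (e4.trans (e3.trans e1.symm)))⟩
    · exact ⟨N, h5, h6 _ (e1.trans e3.symm) h2⟩
  | Ψ, _, _, @TmChk.lam _ _ n N A Φ B hN, hC, Ψ', θ, M, C', C₂, h1, e1, h2 => by
    have ih := @TmChk.sub hS IH _ _ _ hN
    have hW : 0 < b → Weakens S := fun h => TmPres.weakens hS (IH 0 h)
    obtain ⟨-, g1, g2⟩ := hC.pi_inv
    obtain ⟨A₁, Φ₁, B₁, rfl, h3, h4, -, -, -, -, -⟩ := hC.sub_pi M.env M.bd h1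
    obtain ⟨A₂, Φ₂, B₂, rfl, e2, e3, e4⟩ := Ty.er_arrow h2.ty_er
    obtain ⟨-, h5, h6⟩ := h2.pi_inv
    obtain ⟨e5, e6⟩ := Ty.pi_nf_iff.1 e1
    obtain ⟨N', h7, h8⟩ := ih (by rwa [Ctx.sctx_ins]) (M.ins hW g1 (e2 ▸ e3 ▸ h5) h3 e5) h4 e6
      (by rw [Ctx.sctx_ins, ← e4]; exact h6)
    exact ⟨.lam n N', .lam h7, .lam h8⟩
termination_by structural _ _ _ h => h
/-- Morphisms preserve the typing of substitutions.  As in `TmChk.sub`, the target context is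
determined only up to equality. -/
theorem SbnChk.sub (hS : S.Typed) (IH : ∀ b' < b, TmPres S b') :
    ∀ {Ψ : Ctx} {σ : Sbn} {n : ℕ} {Φ : Ctx}, SbnChk S Ψ σ n Φ →
      Has S.er Ψ.sctx (Φ.toX n) (.ctx n Φ.er) → ∀ {Ψ' : Ctx} {θ : Env}, Mor S b Ψ' θ Ψ →
      ∀ {Φ₁ Φ₂ : Ctx}, Sub θ (Φ.toX n) (Φ₁.toX n) → (Φ₂.toX n).nf = (Φ₁.toX n).nf →
      Has S.er Ψ'.sctx (Φ₂.toX n) (.ctx n Φ.er) →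
      ∃ σ' : Sbn, Sub θ σ.toX σ'.toX ∧ SbnChk S Ψ' σ' n Φ₂
  | _, _, _, _, .nil, _, _, _, _, _, Φ₂, _, _, h => by
    have := h.ctx_er
    cases Φ₂ with
    | nil => exact ⟨.nil, .leaf _, .nil⟩
    | snoc => cases this
  | Ψ, _, _, _, @SbnChk.clo _ _ σ n k Φ Γ Γ₁ A A₁ N hσ hΓ hA hN, hΦ, Ψ', θ, M, Φ₁, Φ₂, h1, e1, h2 => by
    have ih1 := fun h => @SbnChk.sub hS IH _ _ _ _ hσ h _ _ M
    have ih2 := @TmChk.sub hS IH _ _ _ hN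
    have hW : 0 < b → Weakens S := fun h => TmPres.weakens hS (IH 0 h)
    obtain ⟨g1, g2, g3⟩ := hΦ.ctx_snoc_inv
    have g4 := hσ.has hS M.src g1
    have g5 := (g3.hdecl_inst_iff g2 g1.ok g4).1 ⟨hΓ, hA⟩
    obtain ⟨Φ₁', Φ₂', A₂, Γ₂, rfl, e2, h3, e3, h4, h5⟩ := M.entry_conv hΦ g4 g5 h1 e1 h2
    obtain ⟨σ', h6, h7⟩ := ih1 g1 h3 e3 h4
    obtain ⟨A', A₃, Γ', Γ₃, h8, e4, h9, h10⟩ := h5 h6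
    obtain ⟨A₀, Γ₀, h11, h12, e5, e6⟩ := g3.exists_decl (HasEnv.inst g1.ok g4) (Bd.inst g1.ok)
    rw [Ctx.hat_er] at h11
    obtain ⟨rfl, rfl⟩ := declX_inj (h11.det g5)
    obtain ⟨-, -, h13, h14⟩ := h12.decl_inv
    obtain ⟨-, h15, h16⟩ := h8.declX_inv
    obtain ⟨e7, e8⟩ := declX_nf_iff'.1 e4
    obtain ⟨-, e9, h17, h18⟩ := h9.decl_inv
    have eΨ := M.src.good.sctx_merge (Φ := Γ₀) (n := k) (by rw [e6]; exact h14.ok)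
    have eΨ' := M.tgt.good.sctx_merge (Φ := Γ₃) (n := k) (by rw [e9]; exact h18.ok)
    have M' := M.enter hW k (e6 ▸ h14) (e6 ▸ h18) h16 e8
    obtain ⟨N', h19, h20⟩ := ih2 (by rw [eΨ, e5, e6]; exact h13) M' h15 e7
      (by rw [eΨ', e5, e9]; exact h17)
    have h21 := SbnChk.clo h7 h10.1 h10.2 h20
    rw [e2] at h21
    exact ⟨.snoc σ' (.clo k Γ.hat N'), .pair h6 (.clo h19), h21⟩
  | Ψ, _, _, _, @SbnChk.ren _ _ σ n k i Φ Γ Γ₁ Γ₀ A A₁ A₀ hσ hΓ hA hl a1 a2, hΦ, Ψ', θ, M, Φ₁, Φ₂,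
      h1, e1, h2 => by
    have ih1 := fun h => @SbnChk.sub hS IH _ _ _ _ hσ h _ _ M
    have hW : 0 < b → Weakens S := fun h => TmPres.weakens hS (IH 0 h)
    obtain ⟨g1, g2, g3⟩ := hΦ.ctx_snoc_inv
    have g4 := hσ.has hS M.src g1
    have g5 := (g3.hdecl_inst_iff g2 g1.ok g4).1 ⟨hΓ, hA⟩
    obtain ⟨Φ₁', Φ₂', A₂, Γ₂, rfl, e2, h3, e3, h4, h5⟩ := M.entry_conv hΦ g4 g5 h1 e1 h2
    obtain ⟨σ', h6, h7⟩ := ih1 g1 h3 e3 h4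
    obtain ⟨A', A₃, Γ', Γ₃, h8, e4, h9, h10⟩ := h5 h6
    obtain ⟨A₄, Γ₄, h11, h12, e5, e6⟩ := g3.exists_decl (HasEnv.inst g1.ok g4) (Bd.inst g1.ok)
    rw [Ctx.hat_er] at h11
    obtain ⟨rfl, rfl⟩ := declX_inj (h11.det g5)
    have a3 := (declX_nf_iff (k := k)).2 ⟨a1, a2⟩
    have h13 := M.src.has hl
    obtain ⟨e7, e8⟩ := h13.decl_unique h12 a3
    obtain ⟨A₅, Γ₅, h14, h15⟩ := M.img (Ctx.look_of_lookup hl)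
    rw [e7, e8] at h13
    have e9 : (declX k A₅ Γ₅).nf = (declX k A₃ Γ₃).nf := Eq.trans
      (RespAt.full (Sub.resp _) h13 h12 a3 M.env M.env M.bd M.bd (EqE.refl _ _) h14 h8) e4.symm
    rcases h15 with ⟨i', D', h16, h17, h18⟩ | ⟨N, h16, h17⟩
    · obtain ⟨A₆, Γ₆, h19, rfl⟩ := Ctx.lookup_of_look h17
      obtain ⟨a4, a5⟩ := declX_nf_iff.1 (h18.trans e9)
      exact ⟨.snoc σ' (.ren k i'), .pair h6 (.ren h16 (.ren i')), .ren h7 h10.1 h10.2 h19 a4 a5⟩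
    · have hb : 0 < b := by
        rcases M.bd k i _ _ (Ctx.sctx_of_lookup hl) with ⟨i', e⟩ | h
        · rw [e] at h16; cases h16
        · omega
      obtain ⟨A₆, Γ₆, h19, h20, e10, e11⟩ := h13.exists_decl M.env M.bd
      obtain ⟨rfl, rfl⟩ := declX_inj (h19.det h14)
      obtain ⟨-, -, h21, h22⟩ := h20.decl_inv
      obtain ⟨-, e12, h23, h24⟩ := h9.decl_inv
      obtain ⟨e13, e14⟩ := declX_nf_iff'.1 e9
      have o : Γ₆.er.Ok (some k) := by rw [e11]; exact h22.ok
      have eΨ := M.tgt.good.sctx_merge o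
      -- The body of the closure is well-typed over the declared context and type.  The identity, a
      -- morphism of bound `0`, converts it to the equal ones that are required.
      have M' := (Mor.id M.tgt).enter (fun h => absurd h (lt_irrefl 0)) k (e11 ▸ h22)
        (e11 ▸ h24) (h22.sub_id fun _ _ _ _ => rfl) e14.symm
      have h25 : Has S.er ((Ψ'.chop k).merge Γ₆).sctx A₆.toX (.ty A₆.er) := by
        rw [eΨ, e10, e11]; exact h21
      have hid : ∀ l i (d : T × T), ((Ψ'.chop k).merge Γ₆).sctx l i = some d →
          enterE k idE l i = .ren l i := fun l i d _ => by simp [enterE, belowOr, idE]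
      obtain ⟨N', h26, h27⟩ := IH 0 hb h17 h25 M' (h25.sub_id hid) e13.symm
        (by rw [M.tgt.good.sctx_merge (by rw [e12]; exact h24.ok), e10, e12]; exact h23)
      cases Tm.toX_inj (h26.det ((h17.has hS M'.src h25).sub_id hid))
      have h28 := SbnChk.clo h7 h10.1 h10.2 h27
      rw [show Γ₂.hat = Γ₆.hat by rw [e2, ← Ctx.hat_er Γ₆, e11, Ctx.hat_er]] at h28
      exact ⟨.snoc σ' (.clo k Γ₆.hat N), .pair h6 (.ren h16 (.clo _ _)), h28⟩
termination_by structural _ _ _ _ h => h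
/-- Morphisms preserve well-formed contexts. -/
theorem CtxWf.sub (hS : S.Typed) (IH : ∀ b' < b, TmPres S b') :
    ∀ {Ψ : Ctx} {n : ℕ} {Φ : Ctx}, CtxWf S Ψ n Φ → ∀ {Ψ' : Ctx} {θ : Env}, Mor S b Ψ' θ Ψ →
      ∃ Φ' : Ctx, Sub θ (Φ.toX n) (Φ'.toX n) ∧ CtxWf S Ψ' n Φ'
  | _, _, _, .nil, _, _, _ => ⟨.nil, .leaf _, .nil⟩
  | Ψ, _, _, @CtxWf.snoc _ _ n k Φ Γ A hΦ hk hl hA hΓ, Ψ', θ, M => by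
    have ih1 := @TyChk.sub hS IH _ _ _ hA
    have ih2 := @CtxWf.sub hS IH _ _ _ hΓ
    have hW : 0 < b → Weakens S := fun h => TmPres.weakens hS (IH 0 h)
    obtain ⟨Φ', h1, h2⟩ := CtxWf.sub hS IH hΦ M
    have g1 := hΦ.has hS M.src
    obtain ⟨Φ₁, h3, h4, e1⟩ := g1.exists_ctx M.env M.bd
    cases Ctx.toX_inj (h3.det h1)
    have e2 : Φ'.hat = Φ.hat := by rw [← Ctx.hat_er, e1, Ctx.hat_er]
    have hl' : ∀ l ∈ Φ'.hat, k ≤ l := e2 ▸ hl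
    have M1 := M.enter hW n g1 h4 h1 rfl
    rw [Ctx.chop_of_ge hl] at hA hΓ ih1 ih2
    obtain ⟨Γ', h5, h6⟩ := ih2 M1
    have g2 := hΓ.has hS M1.src
    obtain ⟨Γ₁, h7, h8, e3⟩ := g2.exists_ctx M1.env M1.bd
    cases Ctx.toX_inj (h7.det h5)
    have M2 := M1.enter hW k g2 h8 h5 rfl
    rw [CtxWf.snoc_env M.src.good hk hl, CtxWf.snoc_env M.tgt.good hk hl'] at M2
    obtain ⟨A', h9, h10⟩ := ih1 M2
    refine ⟨.snoc Φ' k A' Γ', ?_, ?_⟩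
    · rw [Ctx.toX, Ctx.toX, e2, ← Ctx.hat_er Γ', e3, Ctx.hat_er]
      exact .pair h1 (.clo (.pair (.clo h9) h5))
    · refine .snoc h2 hk hl' ?_ ?_ <;> rwa [Ctx.chop_of_ge hl']
termination_by structural _ _ _ h => h
end

/-- Morphisms preserve the typing of normal terms, by induction on their bounds. -/
theorem Sig.Typed.tmPres (hS : S.Typed) (b : ℕ) : TmPres S b := by
  induction b using Nat.strong_induction_on with
  | _ b IH => exact @TmChk.sub S b hS IH

/-! ### The substitution property -/

/-- A neutral term which is checked has a base type. -/
theorem Has.neut_base {G : SCtx} {R : Ne} {α : T} (h : Has s G R.toX (.chk α)) :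
    ∃ l, α = .base l := by
  generalize e : R.toX = M at h
  cases h with
  | ne => exact ⟨_, rfl⟩
  | lam => have := R.toX_isLam; rw [e] at this; cases this

theorem Tm.toX_eq_ne {N : Tm} {R : Ne} (h : N.toX = R.toX) : N = .ne R :=
  Tm.toX_inj (N := .ne R) h

/-- A morphism which is given by a substitution preserves all judgments. -/
theorem Mor.holdsSubst (hS : S.Typed) (M : Mor S b Ψ' θ Ψ) {τ : Sb} (hA : Agree Ψ.sctx τ θ)
    {j : Judgment} (hp : Presupposed S Ψ j) (h : Holds S Ψ j) : HoldsSubst S Ψ' τ j := by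
  have IH : ∀ b' < b, TmPres S b' := fun b' _ => hS.tmPres b'
  have hty : ∀ {A A' : Ty} {α : T}, Has S.er Ψ.sctx A.toX (.ty α) → Sub θ A.toX A'.toX →
      IsValue (HTy τ A) A' := fun h h1 =>
    IsValue.of_det ((h.hty_iff M.env M.bd hA).2 h1) HTy.det
  cases j with
  | atySyn P K =>
    obtain ⟨g1, g2⟩ := ATySyn.has hS h M.src
    obtain ⟨P', K', K'', h1, h2, h3, e⟩ := ATySyn.sub hS IH h M
    obtain ⟨Q, Q', e1, e2, h4⟩ := Sub.graph b g1 M.env M.bd hA h1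
    cases ATy.toX_inj e1
    cases ATy.toX_inj e2
    exact ⟨P', K', K'', .of_det h4 HATy.det, hty g2 h2, h3, Ty.eqv_iff.2 e⟩
  | tyChk A t =>
    obtain ⟨A', h1, h2⟩ := TyChk.sub hS IH h M
    exact ⟨A', hty (TyChk.has hS h M.src) h1, h2⟩
  | neSyn R C =>
    obtain ⟨g1, g2⟩ := NeSyn.has hS h M.src
    obtain ⟨C', h1, h2⟩ := NeSyn.sub hS IH h M
    obtain ⟨C₁, h3, g3, e0⟩ := g2.exists_ty M.env M.bd
    cases Ty.toX_inj (h3.det h1)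
    have ha : C.er.toApx = C'.erase := by rw [← e0, Ty.er_toApx]
    rcases h2 with ⟨R', C'', h4, h5, e⟩ | ⟨N, h4, h5⟩
    · obtain ⟨R₀, e1, ⟨R₁, e2, h6, -⟩ | ⟨N, e2, h6, h7, -⟩⟩ := Sub.graph b g1 M.env M.bd hA h4
      · cases Ne.toX_inj e1
        cases Ne.toX_inj e2
        exact ⟨.ne R', C', .of_det h6 HNe.det, hty g2 h1, C'', h5, Ty.eqv_iff.2 e⟩
      · cases Ne.toX_inj e1
        -- A normal result which happens to be neutral has a base type, so that it checks against
        -- its type.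
        cases Tm.toX_eq_ne e2.symm
        refine ⟨.nm (.ne R') C.er.toApx, C', .of_det h6 HNe.det, hty g2 h1, ?_, ha⟩
        obtain ⟨l, el⟩ := h7.neut_base
        obtain ⟨Q, rfl⟩ := Ty.er_base (e0.trans el)
        obtain ⟨P, rfl⟩ := Ty.er_base (((NeSyn.has hS h5 M.tgt).2.ty_unique g3 e).trans el)
        exact .ne h5 (Ty.eqv_iff.2 e)
    · have h8 := h5 C' rfl g3
      obtain ⟨R₀, e1, ⟨R₁, e2, h6, -⟩ | ⟨N', e2, h6, -, -⟩⟩ := Sub.graph b g1 M.env M.bd hA h4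
      · cases Ne.toX_inj e1
        cases Tm.toX_eq_ne e2
        cases h8 with
        | ne h8 e => exact ⟨.ne R₁, _, .of_det h6 HNe.det, hty g2 h1, _, h8, e⟩
      · cases Ne.toX_inj e1
        cases Tm.toX_inj e2
        exact ⟨.nm N _, C', .of_det h6 HNe.det, hty g2 h1, h8, ha⟩
  | tmChk N C =>
    have g2 := TyChk.has hS hp M.src
    have g1 := TmChk.has hS h M.src g2
    obtain ⟨C', h1, g3, e⟩ := g2.exists_ty M.env M.bd
    obtain ⟨N', h2, h3⟩ := TmChk.sub hS IH h g2 M h1 rfl g3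
    obtain ⟨N₁, N₂, e1, e2, h4⟩ := Sub.graph b g1 M.env M.bd hA h2
    cases Tm.toX_inj e1
    cases Tm.toX_inj e2
    exact ⟨N', C', .of_det h4 HTm.det, hty g2 h1, h3⟩
  | sbnChk σ m Γ =>
    have g2 := CtxWf.has hS hp M.src
    have g1 := SbnChk.has hS h M.src g2
    obtain ⟨Γ', h1, g3, e⟩ := g2.exists_ctx M.env M.bd
    obtain ⟨σ', h2, h3⟩ := SbnChk.sub hS IH h g2 M h1 rfl g3
    obtain ⟨σ₁, σ₂, e1, e2, h4⟩ := Sub.graph b g1 M.env M.bd hA h2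
    cases Sbn.toX_inj e1
    cases Sbn.toX_inj e2
    exact ⟨σ', Γ', .of_det h4 HSbn.det,
      .of_det ((g2.hctx_iff M.env M.bd hA).2 h1) HCtx.det, h3⟩
  | ctxWf m Γ =>
    have g2 := CtxWf.has hS h M.src
    obtain ⟨Γ', h1, h2⟩ := CtxWf.sub hS IH h M
    exact ⟨Γ', .of_det ((g2.hctx_iff M.env M.bd hA).2 h1) HCtx.det, h2⟩

theorem CtxWf.nil_merge : ∀ {Δ : Ctx} {m : ℕ}, CtxWf S .nil m Δ → Ctx.nil.merge Δ = Δ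
  | .nil, _, _ => rfl
  | .snoc Δ k A Γ, _, h => by
    cases h with
    | snoc h _ hl => rw [Ctx.merge, h.nil_merge, Ctx.ins_of_ge _ _ hl]

/-- In a well-formed context all declarations are simply typed. -/
theorem CtxWf.swf (hS : S.Typed) {Δ : Ctx} {m : ℕ} (h : CtxWf S .nil m Δ) : Δ.SWf S.er := by
  have := Ctx.SWf.merge .nil (h.has hS .nil)
  rwa [Ctx.chop, h.nil_merge] at this

end MLCTT

theorem mainTheorem3 (S : MLCTT.Sig) (hS : S.Wf) :
    (∀ (n N : ℕ) (Δ Ψ Φ : MLCTT.Ctx) (σ : MLCTT.Sbn) (J : MLCTT.Judgment),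
      MLCTT.CtxWf S .nil N Δ →
      MLCTT.CtxWf S (Δ.chop n) n Ψ →
      MLCTT.CtxWf S (Δ.chop n) n Φ →
      MLCTT.SbnChk S ((Δ.chop n).merge Ψ) σ n Φ →
      MLCTT.Presupposed S ((Δ.chop n).merge Φ) J →
      MLCTT.Holds S ((Δ.chop n).merge Φ) J →
      MLCTT.HoldsSubst S ((Δ.chop n).merge Ψ) (.simul n σ Φ.erase) J) ∧
    (∀ (n m : ℕ) (Ψ Φ : MLCTT.Ctx) (A : MLCTT.Ty) (N : MLCTT.Tm) (J : MLCTT.Judgment),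
      MLCTT.CtxWf S .nil m Ψ →
      MLCTT.CtxWf S Ψ n Φ →
      MLCTT.TyChk S ((Ψ.chop n).merge Φ) A .type →
      MLCTT.TmChk S ((Ψ.chop n).merge Φ) N A →
      MLCTT.Presupposed S (Ψ.ins n A Φ) J →
      MLCTT.Holds S (Ψ.ins n A Φ) J →
      MLCTT.HoldsSubst S Ψ (.single n 0 Φ.hat N A.erase Φ.erase) J) := by
  have hT := hS.typed
  constructor
  · intro n N Δ Ψ Φ σ J hΔ hΨ hΦ hσ hp h
    have g := (hΔ.swf hT).chop n
    have g1 := hΨ.has hT g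
    have g2 := hΦ.has hT g
    have g3 := g.merge g1
    rw [MLCTT.Ctx.chop_chop le_rfl] at g3
    have e1 : (((Δ.chop n).merge Ψ).chop n) = Δ.chop n :=
      MLCTT.Ctx.chop_merge le_rfl Δ fun l hl => g1.ok.lt l (by rwa [MLCTT.Ctx.hat_er])
    have e2 := (hΔ.swf hT).good.sctx_merge g1.ok
    -- `Φ` depends only on variables of levels `≥ n`, on which the two contexts agree.
    have g4 : MLCTT.Has S.er ((Δ.chop n).merge Ψ).sctx (Φ.toX n) (.ctx n Φ.er) :=
      g2.ctx_congr rfl fun l i hl => by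
        rw [e2, (hΔ.swf hT).good.sctx_chop, MLCTT.belowOr_ge hl, MLCTT.belowOr_ge hl]
    have M := MLCTT.Mor.inst hT g3 hσ g4
    have hA := MLCTT.Agree.inst g4.ok (hσ.has hT g3 g4)
    rw [← g3.good.sctx_merge g4.ok, MLCTT.Ctx.er_toCApx, MLCTT.Ctx.hat_er] at hA
    rw [e1] at M hA
    exact M.holdsSubst hT hA hp h
  · intro n m Ψ Φ A N J hΨ hΦ hA hN hp h
    have g := hΨ.swf hT
    have g1 := hΦ.has hT g
    have g2 := hA.has hT (g.merge g1)
    rw [g.good.sctx_merge g1.ok] at g2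
    have M := MLCTT.Mor.single hT g (g2.declX g1) hN
    have hA := MLCTT.Agree.single Ψ.sctx n Φ.hat N A.er Φ.er
    rw [← MLCTT.Ctx.sctx_ins, MLCTT.Ty.er_toApx, MLCTT.Ctx.er_toCApx] at hA
    exact M.holdsSubst hT hA hp h
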